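/- Let $0=s_0<s_1<\dots<s_{K-1}<s_K=\infty$ be a grid and let $k(x)$ denote the $k$ with $x\in(s_{k-1},s_k]$ (and $k(0)=1$). Let $\Theta$ be a parameter set and, for each $\theta\in\Theta$, let $T_k(\theta)=(\mu^k_{ij}(\theta))_{1\le i,j\le p}$, $k=1,\dots,K$, be sub-intensity matrices with exit rate vectors $t_k(\theta)=-T_k(\theta)e$, where $e=(1,\dots,1)'$; write $\mu^k_{i,p+1}(\theta)=(t_k(\theta))_i$. Fix $\theta\in\Theta$ and a probability vector $\pi$ on $\{1,\dots,p\}$ (the current parameters; $\theta$ is suppressed below). Let $X^{(1)},\dots,X^{(N)}$, $N\ge 1$, be i.i.d. time-inhomogeneous Markov jump processes (with right-continuous step paths) on $E=\{1,\dots,p+1\}$ with initial distribution $(\pi,0)$ and intensity matrix function $\begin{pmatrix}T_k&t_k\\0&0\end{pmatrix}$ on $(s_{k-1},s_k]$, so that $p+1$ is absorbing; let $\tau^{(n)}$ be the absorption time of $X^{(n)}$, assumed a.s. finite, $\tau=(\tau^{(1)},\dots,\tau^{(N)})$ and $k^{(n)}=k(\tau^{(n)})$. Let $B_i$ be the number of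 $n$ with $X^{(n)}(0)=i$, and let $E_i(k)$ and $O_{ij}(k)$ be, respectively, the total time spent in $i$ and the total number of jumps from $i$ to $j$ during $(s_{k-1},s_k]$, summed over $n$. For $0\le s\le t$ put $$\bar P(s,t)=\begin{cases} e^{T_{k(s)}(s_{k(s)}-s)}\Big(\prod_{\ell=k(s)+1}^{k(t)-1}e^{T_\ell(s_\ell-s_{\ell-1})}\Big)e^{T_{k(t)}(t-s_{k(t)-1})}, & k(s)<k(t),\\ e^{T_{k(t)}(t-s)}, & k(s)=k(t),\end{cases}\qquad f(x)=\pi\bar P(0,x)\,t_{k(x)}$$ (products ordered from left to right by increasing $\ell$; empty products are the identity). Then a.s. $\tau^{(n)}>0$ and $f(\tau^{(n)})>0$ for all $n$, the statistics below are integrable, and almost surely, for $i,j\in\{1,\dots,p\}$, $j\ne i$, and $k=1,\dots,K$, with $e_i$ the $i$-th unit vector, $$\bar B_i:=\mathbb E[B_i\mid\tau]=\sum_{n=1}^N\frac{\pi_i\,e_i'\bar P(0,\tau^{(n)})t_{k^{(n)}}}{f(\tau^{(n)})},$$ $$\bar E_i(k):=\mathbb E[E_i(k)\mid\tau]=\sum_{n=1}^N\frac{\int_{s_{k-1}\wedge\tau^{(n)}}^{s_k\wedge\tau^{(n)}}\pi\bar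 P(0,u)e_i\,e_i'\bar P(u,\tau^{(n)})t_{k^{(n)}}\,du}{f(\tau^{(n)})},$$ $$\bar O_{ij}(k):=\mathbb E[O_{ij}(k)\mid\tau]=\sum_{n=1}^N\frac{\int_{s_{k-1}\wedge\tau^{(n)}}^{s_k\wedge\tau^{(n)}}\pi\bar P(0,u)e_i\,\mu^k_{ij}\,e_j'\bar P(u,\tau^{(n)})t_{k^{(n)}}\,du}{f(\tau^{(n)})},$$ $$\bar O_{i,p+1}(k):=\mathbb E[O_{i,p+1}(k)\mid\tau]=\sum_{n=1}^N\mathbf 1_{\{\tau^{(n)}\in(s_{k-1},s_k]\}}\frac{\pi\bar P(0,\tau^{(n)})e_i\,e_i't_{k^{(n)}}}{f(\tau^{(n)})}.$$ Consequently, let $$\mathcal L(\varpi,\vartheta;B,E,O)=\prod_{i\le p}\varpi_i^{B_i}\prod_{k=1}^K\prod_{i\le p}\prod_{j\in E,\,j\ne i}\mu^k_{ij}(\vartheta)^{O_{ij}(k)}e^{-E_i(k)\mu^k_{ij}(\vartheta)}\qquad(0^0=1)$$ be the complete-data likelihood. (E-step) For every probability vector $\varpi$ and $\vartheta\in\Theta$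 with $\mathcal L(\varpi,\vartheta;B,E,O)>0$ a.s., $\log\mathcal L(\varpi,\vartheta;B,E,O)$ is integrable and $\mathbb E[\log\mathcal L(\varpi,\vartheta;B,E,O)\mid\tau]=\log\mathcal L(\varpi,\vartheta;\bar B,\bar E,\bar O)$ a.s. (M-step) Evaluate $\bar B,\bar E,\bar O$ by the above formulas at data $x\in(0,\infty)^N$ (in place of $\tau$) with $f(x_n)>0$ for all $n$. Then $(\varpi,\vartheta)$ maximizes $\mathcal L(\cdot,\cdot\,;\bar B,\bar E,\bar O)$ over all probability vectors and $\Theta$ if and only if $\varpi_i=\bar B_i/N$ for all $i$ and $\vartheta$ maximizes over $\Theta$ the Poisson regression likelihood $$\prod_{k=1}^K\prod_{i\le p}\prod_{j\in E,\,j\ne i}\frac{(\bar E_i(k)\mu^k_{ij}(\vartheta))^{\bar O_{ij}(k)}e^{-\bar E_i(k)\mu^k_{ij}(\vartheta)}}{\Gamma(\bar O_{ij}(k)+1)} .$$ -/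

import Mathlib

open MeasureTheory ProbabilityTheory Filter Topology
open scoped NNReal ENNReal Matrix

noncomputable section

namespace IPH

/-- The state space: `Sum.inl i` for the `p` transient states, `Sum.inr ()` for the absorbing
state `p + 1`. -/
abbrev State (p : ℕ) : Type := Fin p ⊕ Unit

/-- The absorbing state. -/
abbrev absorbing (p : ℕ) : State p := Sum.inr ()

/-! ### Grid and intensity matrices -/

/-- A grid `0 = s₀ < s₁ < ⋯ < s_{K-1} < s_K = ∞`. The cell with index `k : Fin K` (counted from
zero) is `(s_k, s_{k+1}]`, that is `(pts k.castSucc, pts k.succ]`. -/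
structure Grid (K : ℕ) where
  pts : Fin (K + 1) → EReal
  pts_zero : pts 0 = 0
  pts_last : pts (Fin.last K) = ⊤
  strictMono : StrictMono pts

/-- The cell `(s_{k-1}, s_k]` as a set of real numbers. -/
def Grid.cell {K : ℕ} (g : Grid K) (k : Fin K) : Set ℝ :=
  {u : ℝ | g.pts k.castSucc < (u : EReal) ∧ (u : EReal) ≤ g.pts k.succ}

theorem Grid.exists_le {K : ℕ} (g : Grid K) (x : ℝ) :
    (Finset.univ.filter fun k : Fin K => (x : EReal) ≤ g.pts k.succ).Nonempty := by
  cases K with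
  | zero =>
    exfalso
    have h0 : g.pts 0 = ⊤ := g.pts_last
    rw [g.pts_zero] at h0
    exact EReal.zero_ne_top h0
  | succ K =>
    refine ⟨Fin.last K, ?_⟩
    have h1 : g.pts (Fin.last K).succ = ⊤ := g.pts_last
    rw [Finset.mem_filter, h1]
    exact ⟨Finset.mem_univ _, le_top⟩

/-- The place `k(x)` of `x` on the grid: the least `k` with `x ≤ s_k`. For `x > 0` it is the
unique `k` with `x ∈ (s_{k-1}, s_k]`; for `x = 0` it is the first cell. -/
def Grid.index {K : ℕ} (g : Grid K) (x : ℝ) : Fin K :=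
  (Finset.univ.filter fun k : Fin K => (x : EReal) ≤ g.pts k.succ).min' (g.exists_le x)

/-- Left end point of a cell, a real number. -/
def Grid.left {K : ℕ} (g : Grid K) (k : Fin K) : ℝ := (g.pts k.castSucc).toReal

/-- Right end point of a cell as a real number; only meaningful, and only used, for cells other
than the last one. -/
def Grid.right {K : ℕ} (g : Grid K) (k : Fin K) : ℝ := (g.pts k.succ).toReal

/-- `s_{k-1} ∧ x`. -/
def Grid.leftMin {K : ℕ} (g : Grid K) (k : Fin K) (x : ℝ) : ℝ :=
  (min (g.pts k.castSucc) (x : EReal)).toReal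

/-- `s_k ∧ x`. -/
def Grid.rightMin {K : ℕ} (g : Grid K) (k : Fin K) (x : ℝ) : ℝ :=
  (min (g.pts k.succ) (x : EReal)).toReal

/-- A sub-intensity matrix: nonnegative off-diagonal entries, nonpositive row sums. -/
def IsSubIntensity {p : ℕ} (T : Matrix (Fin p) (Fin p) ℝ) : Prop :=
  (∀ i j, i ≠ j → 0 ≤ T i j) ∧ ∀ i, ∑ j, T i j ≤ 0

/-- The exit rates `t = -T e`. -/
def exitRate {p : ℕ} (T : Matrix (Fin p) (Fin p) ℝ) : Fin p → ℝ := -(T *ᵥ 1)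

/-- The intensity matrix `Λ = [[T, t], [0, 0]]` on all states. -/
def intensity {p : ℕ} (T : Matrix (Fin p) (Fin p) ℝ) : Matrix (State p) (State p) ℝ :=
  Matrix.fromBlocks T (Matrix.of fun i _ => exitRate T i) 0 0

/-- The piecewise constant intensity matrix function: `Λ(u) = Λ_k` for `u ∈ (s_{k-1}, s_k]`. -/
def Grid.intensityFun {K p : ℕ} (g : Grid K) (T : Fin K → Matrix (Fin p) (Fin p) ℝ) (u : ℝ) :
    Matrix (State p) (State p) ℝ :=
  intensity (T (g.index u))

/-- The initial distribution `α = (π, 0)`. -/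
def initialLaw {p : ℕ} (π : Fin p → ℝ) : State p → ℝ := Sum.elim π 0

/-! ### Time-inhomogeneous Markov jump processes -/

/-- `Q(s,t)`, `0 ≤ s ≤ t`, is the product integral of `I + Λ(u) du` over `(s, t]`, that is the
solution of the Kolmogorov forward (Volterra) equation
`Q(s,t) = I + ∫_s^t Q(s,u) Λ(u) du`. -/
def IsTransitionFunction {S : Type*} [Fintype S] [DecidableEq S]
    (Λ : ℝ → Matrix S S ℝ) (Q : ℝ → ℝ → Matrix S S ℝ) : Prop :=
  ∀ s t : ℝ, 0 ≤ s → s ≤ t → ∀ i j : S,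
    IntervalIntegrable (fun u => (Q s u * Λ u) i j) volume s t ∧
      Q s t i j = (1 : Matrix S S ℝ) i j + ∫ u in s..t, (Q s u * Λ u) i j

/-- `X` is a Markov jump process on the finite set `S` with initial distribution `α` and intensity
matrix function `Λ`: its paths are right-continuous with left limits in the discrete space `S`
(so they are step functions with finitely many jumps on bounded intervals), and its
finite-dimensional distributions are those of the Markov process with initial distribution `α` and
the transition probabilities generated by `Λ`. -/
structure IsMarkovJumpProcess {Ω S : Type*} [MeasurableSpace Ω] [Fintype S] [DecidableEq S]
    [MeasurableSpace S] (P : Measure Ω) (α : S → ℝ) (Λ : ℝ → Matrix S S ℝ)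
    (X : ℝ≥0 → Ω → S) : Prop where
  measurable : ∀ t, Measurable (X t)
  right_continuous : ∀ ω t, ∀ᶠ u in 𝓝[>] t, X u ω = X t ω
  left_limit : ∀ ω t, 0 < t → ∃ i : S, ∀ᶠ u in 𝓝[<] t, X u ω = i
  law : ∃ Q : ℝ → ℝ → Matrix S S ℝ, IsTransitionFunction Λ Q ∧
    ∀ (m : ℕ) (t : Fin (m + 1) → ℝ≥0), t 0 = 0 → Monotone t → ∀ x : Fin (m + 1) → S,
      P.real {ω | ∀ l, X (t l) ω = x l} =
        α (x 0) * ∏ l : Fin m, Q (t l.castSucc) (t l.succ) (x l.castSucc) (x l.succ)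

/-- The absorption time `τ = inf {t ≥ 0 : X(t) = p + 1}`, with `inf ∅ = ∞`. -/
def absorptionTime {Ω : Type*} {p : ℕ} (X : ℝ≥0 → Ω → State p) (ω : Ω) : ℝ≥0∞ :=
  ⨅ (t : ℝ≥0) (_ : X t ω = absorbing p), (t : ℝ≥0∞)

/-- The vector `(τ⁽¹⁾, …, τ⁽ᴺ⁾)` of observed absorption times. -/
def absorptionTimes {Ω : Type*} {N p : ℕ} (X : Fin N → ℝ≥0 → Ω → State p) (ω : Ω) :
    Fin N → ℝ≥0∞ :=
  fun n => absorptionTime (X n) ω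

/-- The σ-algebra generated by the observed absorption times. -/
abbrev obsSigma {Ω : Type*} {N p : ℕ} (X : Fin N → ℝ≥0 → Ω → State p) : MeasurableSpace Ω :=
  MeasurableSpace.comap (absorptionTimes X) inferInstance

/-- The observed absorption times as real numbers. -/
def obs {Ω : Type*} {N p : ℕ} (X : Fin N → ℝ≥0 → Ω → State p) (ω : Ω) : Fin N → ℝ :=
  fun n => (absorptionTimes X ω n).toReal

/-! ### Complete-data sufficient statistics -/

/-- Number `B_i` of initiations in the transient state `i`. -/
def initiations {Ω : Type*} {N p : ℕ} (X : Fin N → ℝ≥0 → Ω → State p) (i : Fin p) (ω : Ω) : ℝ :=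
  ∑ n, if X n 0 ω = Sum.inl i then 1 else 0

/-- Local exposure `E_i(k)`: the total time spent in the transient state `i` during
`(s_{k-1}, s_k]`. -/
def exposure {Ω : Type*} {N p K : ℕ} (g : Grid K) (X : Fin N → ℝ≥0 → Ω → State p)
    (i : Fin p) (k : Fin K) (ω : Ω) : ℝ :=
  ∑ n, ∫ u in g.cell k, if X n u.toNNReal ω = Sum.inl i then (1 : ℝ) else 0

/-- The set of times in `(s_{k-1}, s_k]` at which the path `x` jumps from `i` to `j`. -/
def jumpTimes {p K : ℕ} (g : Grid K) (x : ℝ≥0 → State p) (i j : State p) (k : Fin K) : Set ℝ≥0 :=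
  {u | (u : ℝ) ∈ g.cell k ∧ (∀ᶠ v in 𝓝[<] u, x v = i) ∧ x u = j}

/-- Occurrences `O_{ij}(k)`: the total number of jumps from the transient state `i` to the state
`j` during `(s_{k-1}, s_k]`. -/
def occurrences {Ω : Type*} {N p K : ℕ} (g : Grid K) (X : Fin N → ℝ≥0 → Ω → State p)
    (i : Fin p) (j : State p) (k : Fin K) (ω : Ω) : ℝ :=
  ∑ n, ((jumpTimes g (fun u => X n u ω) (Sum.inl i) j k).ncard : ℝ)

/-! ### Matrix exponential formulas -/

/-- The ordered product `∏_{k₁ < l < k₂} exp(T_l (s_l - s_{l-1}))`, in increasing order of `l`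
from left to right; the empty product is the identity. -/
def cellProd {K p : ℕ} (g : Grid K) (T : Fin K → Matrix (Fin p) (Fin p) ℝ) (k₁ k₂ : Fin K) :
    Matrix (Fin p) (Fin p) ℝ :=
  (((List.finRange K).filter fun l => k₁ < l ∧ l < k₂).map
    fun l => NormedSpace.exp ((g.right l - g.left l) • T l)).prod

/-- The transition sub-probability matrix `P̄(s,t)`, `0 ≤ s ≤ t`, between the transient states. -/
def subTrans {K p : ℕ} (g : Grid K) (T : Fin K → Matrix (Fin p) (Fin p) ℝ) (s t : ℝ) :
    Matrix (Fin p) (Fin p) ℝ :=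
  if g.index s = g.index t then NormedSpace.exp ((t - s) • T (g.index t))
  else NormedSpace.exp ((g.right (g.index s) - s) • T (g.index s)) *
    cellProd g T (g.index s) (g.index t) *
    NormedSpace.exp ((t - g.left (g.index t)) • T (g.index t))

/-- The row vector `π P̄(0,u)`. -/
def forwardVec {K p : ℕ} (g : Grid K) (π : Fin p → ℝ) (T : Fin K → Matrix (Fin p) (Fin p) ℝ)
    (u : ℝ) : Fin p → ℝ :=
  π ᵥ* subTrans g T 0 u

/-- The column vector `P̄(u,x) t_{k(x)}`. -/
def backwardVec {K p : ℕ} (g : Grid K) (T : Fin K → Matrix (Fin p) (Fin p) ℝ) (u x : ℝ) :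
    Fin p → ℝ :=
  subTrans g T u x *ᵥ exitRate (T (g.index x))

/-- The density `f(x) = π P̄(0,x) t_{k(x)}`. -/
def density {K p : ℕ} (g : Grid K) (π : Fin p → ℝ) (T : Fin K → Matrix (Fin p) (Fin p) ℝ)
    (x : ℝ) : ℝ :=
  forwardVec g π T x ⬝ᵥ exitRate (T (g.index x))

/-- `B̄_i` as a function of the data `x = (x₁, …, x_N)`. -/
def expInitiations {K N p : ℕ} (g : Grid K) (π : Fin p → ℝ)
    (T : Fin K → Matrix (Fin p) (Fin p) ℝ) (x : Fin N → ℝ) (i : Fin p) : ℝ :=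
  ∑ n, π i * backwardVec g T 0 (x n) i / density g π T (x n)

/-- `Ē_i(k)` as a function of the data. -/
def expExposure {K N p : ℕ} (g : Grid K) (π : Fin p → ℝ)
    (T : Fin K → Matrix (Fin p) (Fin p) ℝ) (x : Fin N → ℝ) (i : Fin p) (k : Fin K) : ℝ :=
  ∑ n, (∫ u in (g.leftMin k (x n))..(g.rightMin k (x n)),
    forwardVec g π T u i * backwardVec g T u (x n) i) / density g π T (x n)

/-- `Ō_{ij}(k)` as a function of the data: the first case is that of a transient state `j`, the
second one is `j = p + 1`. -/
def expOccurrences {K N p : ℕ} (g : Grid K) (π : Fin p → ℝ)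
    (T : Fin K → Matrix (Fin p) (Fin p) ℝ) (x : Fin N → ℝ) (i : Fin p) :
    State p → Fin K → ℝ
  | Sum.inl j, k =>
    ∑ n, (∫ u in (g.leftMin k (x n))..(g.rightMin k (x n)),
      forwardVec g π T u i * T k i j * backwardVec g T u (x n) j) / density g π T (x n)
  | Sum.inr _, k =>
    ∑ n, (g.cell k).indicator (fun _ => (1 : ℝ)) (x n) *
      (forwardVec g π T (x n) i * exitRate (T (g.index (x n))) i) / density g π T (x n)

/-! ### Likelihoods -/

/-- The factor of the complete-data likelihood that depends on the initial distribution and on the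
initiations, `∏_i ϖ_i^{B_i}` (with `0^0 = 1`). -/
def initialLikelihood {p : ℕ} (ϖ : Fin p → ℝ) (B : Fin p → ℝ) : ℝ := ∏ i, ϖ i ^ B i

/-- The complete-data likelihood in the piecewise constant case,
`∏_i ϖ_i^{B_i} ∏_k ∏_{i ≠ j} (μ^k_{ij})^{O_{ij}(k)} exp(-E_i(k) μ^k_{ij})`, as a function of the
parameters and the statistics. -/
def completeLikelihood {K p : ℕ} (ϖ : Fin p → ℝ) (T : Fin K → Matrix (Fin p) (Fin p) ℝ)
    (B : Fin p → ℝ) (E : Fin p → Fin K → ℝ) (O : Fin p → State p → Fin K → ℝ) : ℝ :=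
  initialLikelihood ϖ B *
    ∏ k, ∏ i : Fin p, ∏ j ∈ Finset.univ.erase (Sum.inl i : State p),
      intensity (T k) (Sum.inl i) j ^ O i j k *
        Real.exp (-(E i k * intensity (T k) (Sum.inl i) j))

/-- The likelihood of independent Poisson responses `O_{ij}(k)` with means `E_i(k) μ^k_{ij}`.
The responses may be non-integers, so the factorial is a Gamma value. -/
def poissonLikelihood {K p : ℕ} (T : Fin K → Matrix (Fin p) (Fin p) ℝ)
    (E : Fin p → Fin K → ℝ) (O : Fin p → State p → Fin K → ℝ) : ℝ :=
  ∏ k, ∏ i : Fin p, ∏ j ∈ Finset.univ.erase (Sum.inl i : State p),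
    (E i k * intensity (T k) (Sum.inl i) j) ^ O i j k *
      Real.exp (-(E i k * intensity (T k) (Sum.inl i) j)) / Real.Gamma (O i j k + 1)

end IPH

end

namespace IPH

/-! ### Positions on the grid -/

section Index

variable {K : ℕ} (g : Grid K)

/-! For one path and one nonnegative statistic `Z`, the conditional expectation is read off from the
numbers E[Z; X(r) = p+1], r ≥ 0. The state p+1 is a trap, so up to a null set {X(r) = p+1} = {τ ≤
r}. If E[Z; X(r) = p+1] is the integral over (0, r] of the numerator in the asserted formula, then
that numerator is the density of the image of Z·P under τ. The case Z = 1 gives the density f of τ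
itself, and E[Z | τ] is the quotient of the two (`HasLaw.map_withDensity_eq`,
`HasLaw.setLIntegral_eq_div`).

To find these numbers, the transition function must be known. Its transient columns solve a linear
equation with piecewise constant coefficients, whose unique solution is the product of exponentials
(`eq_vecMul_subTrans_of_integral_eq`). Together with zero row sums of the intensity this gives
Chapman–Kolmogorov, Lipschitz bounds in time and a second-order bound for short times. Exposures
then follow from Tonelli's theorem. Jumps are counted along dyadic partitions: for each path the
count is eventually exact, the expected counts are Riemann-type sums with error of order 2^{-n}, and
the number of changes of state dominates them (`HasLaw.lintegral_ncard_jumpsIoc`). A second use of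
Tonelli, with absorption from u onwards written as the integral of its density, turns integrals up
to r into integrals over the absorption time x (`IsTransitionFunction.lintegral_mul_absorbing`).

Independent paths are reduced to one path. On restricting P to the event that the other paths are
absorbed by given times, the n-th path keeps its transition law and π becomes cπ
(`isMarkovJumpProcess_restrict`). Numerator and density are both linear in π, so c cancels when it
is positive. The formula thus holds on boxes, and boxes determine a finite measure
(`condExp_path_statistic`).

Integrability is in question because the last cell is unbounded. There the process is homogeneous
and absorption is almost surely finite, so the survival probability is halved over a fixed length of
time and is integrable (`IsTransitionFunction.exists_halving`).

The E-step holds because log L is linear in the statistics. On the boundary of the parameter set, a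
statistic belonging to a vanishing parameter is almost surely zero, and so is its conditional
expectation. For the M-step, L is a product of a multinomial factor, maximized uniquely by the
proportions (Gibbs' inequality), and a rate factor. The Poisson likelihood is a positive constant
times the rate factor, because a positive expected number of jumps out of i in a cell forces a
positive expected exposure there (`IsTransitionFunction.numExposure_pos_of_numOccurrences_ne_zero`).
The rate factor is positive at the current parameter, so a maximizer of the product has both factors
positive and maximizes each of them. -/

theorem Grid.index_le {x : ℝ} {k : Fin K} (h : (x : EReal) ≤ g.pts k.succ) : g.index x ≤ k :=
  Finset.min'_le _ _ (by simpa using h)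

theorem Grid.le_pts_index (x : ℝ) : (x : EReal) ≤ g.pts (g.index x).succ :=
  (Finset.mem_filter.1 (Finset.min'_mem _ (g.exists_le x))).2

theorem Grid.index_mono : Monotone g.index := fun x y h =>
  g.index_le (le_trans (by exact_mod_cast h) (g.le_pts_index y))

theorem Grid.pts_castSucc_nonneg (k : Fin K) : 0 ≤ g.pts k.castSucc := by
  rw [← g.pts_zero]
  exact g.strictMono.monotone (Fin.zero_le _)

theorem Grid.coe_left (k : Fin K) : ((g.left k : ℝ) : EReal) = g.pts k.castSucc := by
  refine EReal.coe_toReal ?_ ?_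
  · have := g.strictMono (Fin.castSucc_lt_last k)
    exact ne_of_lt (this.trans_le le_top)
  · exact ne_of_gt (lt_of_lt_of_le EReal.bot_lt_zero (g.pts_castSucc_nonneg k))

theorem Grid.left_nonneg (k : Fin K) : 0 ≤ g.left k := by
  have := g.pts_castSucc_nonneg k
  rw [← g.coe_left] at this
  exact_mod_cast this

theorem Grid.mem_cell {k : Fin K} {u : ℝ} :
    u ∈ g.cell k ↔ g.left k < u ∧ (u : EReal) ≤ g.pts k.succ := by
  rw [Grid.cell, Set.mem_ofPred_eq, ← g.coe_left, EReal.coe_lt_coe_iff]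

theorem Grid.pos_of_mem_cell {k : Fin K} {u : ℝ} (h : u ∈ g.cell k) : 0 < u :=
  (g.left_nonneg k).trans_lt (g.mem_cell.1 h).1

theorem Grid.index_eq_of_mem_cell {k : Fin K} {u : ℝ} (h : u ∈ g.cell k) : g.index u = k := by
  refine le_antisymm (g.index_le h.2) ?_
  by_contra hlt
  rw [not_le] at hlt
  have h1 : g.pts (g.index u).succ ≤ g.pts k.castSucc := by
    refine g.strictMono.monotone ?_
    rw [Fin.le_def, Fin.val_succ, Fin.val_castSucc]
    exact hlt
  exact absurd (h.1.trans_le ((g.le_pts_index u).trans h1)) (lt_irrefl _)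

theorem Grid.mem_cell_index {u : ℝ} (hu : 0 < u) : u ∈ g.cell (g.index u) := by
  refine ⟨?_, g.le_pts_index u⟩
  by_contra hlt
  rw [not_lt] at hlt
  rcases Nat.eq_zero_or_pos (g.index u).val with h0 | h0
  · have : (g.index u).castSucc = 0 := Fin.ext (by simpa using h0)
    rw [this, g.pts_zero] at hlt
    exact absurd hu (not_lt.2 (by exact_mod_cast hlt))
  · let j : Fin K := ⟨(g.index u).val - 1, by omega⟩
    have hj : j.succ = (g.index u).castSucc := Fin.ext (by simp [j]; omega)
    have h1 : g.index u ≤ j := g.index_le (by rw [hj]; exact hlt)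
    rw [Fin.le_def] at h1
    simp only [j] at h1
    omega

theorem Grid.mem_cell_iff {k : Fin K} {u : ℝ} (hu : 0 < u) : u ∈ g.cell k ↔ g.index u = k :=
  ⟨g.index_eq_of_mem_cell, fun h => h ▸ g.mem_cell_index hu⟩

theorem Grid.left_index_lt {u : ℝ} (hu : 0 < u) : g.left (g.index u) < u :=
  (g.mem_cell.1 (g.mem_cell_index hu)).1

theorem Grid.index_zero : (g.index 0).val = 0 := by
  obtain ⟨k, hk⟩ : ∃ k : Fin K, k.val = 0 := ⟨⟨0, (g.index 0).pos⟩, rfl⟩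
  have : g.index 0 ≤ k := g.index_le (by
    rw [EReal.coe_zero, ← g.pts_zero]; exact g.strictMono.monotone (Fin.zero_le _))
  rw [Fin.le_def] at this
  omega

theorem Grid.left_index_le {u : ℝ} (hu : 0 ≤ u) : g.left (g.index u) ≤ u := by
  rcases hu.eq_or_lt with rfl | hu
  · have : (g.index 0).castSucc = 0 := Fin.ext (by simpa using g.index_zero)
    rw [Grid.left, this, g.pts_zero]; simp
  · exact (g.left_index_lt hu).le

theorem Grid.left_of_succ {k l : Fin K} (h : l.val = k.val + 1) : g.left l = g.right k := by
  have : l.castSucc = k.succ := Fin.ext (by simpa using h)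
  rw [Grid.left, Grid.right, this]

/-- Cells are closed on the right, so a common end point belongs to the earlier of the two cells.
The recursion over cells depends on this convention. -/
theorem Grid.index_left_of_succ {k l : Fin K} (h : l.val = k.val + 1) :
    g.index (g.left l) = k := by
  refine g.index_eq_of_mem_cell ?_
  have hl : l.castSucc = k.succ := Fin.ext (by simpa using h)
  rw [Grid.cell, Set.mem_ofPred_eq, g.coe_left, hl]
  exact ⟨g.strictMono (Fin.castSucc_lt_succ), le_rfl⟩

theorem Grid.left_lt_left {k l : Fin K} (h : k < l) : g.left k < g.left l := by
  have := g.strictMono (Fin.castSucc_lt_castSucc_iff.2 h)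
  rw [← g.coe_left, ← g.coe_left] at this
  exact_mod_cast this

theorem Grid.measurable_index : Measurable g.index := by
  refine measurable_to_countable' fun k => ?_
  exact (Set.ordConnected_singleton.preimage_mono g.index_mono).measurableSet

theorem Grid.measurableSet_cell (k : Fin K) : MeasurableSet (g.cell k) := by
  have : g.cell k = g.index ⁻¹' {k} ∩ Set.Ioi 0 := by
    ext u
    constructor
    · intro h
      exact ⟨g.index_eq_of_mem_cell h, g.pos_of_mem_cell h⟩
    · rintro ⟨h, h0⟩
      exact (g.mem_cell_iff h0).2 h
  rw [this]
  exact (g.measurable_index (measurableSet_singleton k)).inter measurableSet_Ioi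

end Index

/-! ### Matrix exponentials -/

section Exp

variable {n : Type*} [Fintype n] [DecidableEq n]

open scoped Matrix.Norms.Operator in
theorem hasDerivAt_exp_smul_apply (A : Matrix n n ℝ) (i j : n) (u : ℝ) :
    HasDerivAt (fun u : ℝ => NormedSpace.exp (u • A) i j) ((A * NormedSpace.exp (u • A)) i j) u := by
  have h := hasDerivAt_exp_smul_const' (𝕂 := ℝ) A u
  have h2 := (Matrix.entryLinearMap ℝ ℝ i j).toContinuousLinearMap.hasFDerivAt.comp_hasDerivAt u h
  exact h2

theorem continuous_exp_smul_apply (A : Matrix n n ℝ) (i j : n) :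
    Continuous fun u : ℝ => NormedSpace.exp (u • A) i j :=
  continuous_iff_continuousAt.2 fun u => (hasDerivAt_exp_smul_apply A i j u).continuousAt

open scoped Matrix.Norms.Operator in
theorem exp_apply_nonneg_of_nonneg {A : Matrix n n ℝ} (hA : ∀ i j, 0 ≤ A i j) (i j : n) :
    0 ≤ NormedSpace.exp A i j := by
  have hpow : ∀ m : ℕ, ∀ i j, 0 ≤ (A ^ m) i j := by
    intro m
    induction m with
    | zero => intro i j; rw [pow_zero, Matrix.one_apply]; split_ifs <;> norm_num
    | succ m ih =>
      intro i j
      rw [pow_succ, Matrix.mul_apply]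
      exact Finset.sum_nonneg fun l _ => mul_nonneg (ih i l) (hA l j)
  have h := NormedSpace.exp_series_hasSum_exp' (𝕂 := ℝ) A
  have h2 := h.mapL (Matrix.entryLinearMap ℝ ℝ i j).toContinuousLinearMap
  refine h2.nonneg fun m => ?_
  change 0 ≤ (((m.factorial : ℝ)⁻¹ • A ^ m) i j)
  rw [Matrix.smul_apply, smul_eq_mul]
  exact mul_nonneg (by positivity) (hpow m i j)

/-- Adding c·I with c at least every -A i i makes all entries nonnegative, where the power series
applies. The shift commutes with everything and costs only the positive factor e^{-c}. -/
theorem exp_apply_nonneg {A : Matrix n n ℝ} (hA : ∀ i j, i ≠ j → 0 ≤ A i j) (i j : n) :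
    0 ≤ NormedSpace.exp A i j := by
  obtain ⟨c, hc⟩ : ∃ c : ℝ, ∀ i, -A i i ≤ c := by
    refine ⟨∑ i, |A i i|, fun i => (neg_le_abs _).trans ?_⟩
    exact Finset.single_le_sum (f := fun i => |A i i|) (fun _ _ => abs_nonneg _)
      (Finset.mem_univ i)
  have h1 : A = (A + c • (1 : Matrix n n ℝ)) + Matrix.diagonal fun _ => -c := by
    ext a b
    by_cases h : a = b
    · subst h; simp
    · simp [h]
  have h2 : Commute (A + c • (1 : Matrix n n ℝ)) (Matrix.diagonal fun _ => -c) := by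
    have : (Matrix.diagonal fun _ : n => -c) = (-c) • (1 : Matrix n n ℝ) := by
      ext a b; by_cases h : a = b
      · subst h; simp
      · simp [h]
    rw [this]
    exact (Commute.one_right _).smul_right _
  rw [h1, Matrix.exp_add_of_commute _ _ h2, Matrix.exp_diagonal, Matrix.mul_diagonal]
  refine mul_nonneg (exp_apply_nonneg_of_nonneg (fun a b => ?_) i j) ?_
  · by_cases h : a = b
    · subst h; simp; linarith [hc a]
    · simpa [h] using hA a b h
  · rw [Pi.coe_exp, ← Real.exp_eq_exp_ℝ]
    exact (Real.exp_pos _).le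

end Exp

end IPH

namespace IPH

/-! ### The transition matrices as solutions of the forward equation -/

section SubTrans

variable {K p : ℕ} (g : Grid K) (T : Fin K → Matrix (Fin p) (Fin p) ℝ)

theorem cellProd_of_succ {k l : Fin K} (h : l.val = k.val + 1) : cellProd g T k l = 1 := by
  have : ((List.finRange K).filter fun m => k < m ∧ m < l) = [] := by
    rw [List.filter_eq_nil_iff]
    intro m _ hm
    simp only [Fin.lt_def, decide_eq_true_eq] at hm
    omega
  rw [cellProd, this]
  simp

/-- Both index lists are strictly increasing and have the same members, hence are equal; the new
factor stands last. -/
theorem cellProd_snoc {k l m : Fin K} (hkl : k < l) (h : m.val = l.val + 1) :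
    cellProd g T k m =
      cellProd g T k l * NormedSpace.exp ((g.right l - g.left l) • T l) := by
  have key : ((List.finRange K).filter fun a => k < a ∧ a < m) =
      ((List.finRange K).filter fun a => k < a ∧ a < l) ++ [l] := by
    have hs : ∀ q : Fin K → Bool, ((List.finRange K).filter q).Pairwise (· < ·) := fun q =>
      (List.pairwise_lt_finRange K).filter q
    have h2 : (((List.finRange K).filter fun a => k < a ∧ a < l) ++ [l]).Pairwise (· < ·) := by
      rw [List.pairwise_append]
      refine ⟨hs _, List.pairwise_singleton _ _, ?_⟩
      intro a ha b hb
      simp only [List.mem_filter, decide_eq_true_eq] at ha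
      rw [List.mem_singleton.1 hb]
      exact ha.2.2
    refine List.Perm.eq_of_pairwise (le := (· < ·))
      (fun a b _ _ h1 h2 => absurd (h1.trans h2) (lt_irrefl _)) (hs _) h2 ?_
    refine (List.perm_ext_iff_of_nodup ((hs _).imp ne_of_lt) (h2.imp ne_of_lt)).2 fun a => ?_
    simp only [List.mem_filter, List.mem_finRange, decide_eq_true_eq, true_and, List.mem_append,
      List.mem_singleton, Fin.lt_def, Fin.ext_iff] at hkl ⊢
    omega
  rw [cellProd, key, List.map_append, List.prod_append, ← cellProd]
  simp

theorem subTrans_of_index_eq {s t : ℝ} (h : g.index s = g.index t) :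
    subTrans g T s t = NormedSpace.exp ((t - s) • T (g.index t)) := if_pos h

theorem subTrans_self (s : ℝ) : subTrans g T s s = 1 := by
  rw [subTrans_of_index_eq g T rfl, sub_self, zero_smul, NormedSpace.exp_zero]

/-- Splits off the factor of the last cell. The left end of the cell of `t` lies in the preceding
cell, so the remaining factor is again a value of `subTrans`, whether or not `s` is in that
preceding cell. This is the recursion behind the uniqueness proof. -/
theorem subTrans_of_index_lt {s t : ℝ} (h : g.index s < g.index t) :
    subTrans g T s t = subTrans g T s (g.left (g.index t)) *
      NormedSpace.exp ((t - g.left (g.index t)) • T (g.index t)) := by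
  set k := g.index t with hk
  have hkpos : 0 < k.val := by have := Fin.lt_def.1 h; omega
  let j : Fin K := ⟨k.val - 1, by omega⟩
  have hj : k.val = j.val + 1 := by simp only [j]; omega
  have hij : g.index (g.left k) = j := g.index_left_of_succ hj
  rw [subTrans, if_neg (by rw [← hk]; exact h.ne), ← hk]
  congr 1
  rcases eq_or_lt_of_le (show g.index s ≤ j by rw [Fin.le_def]; rw [Fin.lt_def] at h; omega)
    with he | hlt
  · rw [subTrans_of_index_eq g T (by rw [hij, he]), hij, he, cellProd_of_succ g T hj,
      g.left_of_succ hj, mul_one]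
  · rw [subTrans, if_neg (by rw [hij]; exact hlt.ne), hij, cellProd_snoc g T hlt hj,
      g.left_of_succ hj, mul_assoc]

/-- The pair of cell indices takes finitely many values and is measurable; with the pair fixed, the
formula is continuous in both times. -/
theorem measurable_subTrans (i j : Fin p) :
    Measurable fun z : ℝ × ℝ => subTrans g T z.1 z.2 i j := by
  have h : ∀ k l : Fin K, Measurable fun z : ℝ × ℝ =>
      (if k = l then NormedSpace.exp ((z.2 - z.1) • T l)
      else NormedSpace.exp ((g.right k - z.1) • T k) *
        cellProd g T k l * NormedSpace.exp ((z.2 - g.left l) • T l)) i j := by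
    intro k l
    split_ifs
    · exact ((continuous_exp_smul_apply _ _ _).comp (by fun_prop)).measurable
    · simp only [Matrix.mul_apply]
      refine Continuous.measurable ?_
      refine continuous_finsetSum _ fun a _ => Continuous.mul
        (continuous_finsetSum _ fun b _ => Continuous.mul ?_ continuous_const) ?_
      · exact (continuous_exp_smul_apply _ _ _).comp (by fun_prop)
      · exact (continuous_exp_smul_apply _ _ _).comp (by fun_prop)
  have h2 : Measurable fun q : (Fin K × Fin K) × (ℝ × ℝ) =>
      (if q.1.1 = q.1.2 then NormedSpace.exp ((q.2.2 - q.2.1) • T q.1.2)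
      else NormedSpace.exp ((g.right q.1.1 - q.2.1) • T q.1.1) *
        cellProd g T q.1.1 q.1.2 * NormedSpace.exp ((q.2.2 - g.left q.1.2) • T q.1.2)) i j :=
    measurable_from_prod_countable_right fun q => h q.1 q.2
  have h3 : Measurable fun z : ℝ × ℝ => ((g.index z.1, g.index z.2), z) :=
    ((g.measurable_index.comp measurable_fst).prodMk
      (g.measurable_index.comp measurable_snd)).prodMk measurable_id
  exact h2.comp h3

variable {g T}

theorem cellProd_nonneg (hT : ∀ k, IsSubIntensity (T k)) (k l : Fin K) (i j : Fin p) :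
    0 ≤ cellProd g T k l i j := by
  have : ∀ L : List (Fin K), (∀ a ∈ L, 0 ≤ g.right a - g.left a) → ∀ i j,
      0 ≤ ((L.map fun l => NormedSpace.exp ((g.right l - g.left l) • T l)).prod) i j := by
    intro L
    induction L with
    | nil => intro _ i j; rw [List.map_nil, List.prod_nil, Matrix.one_apply]; split_ifs <;> norm_num
    | cons a L ih =>
      intro hL i j
      rw [List.map_cons, List.prod_cons, Matrix.mul_apply]
      refine Finset.sum_nonneg fun c _ => mul_nonneg ?_
        (ih (fun b hb => hL b (List.mem_cons_of_mem _ hb)) _ _)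
      refine exp_apply_nonneg (fun x y hxy => ?_) _ _
      exact mul_nonneg (hL a List.mem_cons_self) ((hT a).1 x y hxy)
  refine this _ (fun a ha => ?_) i j
  simp only [List.mem_filter, decide_eq_true_eq] at ha
  have hb : a.val + 1 < K := by have := Fin.lt_def.1 ha.2.2; omega
  rw [← g.left_of_succ (k := a) (l := ⟨a.val + 1, hb⟩) rfl, sub_nonneg]
  exact (g.left_lt_left (by rw [Fin.lt_def]; simp)).le

theorem subTrans_nonneg (hT : ∀ k, IsSubIntensity (T k)) {s t : ℝ} (hs : 0 ≤ s) (hst : s ≤ t)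
    (i j : Fin p) : 0 ≤ subTrans g T s t i j := by
  have hexp : ∀ (c : ℝ) (k : Fin K), 0 ≤ c → ∀ a b, 0 ≤ NormedSpace.exp (c • T k) a b :=
    fun c k hc a b => exp_apply_nonneg (fun x y hxy => mul_nonneg hc ((hT k).1 x y hxy)) a b
  rcases eq_or_lt_of_le (g.index_mono hst) with h | h
  · rw [subTrans_of_index_eq g T h]
    exact hexp _ _ (by linarith) _ _
  · rw [subTrans, if_neg h.ne, Matrix.mul_apply]
    refine Finset.sum_nonneg fun c _ => mul_nonneg ?_
      (hexp _ _ (by linarith [g.left_index_le (hs.trans hst)]) _ _)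
    rw [Matrix.mul_apply]
    refine Finset.sum_nonneg fun d _ => mul_nonneg (hexp _ _ ?_ _ _) (cellProd_nonneg hT _ _ _ _)
    have hb : (g.index s).val + 1 < K := by have := Fin.lt_def.1 h; omega
    rw [← g.left_of_succ (k := g.index s) (l := ⟨(g.index s).val + 1, hb⟩) rfl, sub_nonneg]
    -- What remains is that `s` does not exceed the right end of its own cell. A violation would
    -- make `s` positive, and then membership in the cell contradicts it.
    by_contra hlt
    rw [not_le] at hlt
    have h1 := g.index_left_of_succ (k := g.index s) (l := ⟨(g.index s).val + 1, hb⟩) rfl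
    have h2 : (⟨(g.index s).val + 1, hb⟩ : Fin K) ≤ g.index s := by
      have hpos : (0:ℝ) < s := (g.left_nonneg _).trans_lt hlt
      by_contra hc
      rw [not_le] at hc
      have hle := (g.mem_cell.1 (g.mem_cell_index hpos)).2
      have : (⟨(g.index s).val + 1, hb⟩ : Fin K).castSucc = (g.index s).succ := Fin.ext (by simp)
      rw [← this, ← g.coe_left] at hle
      exact absurd hlt (not_lt.2 (by exact_mod_cast hle))
    rw [Fin.le_def] at h2
    simp at h2

/-- A row vector solving the forward equation with a constant matrix. -/
theorem eq_vecMul_exp_of_integral_eq {A : Matrix (Fin p) (Fin p) ℝ} {y : ℝ → Fin p → ℝ} {a b : ℝ}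
    (hab : a ≤ b)
    (h : ∀ t ∈ Set.Icc a b, ∀ j, IntervalIntegrable (fun u => (y u ᵥ* A) j) volume a t ∧
      y t j = y a j + ∫ u in a..t, (y u ᵥ* A) j) :
    y b = y a ᵥ* NormedSpace.exp ((b - a) • A) := by
  have hy : ∀ j, ContinuousOn (fun t => y t j) (Set.Icc a b) := by
    intro j
    have h1 : ContinuousOn (fun t => ∫ u in a..t, (y u ᵥ* A) j) (Set.Icc a b) := by
      have h2 : IntegrableOn (fun u => (y u ᵥ* A) j) (Set.uIcc a b) volume := by
        rw [Set.uIcc_of_le hab]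
        exact (intervalIntegrable_iff_integrableOn_Icc_of_le hab).1
          (h b (Set.right_mem_Icc.2 hab) j).1
      have := intervalIntegral.continuousOn_primitive_interval h2
      rwa [Set.uIcc_of_le hab] at this
    exact (continuousOn_const.add h1).congr fun t ht => (h t ht j).2
  -- Clamping to [a, b] extends `y` continuously to the line, so that its primitive `F` is
  -- differentiable everywhere, end points included.
  let c : ℝ → ℝ := fun t => max a (min b t)
  have hc : Continuous c := by fun_prop
  have hcm : ∀ t, c t ∈ Set.Icc a b := fun t =>
    ⟨le_max_left _ _, max_le hab (min_le_left _ _)⟩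
  have hce : ∀ t ∈ Set.Icc a b, c t = t := fun t ht => by
    simp [c, min_eq_right ht.2, max_eq_right ht.1]
  have hyc : ∀ j, Continuous fun t => y (c t) j := fun j =>
    (hy j).comp_continuous hc hcm
  have hycA : ∀ j, Continuous fun t => (y (c t) ᵥ* A) j := fun j => by
    simp only [Matrix.vecMul, dotProduct]
    exact continuous_finsetSum _ fun l _ => (hyc l).mul continuous_const
  let F : ℝ → Fin p → ℝ := fun t j => y a j + ∫ u in a..t, (y (c u) ᵥ* A) j
  have hF : ∀ t j, HasDerivAt (fun t => F t j) ((y (c t) ᵥ* A) j) t := fun t j =>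
    ((intervalIntegral.integral_hasDerivAt_right ((hycA j).intervalIntegrable _ _)
      ((hycA j).stronglyMeasurableAtFilter _ _) (hycA j).continuousAt).const_add _)
  have hFy : ∀ t ∈ Set.Icc a b, F t = y t := by
    intro t ht
    funext j
    rw [(h t ht j).2]
    refine congrArg (y a j + ·) (intervalIntegral.integral_congr fun u hu => ?_)
    rw [Set.uIcc_of_le ht.1] at hu
    simp only [hce u ⟨hu.1, hu.2.trans ht.2⟩]
  -- The conserved quantity: the derivative of y(t) exp((b-t)A) is yA·exp − y·A exp = 0. Its values
  -- at `a` and `b` give the claim.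
  have hz : ∀ j, ∀ t ∈ Set.Icc a b,
      (F t ᵥ* NormedSpace.exp ((b - t) • A)) j = (F a ᵥ* NormedSpace.exp ((b - a) • A)) j := by
    intro j
    have hd : ∀ t, HasDerivAt (fun t => (F t ᵥ* NormedSpace.exp ((b - t) • A)) j)
        (∑ l, ((y (c t) ᵥ* A) l * NormedSpace.exp ((b - t) • A) l j +
          F t l * -((A * NormedSpace.exp ((b - t) • A)) l j))) t := by
      intro t
      simp only [Matrix.vecMul, dotProduct]
      refine HasDerivAt.fun_sum fun l _ => (hF t l).mul ?_
      have := (hasDerivAt_exp_smul_apply A l j (b - t)).scomp t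
        ((hasDerivAt_id t).const_sub b)
      exact this.congr_deriv (by simp)
    refine constant_of_has_deriv_right_zero (fun t _ => (hd t).continuousAt.continuousWithinAt) ?_
    intro t ht
    have ht' : t ∈ Set.Icc a b := ⟨ht.1, ht.2.le⟩
    convert (hd t).hasDerivWithinAt using 1
    rw [hce t ht', hFy t ht', Finset.sum_add_distrib]
    simp only [mul_neg, Finset.sum_neg_distrib]
    change 0 = ((y t ᵥ* A) ᵥ* NormedSpace.exp ((b - t) • A)) j -
      (y t ᵥ* (A * NormedSpace.exp ((b - t) • A))) j
    rw [Matrix.vecMul_vecMul, sub_self]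
  have ha := Set.left_mem_Icc.2 hab
  have hb := Set.right_mem_Icc.2 hab
  funext j
  have := hz j b hb
  rwa [hFy b hb, hFy a ha, sub_self, zero_smul, NormedSpace.exp_zero, Matrix.vecMul_one] at this

/-- Uniqueness for the forward equation with the piecewise constant intensity. -/
theorem eq_vecMul_subTrans_of_integral_eq {y : ℝ → Fin p → ℝ} {s : ℝ} (hs : 0 ≤ s)
    (h : ∀ t, s ≤ t → ∀ j,
      IntervalIntegrable (fun u => (y u ᵥ* T (g.index u)) j) volume s t ∧
      y t j = y s j + ∫ u in s..t, (y u ᵥ* T (g.index u)) j) :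
    ∀ t, s ≤ t → y t = y s ᵥ* subTrans g T s t := by
  -- The index needs to be constant only on (a, b]: the integral does not see the point `a`, which
  -- at a grid point belongs to the previous cell.
  have hcell : ∀ a b, s ≤ a → a ≤ b → (∀ u ∈ Set.Ioc a b, g.index u = g.index b) →
      y b = y a ᵥ* NormedSpace.exp ((b - a) • T (g.index b)) := by
    intro a b hsa hab hk
    refine eq_vecMul_exp_of_integral_eq hab fun t ht j => ?_
    have hI : IntervalIntegrable (fun u => (y u ᵥ* T (g.index u)) j) volume a t :=
      (h t (hsa.trans ht.1) j).1.mono_set (by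
        rw [Set.uIcc_of_le ht.1, Set.uIcc_of_le (hsa.trans ht.1)]
        exact Set.Icc_subset_Icc hsa le_rfl)
    have he : ∀ u ∈ Set.uIoc a t, (y u ᵥ* T (g.index u)) j = (y u ᵥ* T (g.index b)) j := by
      intro u hu
      rw [Set.uIoc_of_le ht.1] at hu
      rw [hk u ⟨hu.1, hu.2.trans ht.2⟩]
    refine ⟨hI.congr he, ?_⟩
    rw [← intervalIntegral.integral_congr_ae (Eventually.of_forall he), (h t (hsa.trans ht.1) j).2,
      (h a hsa j).2, add_assoc, intervalIntegral.integral_add_adjacent_intervals (h a hsa j).1 hI]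
  -- Induction on the number of cells between `s` and `t`.
  have key : ∀ n : ℕ, ∀ t, s ≤ t → (g.index t).val = (g.index s).val + n →
      y t = y s ᵥ* subTrans g T s t := by
    intro n
    induction n with
    | zero =>
      intro t hst ht
      have he : g.index s = g.index t := Fin.ext (by omega)
      rw [subTrans_of_index_eq g T he]
      exact hcell s t le_rfl hst fun u hu =>
        le_antisymm (g.index_mono hu.2) (he ▸ g.index_mono hu.1.le)
    | succ n ih =>
      intro t hst ht
      have hlt : g.index s < g.index t := by rw [Fin.lt_def]; omega
      have htpos : 0 < t := by
        refine lt_of_le_of_ne (hs.trans hst) fun h0 => ?_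
        have := g.index_zero
        rw [h0] at this
        omega
      have hjlt : (g.index s).val + n < K := by have := (g.index t).isLt; omega
      let j : Fin K := ⟨(g.index s).val + n, hjlt⟩
      have hj : g.index (g.left (g.index t)) = j :=
        g.index_left_of_succ (by simp only [j]; omega)
      have hsl : s ≤ g.left (g.index t) := by
        by_contra hc
        rw [not_le] at hc
        have h1 : g.index s = g.index t := by
          refine g.index_eq_of_mem_cell (g.mem_cell.2 ⟨hc, ?_⟩)
          exact le_trans (by exact_mod_cast hst) (g.le_pts_index t)
        exact hlt.ne h1
      rw [subTrans_of_index_lt g T hlt, ← Matrix.vecMul_vecMul, ← ih _ hsl (by rw [hj])]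
      refine hcell _ t hsl (g.left_index_lt htpos).le fun u hu => ?_
      refine g.index_eq_of_mem_cell (g.mem_cell.2 ⟨hu.1, ?_⟩)
      exact le_trans (by exact_mod_cast hu.2) (g.le_pts_index t)
  intro t hst
  have := Fin.le_def.1 (g.index_mono hst)
  exact key ((g.index t).val - (g.index s).val) t hst (by omega)

end SubTrans

end IPH

namespace IPH

/-! ### Intensities -/

section Intensity

variable {K p : ℕ} {g : Grid K} {T : Fin K → Matrix (Fin p) (Fin p) ℝ}

theorem exitRate_apply (A : Matrix (Fin p) (Fin p) ℝ) (i : Fin p) :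
    exitRate A i = -∑ j, A i j := by
  simp [exitRate, Matrix.mulVec, dotProduct]

theorem exitRate_nonneg {A : Matrix (Fin p) (Fin p) ℝ} (hA : IsSubIntensity A) (i : Fin p) :
    0 ≤ exitRate A i := by
  rw [exitRate_apply]
  linarith [hA.2 i]

@[simp] theorem intensity_inl_inl (A : Matrix (Fin p) (Fin p) ℝ) (i j : Fin p) :
    intensity A (Sum.inl i) (Sum.inl j) = A i j := rfl

@[simp] theorem intensity_inl_inr (A : Matrix (Fin p) (Fin p) ℝ) (i : Fin p) (u : Unit) :
    intensity A (Sum.inl i) (Sum.inr u) = exitRate A i := rfl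

@[simp] theorem intensity_inr (A : Matrix (Fin p) (Fin p) ℝ) (u : Unit) (b : State p) :
    intensity A (Sum.inr u) b = 0 := by
  cases b <;> rfl

theorem intensity_nonneg {A : Matrix (Fin p) (Fin p) ℝ} (hA : IsSubIntensity A) {i : Fin p}
    {b : State p} (h : b ≠ Sum.inl i) : 0 ≤ intensity A (Sum.inl i) b := by
  cases b with
  | inl j => exact hA.1 i j fun hij => h (by rw [hij])
  | inr u => exact exitRate_nonneg hA i

theorem measurable_intensityFun (a b : State p) : Measurable fun u => g.intensityFun T u a b :=
  (measurable_of_countable fun k => intensity (T k) a b).comp g.measurable_index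

variable (g T) in
theorem exists_intensityFun_bound : ∃ C, 0 ≤ C ∧ ∀ u a b, |g.intensityFun T u a b| ≤ C := by
  refine ⟨∑ k, ∑ a, ∑ b, |intensity (T k) a b|, by positivity, fun u a b => ?_⟩
  calc |g.intensityFun T u a b| ≤ ∑ b, |intensity (T (g.index u)) a b| :=
        Finset.single_le_sum (f := fun b => |intensity (T (g.index u)) a b|)
          (fun _ _ => abs_nonneg _) (Finset.mem_univ b)
    _ ≤ ∑ a, ∑ b, |intensity (T (g.index u)) a b| :=
        Finset.single_le_sum (f := fun a => ∑ b, |intensity (T (g.index u)) a b|)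
          (fun _ _ => Finset.sum_nonneg fun _ _ => abs_nonneg _) (Finset.mem_univ a)
    _ ≤ _ := Finset.single_le_sum (f := fun k => ∑ a, ∑ b, |intensity (T k) a b|)
          (fun _ _ => Finset.sum_nonneg fun _ _ => Finset.sum_nonneg fun _ _ => abs_nonneg _)
          (Finset.mem_univ _)

end Intensity

/-! ### The transition function -/

section Transition

variable {K p : ℕ} {g : Grid K} {T : Fin K → Matrix (Fin p) (Fin p) ℝ}
  {Q : ℝ → ℝ → Matrix (State p) (State p) ℝ}

theorem mul_intensityFun_inl (M : Matrix (State p) (State p) ℝ) (u : ℝ) (a : State p)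
    (j : Fin p) : (M * g.intensityFun T u) a (Sum.inl j) =
      ((fun l => M a (Sum.inl l)) ᵥ* T (g.index u)) j := by
  rw [Matrix.mul_apply, Fintype.sum_sum_type]
  simp [Grid.intensityFun, Matrix.vecMul, dotProduct]

theorem mul_intensityFun_inr (M : Matrix (State p) (State p) ℝ) (u : ℝ) (a : State p)
    (x : Unit) : (M * g.intensityFun T u) a (Sum.inr x) =
      (fun l => M a (Sum.inl l)) ⬝ᵥ exitRate (T (g.index u)) := by
  rw [Matrix.mul_apply, Fintype.sum_sum_type]
  simp [Grid.intensityFun, dotProduct]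

theorem IsTransitionFunction.apply_self (hQ : IsTransitionFunction (g.intensityFun T) Q) {s : ℝ}
    (hs : 0 ≤ s) : Q s s = 1 := by
  ext a b
  rw [(hQ s s hs le_rfl a b).2, intervalIntegral.integral_same, add_zero]

/-- The absorbing row of the intensity is zero, so the transient entries of a row of `Q` satisfy a
closed equation. Restarting it at `u` and using uniqueness identifies them; with `u = s` this gives
the transition matrix, with general `u` the transient half of Chapman–Kolmogorov. -/
theorem IsTransitionFunction.row_inl (hQ : IsTransitionFunction (g.intensityFun T) Q) {s u t : ℝ}
    (hs : 0 ≤ s) (hsu : s ≤ u) (hut : u ≤ t) (a : State p) :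
    (fun l => Q s t a (Sum.inl l)) = (fun l => Q s u a (Sum.inl l)) ᵥ* subTrans g T u t := by
  refine eq_vecMul_subTrans_of_integral_eq (g := g) (T := T) (s := u)
    (y := fun t l => Q s t a (Sum.inl l)) (hs.trans hsu) (fun v huv j => ?_) t hut
  have h1 := hQ s u hs hsu a (Sum.inl j)
  have h2 := hQ s v hs (hsu.trans huv) a (Sum.inl j)
  simp only [mul_intensityFun_inl] at h1 h2
  have h3 : IntervalIntegrable (fun w => ((fun l => Q s w a (Sum.inl l)) ᵥ* T (g.index w)) j)
      volume u v := h2.1.mono_set (by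
        rw [Set.uIcc_of_le huv, Set.uIcc_of_le (hsu.trans huv)]
        exact Set.Icc_subset_Icc hsu le_rfl)
  refine ⟨h3, ?_⟩
  rw [h1.2, h2.2, add_assoc, intervalIntegral.integral_add_adjacent_intervals h1.1 h3]

theorem IsTransitionFunction.apply_inl_inl (hQ : IsTransitionFunction (g.intensityFun T) Q)
    {s t : ℝ} (hs : 0 ≤ s) (hst : s ≤ t) (i j : Fin p) :
    Q s t (Sum.inl i) (Sum.inl j) = subTrans g T s t i j := by
  have h := congrFun (hQ.row_inl hs le_rfl hst (Sum.inl i)) j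
  rw [hQ.apply_self hs] at h
  rw [h]
  simp [Matrix.vecMul, dotProduct, Matrix.one_apply]

theorem IsTransitionFunction.apply_inr_inl (hQ : IsTransitionFunction (g.intensityFun T) Q)
    {s t : ℝ} (hs : 0 ≤ s) (hst : s ≤ t) (x : Unit) (j : Fin p) :
    Q s t (Sum.inr x) (Sum.inl j) = 0 := by
  have h := congrFun (hQ.row_inl hs le_rfl hst (Sum.inr x)) j
  rw [hQ.apply_self hs] at h
  rw [h]
  simp [Matrix.vecMul, dotProduct]

theorem IsTransitionFunction.apply_inr_inr (hQ : IsTransitionFunction (g.intensityFun T) Q)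
    {s t : ℝ} (hs : 0 ≤ s) (hst : s ≤ t) (x y : Unit) :
    Q s t (Sum.inr x) (Sum.inr y) = 1 := by
  rw [(hQ s t hs hst (Sum.inr x) (Sum.inr y)).2, intervalIntegral.integral_congr (g := fun _ => 0)]
  · simp
  · intro u hu
    rw [Set.uIcc_of_le hst] at hu
    simp only [mul_intensityFun_inr, dotProduct, hQ.apply_inr_inl hs hu.1, zero_mul,
      Finset.sum_const_zero]

theorem IsTransitionFunction.apply_inl_inr (hQ : IsTransitionFunction (g.intensityFun T) Q)
    {s t : ℝ} (hs : 0 ≤ s) (hst : s ≤ t) (i : Fin p) (x : Unit) :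
    IntervalIntegrable (fun u => backwardVec g T s u i) volume s t ∧
    Q s t (Sum.inl i) (Sum.inr x) = ∫ u in s..t, backwardVec g T s u i := by
  have h := hQ s t hs hst (Sum.inl i) (Sum.inr x)
  have he : ∀ u ∈ Set.uIcc s t, (Q s u * g.intensityFun T u) (Sum.inl i) (Sum.inr x) =
      backwardVec g T s u i := by
    intro u hu
    rw [Set.uIcc_of_le hst] at hu
    rw [mul_intensityFun_inr]
    simp only [hQ.apply_inl_inl hs hu.1]
    rfl
  refine ⟨h.1.congr fun u hu => he u (Set.uIoc_subset_uIcc hu), ?_⟩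
  rw [h.2, intervalIntegral.integral_congr he]
  simp

/-- The rows of the intensity sum to zero by the choice of the exit rates, so the integrands cancel
and only the identity contributes. -/
theorem IsTransitionFunction.sum_row (hQ : IsTransitionFunction (g.intensityFun T) Q)
    {s t : ℝ} (hs : 0 ≤ s) (hst : s ≤ t) (a : State p) : ∑ b, Q s t a b = 1 := by
  rw [Finset.sum_congr rfl fun b _ => (hQ s t hs hst a b).2, Finset.sum_add_distrib,
    ← intervalIntegral.integral_finsetSum fun b _ => (hQ s t hs hst a b).1]
  have : ∀ u, ∑ b, (Q s u * g.intensityFun T u) a b = 0 := by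
    intro u
    rw [Fintype.sum_sum_type]
    simp only [mul_intensityFun_inl, mul_intensityFun_inr, Matrix.vecMul, dotProduct,
      exitRate_apply, Finset.univ_unique, Finset.sum_singleton]
    rw [Finset.sum_comm]
    simp [← Finset.mul_sum]
  simp [this, Matrix.one_apply]

theorem backwardVec_nonneg (hT : ∀ k, IsSubIntensity (T k)) {s t : ℝ} (hs : 0 ≤ s) (hst : s ≤ t)
    (i : Fin p) : 0 ≤ backwardVec g T s t i := by
  simp only [backwardVec, Matrix.mulVec, dotProduct]
  exact Finset.sum_nonneg fun _ _ => mul_nonneg (subTrans_nonneg hT hs hst _ _)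
    (exitRate_nonneg (hT _) _)

theorem IsTransitionFunction.nonneg (hQ : IsTransitionFunction (g.intensityFun T) Q)
    (hT : ∀ k, IsSubIntensity (T k)) {s t : ℝ} (hs : 0 ≤ s) (hst : s ≤ t) (a b : State p) :
    0 ≤ Q s t a b := by
  rcases a with i | x <;> rcases b with j | y
  · rw [hQ.apply_inl_inl hs hst]; exact subTrans_nonneg hT hs hst i j
  · rw [(hQ.apply_inl_inr hs hst i y).2]
    exact intervalIntegral.integral_nonneg hst fun u hu => backwardVec_nonneg hT hs hu.1 i
  · rw [hQ.apply_inr_inl hs hst]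
  · rw [hQ.apply_inr_inr hs hst]; exact zero_le_one

theorem IsTransitionFunction.le_one (hQ : IsTransitionFunction (g.intensityFun T) Q)
    (hT : ∀ k, IsSubIntensity (T k)) {s t : ℝ} (hs : 0 ≤ s) (hst : s ≤ t) (a b : State p) :
    Q s t a b ≤ 1 := by
  rw [← hQ.sum_row hs hst a]
  exact Finset.single_le_sum (fun b _ => hQ.nonneg hT hs hst a b) (Finset.mem_univ b)

theorem IsTransitionFunction.abs_le_one (hQ : IsTransitionFunction (g.intensityFun T) Q)
    (hT : ∀ k, IsSubIntensity (T k)) {s t : ℝ} (hs : 0 ≤ s) (hst : s ≤ t) (a b : State p) :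
    |Q s t a b| ≤ 1 := by
  rw [abs_of_nonneg (hQ.nonneg hT hs hst a b)]
  exact hQ.le_one hT hs hst a b

theorem IsTransitionFunction.subTrans_mul (hQ : IsTransitionFunction (g.intensityFun T) Q)
    {s u t : ℝ} (hs : 0 ≤ s) (hsu : s ≤ u) (hut : u ≤ t) :
    subTrans g T s u * subTrans g T u t = subTrans g T s t := by
  ext i j
  have h := congrFun (hQ.row_inl hs hsu hut (Sum.inl i)) j
  rw [hQ.apply_inl_inl hs (hsu.trans hut)] at h
  rw [h, Matrix.mul_apply]
  simp [Matrix.vecMul, dotProduct, hQ.apply_inl_inl hs hsu]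

/-- The Chapman–Kolmogorov equation. -/
theorem IsTransitionFunction.mul (hQ : IsTransitionFunction (g.intensityFun T) Q)
    {s u t : ℝ} (hs : 0 ≤ s) (hsu : s ≤ u) (hut : u ≤ t) : Q s u * Q u t = Q s t := by
  have hinl : ∀ a j, (Q s u * Q u t) a (Sum.inl j) = Q s t a (Sum.inl j) := by
    intro a j
    rw [congrFun (hQ.row_inl hs hsu hut a) j, Matrix.mul_apply, Fintype.sum_sum_type]
    simp [Matrix.vecMul, dotProduct, hQ.apply_inl_inl (hs.trans hsu) hut,
      hQ.apply_inr_inl (hs.trans hsu) hut]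
  ext a b
  rcases b with j | y
  · exact hinl a j
  -- The absorbing column needs no separate equation: both sides have row sums one and agree in all
  -- transient columns.
  · have h1 := hQ.sum_row hs (hsu.trans hut) a
    have h2 : ∑ b, (Q s u * Q u t) a b = 1 := by
      simp only [Matrix.mul_apply]
      rw [Finset.sum_comm]
      simp [← Finset.mul_sum, hQ.sum_row (hs.trans hsu) hut, hQ.sum_row hs hsu]
    rw [Fintype.sum_sum_type] at h1 h2
    simp only [hinl, Finset.univ_unique, Finset.sum_singleton] at h1 h2
    exact add_left_cancel (h2.trans h1.symm)

/-- Quantitative continuity of the transition function. -/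
theorem IsTransitionFunction.exists_bounds (hQ : IsTransitionFunction (g.intensityFun T) Q)
    (hT : ∀ k, IsSubIntensity (T k)) :
    ∃ L, 0 ≤ L ∧ (∀ u a b, |g.intensityFun T u a b| ≤ L) ∧
      (∀ s t, 0 ≤ s → s ≤ t → ∀ a b,
        |Q s t a b - (1 : Matrix (State p) (State p) ℝ) a b| ≤ L * (t - s)) ∧
      (∀ s u t, 0 ≤ s → s ≤ u → u ≤ t → ∀ a b, |Q s t a b - Q s u a b| ≤ L * (t - u)) ∧
      (∀ s u t, 0 ≤ s → s ≤ u → u ≤ t → ∀ a b, |Q s t a b - Q u t a b| ≤ L * (u - s)) ∧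
      (∀ s t, 0 ≤ s → s ≤ t → ∀ a b,
        |Q s t a b - (1 : Matrix (State p) (State p) ℝ) a b -
          ∫ u in s..t, g.intensityFun T u a b| ≤ L * (t - s) ^ 2) := by
  obtain ⟨C, hC0, hC⟩ := exists_intensityFun_bound g T
  let d : ℝ := Fintype.card (State p)
  have hd : 1 ≤ d := by
    simp only [d]
    exact_mod_cast Fintype.card_pos
  have hd0 : 0 ≤ d := by linarith
  have hsum : ∀ (f : State p → ℝ) (c : ℝ), (∀ x, |f x| ≤ c) → |∑ x, f x| ≤ d * c := by
    intro f c hf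
    refine (Finset.abs_sum_le_sum_abs _ _).trans ((Finset.sum_le_sum fun x _ => hf x).trans ?_)
    simp [d]
  have h1 : ∀ s t, 0 ≤ s → s ≤ t → ∀ a b,
      |Q s t a b - (1 : Matrix (State p) (State p) ℝ) a b| ≤ d * C * (t - s) := by
    intro s t hs hst a b
    rw [(hQ s t hs hst a b).2, add_sub_cancel_left, ← Real.norm_eq_abs]
    refine (intervalIntegral.norm_integral_le_of_norm_le_const (C := d * C) fun u hu => ?_).trans
      (by rw [abs_of_nonneg (sub_nonneg.2 hst)])
    rw [Set.uIoc_of_le hst] at hu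
    rw [Matrix.mul_apply, Real.norm_eq_abs]
    refine hsum _ _ fun x => ?_
    rw [abs_mul]
    exact (mul_le_mul (hQ.abs_le_one hT hs hu.1.le a x) (hC u x b) (abs_nonneg _)
      zero_le_one).trans (one_mul C).le
  have hdC : d * C ≤ d * (d * C) := le_mul_of_one_le_left (by positivity) hd
  -- The five bounds below come out with constants C, dC, d²C, d²C and d²C², where d ≥ 1 is the
  -- number of states. The chosen constant d²C(C+1) dominates them all.
  refine ⟨d * (d * C) * (C + 1), by positivity, fun u a b => (hC u a b).trans ?_,
    fun s t hs hst a b => (h1 s t hs hst a b).trans ?_, fun s u t hs hsu hut a b => ?_,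
    fun s u t hs hsu hut a b => ?_, fun s t hs hst a b => ?_⟩
  · have : C ≤ d * C := le_mul_of_one_le_left hC0 hd
    nlinarith
  · refine mul_le_mul_of_nonneg_right ?_ (sub_nonneg.2 hst)
    nlinarith [mul_nonneg (mul_nonneg hd0 (mul_nonneg hd0 hC0)) hC0]
  -- By Chapman–Kolmogorov the increment is Q(s,u)(Q(u,t) − I), which the distance of a short
  -- transition matrix from the identity controls.
  · have : Q s t a b - Q s u a b =
        ∑ x, Q s u a x * (Q u t x b - (1 : Matrix (State p) (State p) ℝ) x b) := by
      rw [← hQ.mul hs hsu hut]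
      simp only [mul_sub, Finset.sum_sub_distrib, ← Matrix.mul_apply, Matrix.mul_one]
    rw [this]
    refine (hsum _ (d * C * (t - u)) fun x => ?_).trans ?_
    · rw [abs_mul]
      exact (mul_le_mul (hQ.abs_le_one hT hs hsu a x) (h1 u t (hs.trans hsu) hut x b)
        (abs_nonneg _) zero_le_one).trans (one_mul _).le
    · rw [← mul_assoc]
      refine mul_le_mul_of_nonneg_right ?_ (sub_nonneg.2 hut)
      nlinarith [mul_nonneg (mul_nonneg hd0 (mul_nonneg hd0 hC0)) hC0]
  · have : Q s t a b - Q u t a b =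
        ∑ x, (Q s u a x - (1 : Matrix (State p) (State p) ℝ) a x) * Q u t x b := by
      rw [← hQ.mul hs hsu hut]
      simp only [sub_mul, Finset.sum_sub_distrib, ← Matrix.mul_apply, Matrix.one_mul]
    rw [this]
    refine (hsum _ (d * C * (u - s)) fun x => ?_).trans ?_
    · rw [abs_mul]
      exact (mul_le_mul (h1 s u hs hsu a x) (hQ.abs_le_one hT (hs.trans hsu) hut x b)
        (abs_nonneg _) (by have := sub_nonneg.2 hsu; positivity)).trans (mul_one _).le
    · rw [← mul_assoc]
      refine mul_le_mul_of_nonneg_right ?_ (sub_nonneg.2 hsu)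
      nlinarith [mul_nonneg (mul_nonneg hd0 (mul_nonneg hd0 hC0)) hC0]
  · have hi : IntervalIntegrable (fun u => g.intensityFun T u a b) volume s t := by
      refine (intervalIntegrable_const (c := C)).mono_fun
        (measurable_intensityFun a b).aestronglyMeasurable (Eventually.of_forall fun u => ?_)
      exact (hC u a b).trans (le_abs_self _)
    rw [(hQ s t hs hst a b).2, add_sub_cancel_left,
      ← intervalIntegral.integral_sub (hQ s t hs hst a b).1 hi, ← Real.norm_eq_abs]
    have hts := sub_nonneg.2 hst
    refine (intervalIntegral.norm_integral_le_of_norm_le_const (C := d * (d * C * (t - s) * C))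
      fun u hu => ?_).trans ?_
    · rw [Set.uIoc_of_le hst] at hu
      have : (Q s u * g.intensityFun T u) a b - g.intensityFun T u a b =
          ∑ x, (Q s u a x - (1 : Matrix (State p) (State p) ℝ) a x) * g.intensityFun T u x b := by
        simp only [sub_mul, Finset.sum_sub_distrib, ← Matrix.mul_apply, Matrix.one_mul]
      rw [this, Real.norm_eq_abs]
      refine hsum _ _ fun x => ?_
      rw [abs_mul]
      refine mul_le_mul ((h1 s u hs hu.1.le a x).trans ?_) (hC u x b) (abs_nonneg _) (by positivity)
      exact mul_le_mul_of_nonneg_left (by linarith [hu.2]) (by positivity)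
    · rw [abs_of_nonneg hts]
      have : d * (d * C * (t - s) * C) * (t - s) = d * (d * C) * C * (t - s) ^ 2 := by ring
      rw [this]
      refine mul_le_mul_of_nonneg_right ?_ (by positivity)
      nlinarith [mul_nonneg hd0 (mul_nonneg hd0 hC0)]

end Transition

end IPH

namespace IPH

/-! ### Continuity in time and the short-time asymptotics of jump probabilities -/

theorem continuousOn_of_abs_sub_le {f : ℝ → ℝ} {a b L : ℝ}
    (h : ∀ x y, a ≤ x → x ≤ y → y ≤ b → |f y - f x| ≤ L * (y - x)) :
    ContinuousOn f (Set.Icc a b) := by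
  refine (LipschitzOnWith.of_dist_le_mul (K := L.toNNReal) fun x hx y hy => ?_).continuousOn
  have hL : L ≤ (L.toNNReal : ℝ) := Real.le_coe_toNNReal L
  rw [Real.dist_eq, Real.dist_eq]
  rcases le_total x y with hxy | hxy
  · rw [abs_sub_comm, abs_sub_comm x y, abs_of_nonneg (sub_nonneg.2 hxy)]
    exact (h x y hx.1 hxy hy.2).trans (mul_le_mul_of_nonneg_right hL (sub_nonneg.2 hxy))
  · rw [abs_of_nonneg (sub_nonneg.2 hxy)]
    exact (h y x hy.1 hxy hx.2).trans (mul_le_mul_of_nonneg_right hL (sub_nonneg.2 hxy))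

section Forward

variable {K p : ℕ} {g : Grid K} {T : Fin K → Matrix (Fin p) (Fin p) ℝ}
  {Q : ℝ → ℝ → Matrix (State p) (State p) ℝ} {π : Fin p → ℝ}

theorem IsTransitionFunction.sum_initialLaw_mul_inl
    (hQ : IsTransitionFunction (g.intensityFun T) Q) {s : ℝ} (hs : 0 ≤ s) (i : Fin p) :
    ∑ x, initialLaw π x * Q 0 s x (Sum.inl i) = forwardVec g π T s i := by
  rw [Fintype.sum_sum_type]
  simp [initialLaw, forwardVec, Matrix.vecMul, dotProduct, hQ.apply_inl_inl le_rfl hs]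

theorem IsTransitionFunction.sum_initialLaw_mul_inr
    (hQ : IsTransitionFunction (g.intensityFun T) Q) {s : ℝ} (hs : 0 ≤ s) :
    ∑ x, initialLaw π x * Q 0 s x (absorbing p) = ∑ i, π i * ∫ u in (0:ℝ)..s, backwardVec g T 0 u i := by
  rw [Fintype.sum_sum_type]
  simp [initialLaw, fun i => (hQ.apply_inl_inr le_rfl hs i ()).2]

theorem forwardVec_nonneg (hT : ∀ k, IsSubIntensity (T k)) (hπ : ∀ i, 0 ≤ π i) {s : ℝ}
    (hs : 0 ≤ s) (i : Fin p) : 0 ≤ forwardVec g π T s i := by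
  simp only [forwardVec, Matrix.vecMul, dotProduct]
  exact Finset.sum_nonneg fun l _ => mul_nonneg (hπ l) (subTrans_nonneg hT le_rfl hs _ _)

theorem measurable_subTrans_right (s : ℝ) (i j : Fin p) :
    Measurable fun u => subTrans g T s u i j := by
  have h := (measurable_subTrans g T i j).comp (measurable_prodMk_left (x := s))
  exact h

theorem measurable_forwardVec (i : Fin p) : Measurable fun u => forwardVec g π T u i := by
  simp only [forwardVec, Matrix.vecMul, dotProduct]
  exact Finset.measurable_fun_sum _ fun l _ => (measurable_subTrans_right 0 l i).const_mul _

theorem measurable_exitRate_index (i : Fin p) :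
    Measurable fun u => exitRate (T (g.index u)) i :=
  (measurable_of_countable fun k => exitRate (T k) i).comp g.measurable_index

theorem measurable_backwardVec (i : Fin p) :
    Measurable fun z : ℝ × ℝ => backwardVec g T z.1 z.2 i := by
  simp only [backwardVec, Matrix.mulVec, dotProduct]
  exact Finset.measurable_fun_sum _ fun l _ => (measurable_subTrans g T i l).mul
    ((measurable_exitRate_index l).comp measurable_snd)

theorem IsTransitionFunction.exists_forwardVec_bounds
    (hQ : IsTransitionFunction (g.intensityFun T) Q) (hT : ∀ k, IsSubIntensity (T k))
    (π : Fin p → ℝ) :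
    ∃ L, 0 ≤ L ∧ (∀ s, 0 ≤ s → ∀ i, |forwardVec g π T s i| ≤ L) ∧
      (∀ s t, 0 ≤ s → s ≤ t → ∀ i,
        |forwardVec g π T t i - forwardVec g π T s i| ≤ L * (t - s)) := by
  obtain ⟨L, hL0, -, -, hL, -, -⟩ := hQ.exists_bounds hT
  let M := ∑ l, |π l|
  have hM : 0 ≤ M := Finset.sum_nonneg fun _ _ => abs_nonneg _
  refine ⟨M * (L + 1), by positivity, fun s hs i => ?_, fun s t hs hst i => ?_⟩
  · simp only [forwardVec, Matrix.vecMul, dotProduct]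
    refine (Finset.abs_sum_le_sum_abs _ _).trans ?_
    calc ∑ l, |π l * subTrans g T 0 s l i| ≤ ∑ l, |π l| := by
          refine Finset.sum_le_sum fun l _ => ?_
          rw [abs_mul, ← hQ.apply_inl_inl le_rfl hs]
          exact mul_le_of_le_one_right (abs_nonneg _) (hQ.abs_le_one hT le_rfl hs _ _)
      _ ≤ M * (L + 1) := by
          change M ≤ _
          nlinarith
  · simp only [forwardVec, Matrix.vecMul, dotProduct]
    rw [← Finset.sum_sub_distrib]
    refine (Finset.abs_sum_le_sum_abs _ _).trans ?_
    calc ∑ l, |π l * subTrans g T 0 t l i - π l * subTrans g T 0 s l i|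
        ≤ ∑ l, |π l| * (L * (t - s)) := by
          refine Finset.sum_le_sum fun l _ => ?_
          rw [← mul_sub, abs_mul, ← hQ.apply_inl_inl le_rfl hs,
            ← hQ.apply_inl_inl le_rfl (hs.trans hst)]
          exact mul_le_mul_of_nonneg_left (hL 0 s t le_rfl hs hst _ _) (abs_nonneg _)
      _ = M * (L * (t - s)) := by rw [← Finset.sum_mul]
      _ ≤ M * (L + 1) * (t - s) := by
          nlinarith [mul_nonneg hM (sub_nonneg.2 hst)]

theorem IsTransitionFunction.continuousOn_forwardVec
    (hQ : IsTransitionFunction (g.intensityFun T) Q) (hT : ∀ k, IsSubIntensity (T k))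
    (b : ℝ) (i : Fin p) : ContinuousOn (fun u => forwardVec g π T u i) (Set.Icc 0 b) := by
  obtain ⟨L, -, -, hL⟩ := hQ.exists_forwardVec_bounds hT π
  exact continuousOn_of_abs_sub_le fun x y hx hxy _ => hL x y hx hxy i

theorem IsTransitionFunction.continuousOn_left
    (hQ : IsTransitionFunction (g.intensityFun T) Q) (hT : ∀ k, IsSubIntensity (T k))
    (r : ℝ) (a b : State p) : ContinuousOn (fun u => Q u r a b) (Set.Icc 0 r) := by
  obtain ⟨L, -, -, -, -, hL, -⟩ := hQ.exists_bounds hT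
  refine continuousOn_of_abs_sub_le (L := L) fun x y hx hxy hy => ?_
  rw [abs_sub_comm]
  exact hL x y r hx hxy hy a b

theorem IsTransitionFunction.continuousOn_backwardVec
    (hQ : IsTransitionFunction (g.intensityFun T) Q) (hT : ∀ k, IsSubIntensity (T k))
    (x : ℝ) (i : Fin p) : ContinuousOn (fun u => backwardVec g T u x i) (Set.Icc 0 x) := by
  simp only [backwardVec, Matrix.mulVec, dotProduct]
  refine continuousOn_finsetSum _ fun l _ => ContinuousOn.mul ?_ continuousOn_const
  refine (hQ.continuousOn_left hT x (Sum.inl i) (Sum.inl l)).congr fun u hu => ?_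
  exact (hQ.apply_inl_inl hu.1 hu.2 i l).symm

theorem intervalIntegrable_intensityFun (a b : State p) (s t : ℝ) :
    IntervalIntegrable (fun u => g.intensityFun T u a b) volume s t := by
  obtain ⟨C, -, hC⟩ := exists_intensityFun_bound g T
  refine (intervalIntegrable_const (c := C)).mono_fun
    (measurable_intensityFun a b).aestronglyMeasurable (Eventually.of_forall fun u => ?_)
  exact (hC u a b).trans (le_abs_self _)

/-- The rate at which the process jumps from `i` to `j` at time `u` and is absorbed before `r`. -/
noncomputable def jumpRate (g : Grid K) (π : Fin p → ℝ) (T : Fin K → Matrix (Fin p) (Fin p) ℝ)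
    (Q : ℝ → ℝ → Matrix (State p) (State p) ℝ) (i : Fin p) (j : State p) (r u : ℝ) : ℝ :=
  forwardVec g π T u i * g.intensityFun T u (Sum.inl i) j * Q u r j (absorbing p)

theorem IsTransitionFunction.intervalIntegrable_jumpRate
    (hQ : IsTransitionFunction (g.intensityFun T) Q) (hT : ∀ k, IsSubIntensity (T k))
    (i : Fin p) (j : State p) {s t r : ℝ} (hs : 0 ≤ s) (hst : s ≤ t) (htr : t ≤ r) :
    IntervalIntegrable (jumpRate g π T Q i j r) volume s t := by
  have hsub : Set.uIcc s t ⊆ Set.Icc 0 r := by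
    rw [Set.uIcc_of_le hst]; exact Set.Icc_subset_Icc hs htr
  refine IntervalIntegrable.mul_continuousOn ?_ ((hQ.continuousOn_left hT r _ _).mono hsub)
  exact (intervalIntegrable_intensityFun _ _ s t).continuousOn_mul
    ((hQ.continuousOn_forwardVec hT r i).mono hsub)

/-- Short-time asymptotics of the probability of a transition from `i` to `j`. -/
theorem IsTransitionFunction.exists_abs_sub_integral_jumpRate_le
    (hQ : IsTransitionFunction (g.intensityFun T) Q) (hT : ∀ k, IsSubIntensity (T k))
    (π : Fin p → ℝ) :
    ∃ C, 0 ≤ C ∧ ∀ (i : Fin p) (j : State p), j ≠ Sum.inl i → ∀ s t r, 0 ≤ s → s ≤ t → t ≤ r →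
      |forwardVec g π T s i * Q s t (Sum.inl i) j * Q t r j (absorbing p) -
        ∫ u in s..t, jumpRate g π T Q i j r u| ≤ C * (t - s) ^ 2 := by
  obtain ⟨L, hL0, hΛ, -, -, hA, hq⟩ := hQ.exists_bounds hT
  obtain ⟨M, hM0, hw, hw'⟩ := hQ.exists_forwardVec_bounds hT π
  refine ⟨M * L + (M * L * L + M * L), by positivity, fun i j hij s t r hs hst htr => ?_⟩
  have hts := sub_nonneg.2 hst
  set W := forwardVec g π T s i
  set A := Q t r j (absorbing p)
  have hA1 : |A| ≤ 1 := hQ.abs_le_one hT (hs.trans hst) htr _ _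
  have h0 : (1 : Matrix (State p) (State p) ℝ) (Sum.inl i) j = 0 := Matrix.one_apply_ne hij.symm
  have hq' := hq s t hs hst (Sum.inl i) j
  rw [h0, sub_zero] at hq'
  have hint := intervalIntegrable_intensityFun (g := g) (T := T) (Sum.inl i) j s t
  -- Two errors of second order: replacing the transition probability by the integrated intensity
  -- (first order being exact because j ≠ i kills the identity), and freezing the outer factors at
  -- `s` and `t`, where they are Lipschitz.
  have hsplit : W * Q s t (Sum.inl i) j * A - ∫ u in s..t, jumpRate g π T Q i j r u =
      W * A * (Q s t (Sum.inl i) j - ∫ u in s..t, g.intensityFun T u (Sum.inl i) j) +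
      ∫ u in s..t, (W * A * g.intensityFun T u (Sum.inl i) j - jumpRate g π T Q i j r u) := by
    rw [intervalIntegral.integral_sub (hint.const_mul _)
      (hQ.intervalIntegrable_jumpRate hT i j hs hst htr), intervalIntegral.integral_const_mul]
    ring
  rw [hsplit]
  refine (abs_add_le _ _).trans ?_
  rw [add_mul]
  refine add_le_add ?_ ?_
  · rw [abs_mul, abs_mul, mul_assoc M L]
    refine mul_le_mul ?_ hq' (abs_nonneg _) hM0
    exact (mul_le_mul (hw s hs i) hA1 (abs_nonneg _) hM0).trans (mul_one M).le
  · rw [← Real.norm_eq_abs]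
    refine (intervalIntegral.norm_integral_le_of_norm_le_const
      (C := (M * L * L + M * L) * (t - s)) fun u hu => ?_).trans ?_
    · rw [Set.uIoc_of_le hst] at hu
      have e : W * A * g.intensityFun T u (Sum.inl i) j - jumpRate g π T Q i j r u =
          g.intensityFun T u (Sum.inl i) j * (W * (A - Q u r j (absorbing p)) +
            (W - forwardVec g π T u i) * Q u r j (absorbing p)) := by
        rw [jumpRate]; ring
      rw [e, Real.norm_eq_abs, abs_mul]
      have h1 : |A - Q u r j (absorbing p)| ≤ L * (t - s) := by
        rw [abs_sub_comm]
        refine (hA u t r (hs.trans hu.1.le) hu.2 htr _ _).trans ?_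
        exact mul_le_mul_of_nonneg_left (by linarith [hu.1]) hL0
      have h2 : |W - forwardVec g π T u i| ≤ M * (t - s) := by
        rw [abs_sub_comm]
        refine (hw' s u hs hu.1.le i).trans ?_
        exact mul_le_mul_of_nonneg_left (by linarith [hu.2]) hM0
      have h3 : |Q u r j (absorbing p)| ≤ 1 :=
        hQ.abs_le_one hT (hs.trans hu.1.le) (hu.2.trans htr) _ _
      have h4 : |W * (A - Q u r j (absorbing p)) +
            (W - forwardVec g π T u i) * Q u r j (absorbing p)| ≤
          M * (L * (t - s)) + M * (t - s) * 1 := by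
        refine (abs_add_le _ _).trans (add_le_add ?_ ?_)
        · rw [abs_mul]; exact mul_le_mul (hw s hs i) h1 (abs_nonneg _) hM0
        · rw [abs_mul]; exact mul_le_mul h2 h3 (abs_nonneg _) (by positivity)
      refine (mul_le_mul (hΛ u _ _) h4 (abs_nonneg _) hL0).trans (le_of_eq (by ring))
    · rw [abs_of_nonneg hts]
      exact le_of_eq (by ring)

end Forward

/-! ### Finite-dimensional distributions -/

section Law

variable {Ω : Type*} [MeasurableSpace Ω] {P : Measure Ω} [IsFiniteMeasure P]
  {S : Type*} [Fintype S] [DecidableEq S] [MeasurableSpace S] [MeasurableSingletonClass S]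
  {α : S → ℝ} {Λ : ℝ → Matrix S S ℝ} {X : ℝ≥0 → Ω → S}

/-- The defining distributions start at time 0. Inserting that time and summing over the initial
state gives the law at three arbitrary times, which is all that the later arguments use: two ends of
a partition interval and a horizon. -/
theorem IsMarkovJumpProcess.exists_law (hX : IsMarkovJumpProcess P α Λ X) :
    ∃ Q : ℝ → ℝ → Matrix S S ℝ, IsTransitionFunction Λ Q ∧
      (∀ (s t r : ℝ≥0), s ≤ t → t ≤ r → ∀ a b c,
        P.real {ω | X s ω = a ∧ X t ω = b ∧ X r ω = c} =
          (∑ x, α x * Q 0 s x a) * Q s t a b * Q t r b c) := by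
  obtain ⟨Q, hQ, h⟩ := hX.law
  refine ⟨Q, hQ, fun s t r hst htr a b c => ?_⟩
  have hm : ∀ t a, MeasurableSet {ω | X t ω = a} := fun t a =>
    hX.measurable t (measurableSet_singleton a)
  have h1 : ∀ x, P.real ({ω | X s ω = a ∧ X t ω = b ∧ X r ω = c} ∩ {ω | X 0 ω = x}) =
      α x * (Q 0 s x a * (Q s t a b * Q t r b c)) := by
    intro x
    have := h 3 ![0, s, t, r] rfl (by
      rw [Fin.monotone_iff_le_succ]
      intro i
      fin_cases i
      · exact bot_le
      · exact hst
      · exact htr) ![x, a, b, c]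
    simp only [Fin.prod_univ_succ, Fin.forall_fin_succ] at this
    simp at this
    rw [← this]
    congr 1
    ext ω
    simp only [Set.mem_inter_iff, Set.mem_ofPred_eq]
    tauto
  have h2 : P.real {ω | X s ω = a ∧ X t ω = b ∧ X r ω = c} =
      ∑ x, P.real ({ω | X s ω = a ∧ X t ω = b ∧ X r ω = c} ∩ {ω | X 0 ω = x}) := by
    rw [← measureReal_biUnion_finset]
    · congr 1
      ext ω
      simp
    · intro x _ y _ hxy
      refine Set.disjoint_left.2 fun ω h1 h2 => hxy (h1.2.symm.trans h2.2)
    · intro x _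
      exact ((hm s a).inter ((hm t b).inter (hm r c))).inter (hm 0 x)
  rw [h2, Finset.sum_congr rfl fun x _ => h1 x, Finset.sum_mul, Finset.sum_mul]
  exact Finset.sum_congr rfl fun x _ => by ring

end Law

end IPH

namespace IPH

/-! ### Step paths and their jumps -/

/-- A right-continuous step path with left limits in a discrete space. -/
structure IsStepPath {S : Type*} (x : ℝ≥0 → S) : Prop where
  right : ∀ t, ∀ᶠ u in 𝓝[>] t, x u = x t
  left : ∀ t, 0 < t → ∃ i : S, ∀ᶠ u in 𝓝[<] t, x u = i

/-- The times in `(a, b]` at which the path jumps from `i` to `j`. -/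
def jumpsIoc {S : Type*} (x : ℝ≥0 → S) (i j : S) (a b : ℝ≥0) : Set ℝ≥0 :=
  {u | u ∈ Set.Ioc a b ∧ (∀ᶠ v in 𝓝[<] u, x v = i) ∧ x u = j}

/-- The `m`-th point of the dyadic partition of order `n` of `[a, a + h]`. -/
noncomputable def dyadicPt (a h : ℝ≥0) (n m : ℕ) : ℝ≥0 := a + m * (h / 2 ^ n)

section Dyadic

variable (a h : ℝ≥0) (n : ℕ)

theorem dyadicPt_zero : dyadicPt a h n 0 = a := by simp [dyadicPt]

theorem dyadicPt_top : dyadicPt a h n (2 ^ n) = a + h := by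
  rw [dyadicPt]
  push_cast
  rw [mul_div_cancel₀]
  positivity

theorem dyadicPt_succ (m : ℕ) : dyadicPt a h n (m + 1) = dyadicPt a h n m + h / 2 ^ n := by
  rw [dyadicPt, dyadicPt]; push_cast; ring

theorem dyadicPt_mono : Monotone (dyadicPt a h n) :=
  monotone_nat_of_le_succ fun m => by rw [dyadicPt_succ]; exact le_self_add

theorem dyadicPt_two_mul (m : ℕ) : dyadicPt a h (n + 1) (2 * m) = dyadicPt a h n m := by
  rw [dyadicPt, dyadicPt, pow_succ]
  push_cast
  congr 1
  field_simp

theorem tendsto_dyadic_mesh : Tendsto (fun n : ℕ => h / 2 ^ n) atTop (𝓝 0) := by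
  have h1 : Tendsto (fun n : ℕ => (2⁻¹ : ℝ≥0) ^ n) atTop (𝓝 0) :=
    NNReal.tendsto_pow_atTop_nhds_zero_of_lt_one (by
      rw [← NNReal.coe_lt_coe]; push_cast; norm_num)
  have h2 := h1.const_mul h
  rw [mul_zero] at h2
  refine h2.congr fun n => ?_
  rw [inv_pow, div_eq_mul_inv]

theorem exists_mem_dyadic {u : ℝ≥0} (hu : u ∈ Set.Ioc a (a + h)) :
    ∃ m < 2 ^ n, u ∈ Set.Ioc (dyadicPt a h n m) (dyadicPt a h n (m + 1)) := by
  have hex : ∃ m, u ≤ dyadicPt a h n m := ⟨2 ^ n, by rw [dyadicPt_top]; exact hu.2⟩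
  classical
  have hpos : 0 < Nat.find hex := by
    rw [Nat.find_pos, dyadicPt_zero, not_le]
    exact hu.1
  obtain ⟨m, hm⟩ := Nat.exists_eq_succ_of_ne_zero hpos.ne'
  refine ⟨m, ?_, not_le.1 (Nat.find_min hex (by omega)), ?_⟩
  · have : Nat.find hex ≤ 2 ^ n := Nat.find_min' hex (by rw [dyadicPt_top]; exact hu.2)
    omega
  · have := Nat.find_spec hex
    rwa [hm] at this

theorem dyadic_subset {m : ℕ} (hm : m < 2 ^ n) :
    Set.Ioc (dyadicPt a h n m) (dyadicPt a h n (m + 1)) ⊆ Set.Ioc a (a + h) := by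
  refine Set.Ioc_subset_Ioc ?_ ?_
  · exact (dyadicPt_zero a h n).symm.le.trans (dyadicPt_mono a h n (Nat.zero_le m))
  · exact (dyadicPt_mono a h n hm).trans (dyadicPt_top a h n).le

end Dyadic

namespace IsStepPath

variable {S : Type*} {x : ℝ≥0 → S}

theorem exists_Ico (hx : IsStepPath x) (t : ℝ≥0) : ∃ c, t < c ∧ ∀ v ∈ Set.Ico t c, x v = x t := by
  obtain ⟨c, hc, hs⟩ := (mem_nhdsGT_iff_exists_Ioo_subset (a := t)).1 (hx.right t)
  refine ⟨c, hc, fun v hv => ?_⟩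
  rcases hv.1.eq_or_lt with rfl | h
  · rfl
  · exact hs ⟨h, hv.2⟩

theorem exists_Ioo (hx : IsStepPath x) {t : ℝ≥0} (ht : 0 < t) :
    ∃ b, b < t ∧ ∃ i, ∀ v ∈ Set.Ioo b t, x v = i := by
  obtain ⟨i, hi⟩ := hx.left t ht
  obtain ⟨b, hb, hs⟩ := (mem_nhdsLT_iff_exists_Ioo_subset' ht).1 hi
  exact ⟨b, hb, i, fun v hv => hs hv⟩

theorem neBot_nhdsLT {t : ℝ≥0} (ht : 0 < t) : (𝓝[<] t).NeBot := nhdsLT_neBot_of_exists_lt ⟨0, ht⟩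

/-- The path is constant on an interval without discontinuities. -/
theorem eq_of_forall_eventually (hx : IsStepPath x) {s t : ℝ≥0} (hst : s ≤ t)
    (h : ∀ u ∈ Set.Ioc s t, ∀ᶠ v in 𝓝[<] u, x v = x u) : x s = x t := by
  -- With the discrete topology, absence of discontinuities is continuity, and a continuous map from
  -- an interval to a discrete space is constant.
  let _ : TopologicalSpace S := ⊥
  have : DiscreteTopology S := ⟨rfl⟩
  refine isPreconnected_Icc.constant (s := Set.Icc s t) (f := x) (fun u hu => ?_)
    (Set.left_mem_Icc.2 hst) (Set.right_mem_Icc.2 hst)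
  rw [ContinuousWithinAt, nhds_discrete, tendsto_pure]
  have hr : ∀ᶠ v in 𝓝[≥] u, x v = x u := by
    rw [← Set.Ioi_insert, nhdsWithin_insert, eventually_sup]
    exact ⟨by simp, hx.right u⟩
  rcases hu.1.eq_or_lt with rfl | hlt
  · exact hr.filter_mono (nhdsWithin_mono _ Set.Icc_subset_Ici_self)
  · refine Eventually.filter_mono nhdsWithin_le_nhds ?_
    rw [← nhdsLT_sup_nhdsGE, eventually_sup]
    exact ⟨h u ⟨hlt, hu.2⟩, hr⟩

/-- One-sided constancy gives every time a neighbourhood with no discontinuity except possibly that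
time itself. Compactness then leaves finitely many on a bounded interval. -/
theorem finite_discontinuities (hx : IsStepPath x) (a b : ℝ≥0) :
    {u | u ∈ Set.Ioc a b ∧ ¬ ∀ᶠ v in 𝓝[<] u, x v = x u}.Finite := by
  set D : Set ℝ≥0 := {u | 0 < u ∧ ¬ ∀ᶠ v in 𝓝[<] u, x v = x u} with hD
  have hloc : ∀ u, ∃ t ∈ 𝓝 u, (D ∩ t).Finite := by
    intro u
    obtain ⟨c, hc, hcs⟩ := hx.exists_Ico u
    have hr : ∀ v ∈ Set.Ioo u c, v ∉ D := fun v hv hvD => hvD.2 <| by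
      filter_upwards [Ioo_mem_nhdsLT hv.1] with w hw
      rw [hcs v ⟨hv.1.le, hv.2⟩, hcs w ⟨hw.1.le, hw.2.trans hv.2⟩]
    rcases eq_or_ne u 0 with rfl | hu
    · refine ⟨Set.Iio c, Iio_mem_nhds hc, (Set.finite_singleton 0).subset ?_⟩
      rintro v ⟨hv, hvc⟩
      by_contra hne
      exact hr v ⟨pos_iff_ne_zero.2 hne, hvc⟩ hv
    · obtain ⟨b, hb, i, hbs⟩ := hx.exists_Ioo (pos_iff_ne_zero.2 hu)
      refine ⟨Set.Ioo b c, Ioo_mem_nhds hb hc, (Set.finite_singleton u).subset ?_⟩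
      rintro v ⟨hv, hvb, hvc⟩
      rcases lt_trichotomy v u with h | h | h
      · exfalso
        refine hv.2 ?_
        filter_upwards [Ioo_mem_nhdsLT hvb] with w hw
        rw [hbs v ⟨hvb, h⟩, hbs w ⟨hw.1, hw.2.trans h⟩]
      · exact h
      · exact absurd hv (hr v ⟨h, hvc⟩)
  have hfin : (D ∩ Set.Icc a b).Finite := by
    refine isCompact_Icc.induction_on (p := fun s => (D ∩ s).Finite) (by simp)
      (fun s t hst ht => ht.subset (Set.inter_subset_inter_right _ hst))
      (fun s t hs ht => by rw [Set.inter_union_distrib_left]; exact hs.union ht) fun u _ => ?_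
    obtain ⟨t, ht, hf⟩ := hloc u
    exact ⟨t, mem_nhdsWithin_of_mem_nhds ht, hf⟩
  refine hfin.subset ?_
  rintro u ⟨hu, hud⟩
  exact ⟨⟨zero_le.trans_lt hu.1, hud⟩, hu.1.le, hu.2⟩

theorem eventually_ne_of_mem_jumpsIoc {i j : S} (hij : i ≠ j) {a b u : ℝ≥0}
    (hu : u ∈ jumpsIoc x i j a b) : ¬ ∀ᶠ v in 𝓝[<] u, x v = x u := by
  intro h
  have := neBot_nhdsLT (zero_le.trans_lt hu.1.1)
  obtain ⟨v, hv1, hv2⟩ := (h.and hu.2.1).exists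
  exact hij (hv2.symm.trans (hv1.trans hu.2.2))

/-- Jumps can be counted along fine dyadic partitions. -/
theorem eventually_card_dyadic [DecidableEq S] (hx : IsStepPath x) {i j : S} (hij : i ≠ j)
    (a h : ℝ≥0) :
    ∀ᶠ n in atTop, ((Finset.range (2 ^ n)).filter fun m =>
      x (dyadicPt a h n m) = i ∧ x (dyadicPt a h n (m + 1)) = j).card =
        (jumpsIoc x i j a (a + h)).ncard := by
  set D := {u | u ∈ Set.Ioc a (a + h) ∧ ¬ ∀ᶠ v in 𝓝[<] u, x v = x u} with hD
  have hDf : D.Finite := hx.finite_discontinuities a (a + h)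
  -- Once the mesh is small, the partition interval containing a discontinuity `u` shows only the
  -- left limit before `u` and only the value at `u` from then on. `D` contains all discontinuities,
  -- not merely jumps from `i` to `j`, and being finite it allows one order `n` for all.
  have hloc : ∀ u ∈ D, ∃ l, (∀ᶠ v in 𝓝[<] u, x v = l) ∧ ∀ᶠ n in atTop, ∀ m : ℕ,
      u ∈ Set.Ioc (dyadicPt a h n m) (dyadicPt a h n (m + 1)) →
      (∀ v ∈ Set.Ico (dyadicPt a h n m) u, x v = l) ∧
      ∀ v ∈ Set.Icc u (dyadicPt a h n (m + 1)), x v = x u := by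
    intro u hu
    have hu0 : 0 < u := zero_le.trans_lt hu.1.1
    obtain ⟨c, hc, hcs⟩ := hx.exists_Ico u
    obtain ⟨b, hb, l, hbs⟩ := hx.exists_Ioo hu0
    refine ⟨l, by filter_upwards [Ioo_mem_nhdsLT hb] with v hv using hbs v hv, ?_⟩
    have h1 : ∀ᶠ n : ℕ in atTop, u + h / 2 ^ n < c := by
      have := (tendsto_dyadic_mesh h).const_add u
      rw [add_zero] at this
      exact this.eventually_lt_const hc
    have h2 : ∀ᶠ n : ℕ in atTop, b + h / 2 ^ n < u := by
      have := (tendsto_dyadic_mesh h).const_add b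
      rw [add_zero] at this
      exact this.eventually_lt_const hb
    filter_upwards [h1, h2] with n hn1 hn2 m hm
    rw [dyadicPt_succ] at hm ⊢
    refine ⟨fun v hv => hbs v ⟨?_, hv.2⟩, fun v hv => hcs v ⟨hv.1, ?_⟩⟩
    · refine lt_of_lt_of_le ?_ hv.1
      exact lt_of_add_lt_add_right (hn2.trans_le hm.2)
    · exact hv.2.trans_lt ((add_lt_add_left hm.1 _).trans hn1)
  have : Nonempty S := ⟨x 0⟩
  choose! l hl1 hl2 using hloc
  filter_upwards [(eventually_all_finite hDf).2 hl2] with n hn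
  set M := (Finset.range (2 ^ n)).filter fun m =>
      x (dyadicPt a h n m) = i ∧ x (dyadicPt a h n (m + 1)) = j with hM
  have hJD : ∀ u ∈ jumpsIoc x i j a (a + h), u ∈ D := fun u hu =>
    ⟨hu.1, eventually_ne_of_mem_jumpsIoc hij hu⟩
  have hJl : ∀ u ∈ jumpsIoc x i j a (a + h), l u = i := fun u hu => by
    have := neBot_nhdsLT (zero_le.trans_lt hu.1.1)
    obtain ⟨v, hv1, hv2⟩ := ((hl1 u (hJD u hu)).and hu.2.1).exists
    exact hv1.symm.trans hv2
  rw [← Set.ncard_coe_finset]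
  symm
  refine Set.ncard_congr
    (fun u hu => (exists_mem_dyadic a h n (jumpsIoc.eq_1 x i j a (a + h) ▸ hu).1).choose) ?_ ?_ ?_
  · intro u hu
    obtain ⟨hm1, hm2⟩ := (exists_mem_dyadic a h n hu.1).choose_spec
    set m := (exists_mem_dyadic a h n hu.1).choose
    obtain ⟨h1, h2⟩ := hn u (hJD u hu) m hm2
    rw [Finset.mem_coe, hM, Finset.mem_filter, Finset.mem_range]
    refine ⟨hm1, ?_, ?_⟩
    · rw [h1 _ ⟨le_rfl, hm2.1⟩, hJl u hu]
    · rw [h2 _ ⟨hm2.2, le_rfl⟩, hu.2.2]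
  -- Injectivity: after a jump the path is constant to the end of its partition interval, so no
  -- second discontinuity fits there.
  · have key : ∀ u v m, u ∈ jumpsIoc x i j a (a + h) → v ∈ jumpsIoc x i j a (a + h) →
        u ∈ Set.Ioc (dyadicPt a h n m) (dyadicPt a h n (m + 1)) →
        v ∈ Set.Ioc (dyadicPt a h n m) (dyadicPt a h n (m + 1)) → ¬ u < v := by
      intro u v m hu hv hmu hmv huv
      obtain ⟨-, h2⟩ := hn u (hJD u hu) m hmu
      refine (hJD v hv).2 ?_
      filter_upwards [Ioo_mem_nhdsLT huv] with w hw
      rw [h2 w ⟨hw.1.le, hw.2.le.trans hmv.2⟩, h2 v ⟨huv.le, hmv.2⟩]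
    intro u v hu hv huv
    have hu2 := (exists_mem_dyadic a h n hu.1).choose_spec.2
    have hv2 := (exists_mem_dyadic a h n hv.1).choose_spec.2
    rw [← huv] at hv2
    exact le_antisymm (not_lt.1 (key v u _ hv hu hv2 hu2)) (not_lt.1 (key u v _ hu hv hu2 hv2))
  · intro m hm
    rw [Finset.mem_coe, hM, Finset.mem_filter, Finset.mem_range] at hm
    obtain ⟨hm0, hmi, hmj⟩ := hm
    -- Surjectivity: different values at the ends force a discontinuity inside, and its left limit
    -- and value must then be those end values `i` and `j`.
    obtain ⟨u, hu, hud⟩ : ∃ u ∈ Set.Ioc (dyadicPt a h n m) (dyadicPt a h n (m + 1)),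
        ¬ ∀ᶠ v in 𝓝[<] u, x v = x u := by
      by_contra! hcon
      refine hij ?_
      rw [← hmi, ← hmj]
      exact hx.eq_of_forall_eventually (dyadicPt_mono a h n (Nat.le_succ m)) hcon
    have huI := dyadic_subset a h n hm0 hu
    have huD : u ∈ D := ⟨huI, hud⟩
    obtain ⟨h1, h2⟩ := hn u huD m hu
    have hli : l u = i := by rw [← hmi, h1 _ ⟨le_rfl, hu.1⟩]
    have huj : x u = j := by rw [← hmj, h2 _ ⟨hu.2, le_rfl⟩]
    have huJ : u ∈ jumpsIoc x i j a (a + h) := ⟨huI, hli ▸ hl1 u huD, huj⟩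
    refine ⟨u, huJ, ?_⟩
    have hs := (exists_mem_dyadic a h n huJ.1).choose_spec.2
    set m' := (exists_mem_dyadic a h n huJ.1).choose
    by_contra hne
    rcases lt_or_gt_of_ne hne with hlt | hlt
    · exact absurd (hu.1.trans_le (hs.2.trans (dyadicPt_mono a h n hlt))) (lt_irrefl _)
    · exact absurd (hs.1.trans_le (hu.2.trans (dyadicPt_mono a h n hlt))) (lt_irrefl _)

end IsStepPath

theorem sum_range_two_mul_dyadic {M : Type*} [AddCommMonoid M] (f : ℕ → M) (n : ℕ) :
    ∑ m ∈ Finset.range (2 * n), f m = ∑ m ∈ Finset.range n, (f (2 * m) + f (2 * m + 1)) := by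
  induction n with
  | zero => simp
  | succ n ih =>
    rw [Nat.mul_succ, Finset.sum_range_succ, Finset.sum_range_succ, Finset.sum_range_succ, ih,
      add_assoc]

/-- Refining the partition can only reveal more changes of state. -/
theorem monotone_sum_dyadic {S : Type*} [DecidableEq S] (x : ℝ≥0 → S) (a h : ℝ≥0) :
    Monotone fun n : ℕ => ∑ m ∈ Finset.range (2 ^ n),
      if x (dyadicPt a h n m) ≠ x (dyadicPt a h n (m + 1)) then (1 : ℝ≥0∞) else 0 := by
  refine monotone_nat_of_le_succ fun n => ?_
  rw [pow_succ', sum_range_two_mul_dyadic]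
  refine Finset.sum_le_sum fun m _ => ?_
  have h2 : dyadicPt a h (n + 1) (2 * m + 1 + 1) = dyadicPt a h n (m + 1) := by
    rw [← dyadicPt_two_mul a h n (m + 1), mul_add]
  rw [dyadicPt_two_mul, h2]
  by_cases h1 : x (dyadicPt a h n m) = x (dyadicPt a h n (m + 1))
  · simp [h1]
  · by_cases h3 : x (dyadicPt a h n m) = x (dyadicPt a h (n + 1) (2 * m + 1))
    · rw [← h3, if_pos h1, if_neg (by simp)]
      simp
    · rw [if_pos h1, if_pos h3]
      exact le_self_add

end IPH

namespace IPH

theorem IsMarkovJumpProcess.isStepPath {Ω S : Type*} [MeasurableSpace Ω] [Fintype S]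
    [DecidableEq S] [MeasurableSpace S] {P : Measure Ω} {α : S → ℝ} {Λ : ℝ → Matrix S S ℝ}
    {X : ℝ≥0 → Ω → S} (hX : IsMarkovJumpProcess P α Λ X) (ω : Ω) : IsStepPath fun t => X t ω :=
  ⟨hX.right_continuous ω, hX.left_limit ω⟩

/-! ### Measurability -/

instance instMeasurableSingletonClassState (p : ℕ) : MeasurableSingletonClass (State p) := by
  refine ⟨fun a => ?_⟩
  rw [measurableSet_sum_iff]
  exact ⟨(Set.toFinite _).measurableSet, (Set.toFinite _).measurableSet⟩

section Measurability

variable {Ω S : Type*} [MeasurableSpace Ω] [MeasurableSpace S] [MeasurableSingletonClass S]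
  {X : ℝ≥0 → Ω → S}

/-- Joint measurability in time and outcome. The times `ρ n u` take countably many values and
decrease to `u` from strictly above within 1/(n+1), so by right-continuity the path at `ρ n u`
eventually equals the path at `u`. -/
theorem measurableSet_eq_of_isStepPath (hm : ∀ t, Measurable (X t))
    (hp : ∀ ω, IsStepPath fun t => X t ω) (i : S) :
    MeasurableSet {z : ℝ≥0 × Ω | X z.1 z.2 = i} := by
  let ρ : ℕ → ℝ≥0 → ℝ≥0 := fun n u => (⌊(n + 1) * u⌋₊ + 1) / (n + 1)
  have hρ1 : ∀ n u, u < ρ n u := fun n u => by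
    simp only [ρ]
    rw [lt_div_iff₀ (by positivity), mul_comm]
    exact Nat.lt_floor_add_one _
  have hρ2 : ∀ n u, ρ n u ≤ u + 1 / (n + 1) := fun n u => by
    simp only [ρ]
    have h0 : ((n : ℝ≥0) + 1) ≠ 0 := by positivity
    rw [div_le_iff₀ (by positivity), add_mul u, div_mul_cancel₀ _ h0, mul_comm u]
    gcongr
    exact Nat.floor_le zero_le
  have hset : {z : ℝ≥0 × Ω | X z.1 z.2 = i} =
      ⋃ N : ℕ, ⋂ n : ℕ, ⋂ _ : N ≤ n, {z : ℝ≥0 × Ω | X (ρ n z.1) z.2 = i} := by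
    ext ⟨u, ω⟩
    have hev : ∀ᶠ n : ℕ in atTop, X (ρ n u) ω = X u ω := by
      obtain ⟨c, hc, hcs⟩ := (hp ω).exists_Ico u
      have h0 : Tendsto (fun n : ℕ => u + 1 / ((n : ℝ≥0) + 1)) atTop (𝓝 (u + 0)) :=
        tendsto_const_nhds.add tendsto_one_div_add_atTop_nhds_zero_nat
      rw [add_zero] at h0
      filter_upwards [h0.eventually_lt_const hc] with n hn
      exact hcs _ ⟨(hρ1 n u).le, (hρ2 n u).trans_lt hn⟩
    obtain ⟨N, hN⟩ := eventually_atTop.1 hev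
    simp only [Set.mem_ofPred_eq, Set.mem_iUnion, Set.mem_iInter]
    constructor
    · intro h
      exact ⟨N, fun n hn => (hN n hn).trans h⟩
    · rintro ⟨N', hN'⟩
      rw [← hN (max N N') (le_max_left _ _)]
      exact hN' _ (le_max_right _ _)
  rw [hset]
  refine MeasurableSet.iUnion fun N => MeasurableSet.iInter fun n => MeasurableSet.iInter fun _ => ?_
  have h1 : Measurable fun z : ℕ × Ω => X ((z.1 + 1) / (n + 1)) z.2 :=
    measurable_from_prod_countable_right fun k => hm ((k + 1) / (n + 1))
  have h2 : Measurable fun z : ℝ≥0 × Ω => (⌊((n : ℝ≥0) + 1) * z.1⌋₊, z.2) :=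
    (Nat.measurable_floor.comp (measurable_fst.const_mul _)).prodMk measurable_snd
  have h3 := h1.comp h2
  exact h3 (measurableSet_singleton i)

theorem measurable_ncard_jumpsIoc [DecidableEq S] (hm : ∀ t, Measurable (X t))
    (hp : ∀ ω, IsStepPath fun t => X t ω) {i j : S} (hij : i ≠ j) (a h : ℝ≥0) :
    Measurable fun ω => ((jumpsIoc (fun t => X t ω) i j a (a + h)).ncard : ℝ≥0∞) := by
  refine measurable_of_tendsto_metrizable (f := fun n ω => ∑ m ∈ Finset.range (2 ^ n),
    if X (dyadicPt a h n m) ω = i ∧ X (dyadicPt a h n (m + 1)) ω = j then (1 : ℝ≥0∞) else 0)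
    (fun n => ?_) ?_
  · refine Finset.measurable_fun_sum _ fun m _ => Measurable.ite ?_ measurable_const measurable_const
    exact (hm _ (measurableSet_singleton i)).inter (hm _ (measurableSet_singleton j))
  · rw [tendsto_pi_nhds]
    intro ω
    refine tendsto_const_nhds.congr' ?_
    filter_upwards [(hp ω).eventually_card_dyadic hij a h] with n hn
    rw [← hn, Finset.card_filter]
    push_cast
    rfl

end Measurability

/-! ### Absorption -/

/-- Right-continuity makes the infimum attained: a path not absorbed at `r` stays unabsorbed a
little longer, and by the trap property it was not absorbed earlier either. -/
theorem absorptionTime_le_iff {Ω : Type*} {p : ℕ} {X : ℝ≥0 → Ω → State p} {ω : Ω}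
    (hp : IsStepPath fun t => X t ω)
    (h : ∀ s t, s ≤ t → X s ω = absorbing p → X t ω = absorbing p) (r : ℝ≥0) :
    absorptionTime X ω ≤ r ↔ X r ω = absorbing p := by
  constructor
  · intro hr
    by_contra hne
    obtain ⟨c, hc, hcs⟩ := hp.exists_Ico r
    have : (c : ℝ≥0∞) ≤ absorptionTime X ω := by
      refine le_iInf₂ fun t ht => ?_
      rw [ENNReal.coe_le_coe]
      by_contra hlt
      rw [not_le] at hlt
      rcases le_total r t with hrt | hrt
      · exact hne ((hcs t ⟨hrt, hlt⟩).symm.trans ht)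
      · exact hne (h t r hrt ht)
    have h2 := this.trans hr
    rw [ENNReal.coe_le_coe] at h2
    exact absurd hc (not_lt.2 h2)
  · intro hr
    exact iInf₂_le r hr

section Absorption

variable {Ω : Type*} [MeasurableSpace Ω] {P : Measure Ω} {p K : ℕ} {g : Grid K}
  {T : Fin K → Matrix (Fin p) (Fin p) ℝ} {α : State p → ℝ} {X : ℝ≥0 → Ω → State p}

/-- By right-continuity, absorption at some time below `c` is absorption at some time below `c` in a
countable dense set. The trap property plays no role here. -/
theorem measurable_absorptionTime (hm : ∀ t, Measurable (X t))
    (hp : ∀ ω, IsStepPath fun t => X t ω) : Measurable (absorptionTime X) := by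
  obtain ⟨D, hDc, hDd⟩ := TopologicalSpace.exists_countable_dense ℝ≥0
  refine measurable_of_Iio fun c => ?_
  have : absorptionTime X ⁻¹' Set.Iio c =
      ⋃ q ∈ {q ∈ D | (q : ℝ≥0∞) < c}, {ω | X q ω = absorbing p} := by
    ext ω
    simp only [Set.mem_preimage, Set.mem_Iio, absorptionTime, iInf_lt_iff, Set.mem_iUnion,
      Set.mem_ofPred_eq, exists_prop]
    constructor
    · rintro ⟨t, ht, htc⟩
      obtain ⟨d, hd, hds⟩ := (hp ω).exists_Ico t
      obtain ⟨e, he1, he2⟩ := ENNReal.lt_iff_exists_nnreal_btwn.1 htc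
      have hte : t < min d e := lt_min hd (by exact_mod_cast he1)
      obtain ⟨q, hq, hq1, hq2⟩ := hDd.exists_between hte
      refine ⟨q, ⟨hq, ?_⟩, (hds q ⟨hq1.le, hq2.trans_le (min_le_left _ _)⟩).trans ht⟩
      exact lt_trans (by exact_mod_cast hq2.trans_le (min_le_right _ _)) he2
    · rintro ⟨q, ⟨-, hq⟩, hqX⟩
      exact ⟨q, hqX, hq⟩
  rw [this]
  exact MeasurableSet.biUnion (hDc.mono fun q hq => hq.1)
    fun q _ => hm q (measurableSet_singleton _)

/-- Almost surely the process stays in the absorbing state once it has reached it. -/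
theorem IsMarkovJumpProcess.ae_absorbed [IsFiniteMeasure P]
    (hX : IsMarkovJumpProcess P α (g.intensityFun T) X) :
    ∀ᵐ ω ∂P, ∀ s t, s ≤ t → X s ω = absorbing p → X t ω = absorbing p := by
  obtain ⟨D, hDc, hDd⟩ := TopologicalSpace.exists_countable_dense ℝ≥0
  obtain ⟨Q, hQ, hlaw⟩ := hX.exists_law
  -- Only countably many null sets arise from times in the dense set; right-continuity at both times
  -- extends the statement to all pairs.
  have h1 : ∀ᵐ ω ∂P, ∀ s ∈ D, ∀ t ∈ D, s ≤ t → X s ω = absorbing p → X t ω = absorbing p := by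
    refine (ae_ball_iff hDc).2 fun s _ => (ae_ball_iff hDc).2 fun t _ => ?_
    by_cases hst : s ≤ t
    · have h2 : ∀ j, P {ω | X s ω = absorbing p ∧ X t ω = Sum.inl j ∧ X t ω = Sum.inl j} = 0 := by
        intro j
        have := hlaw s t t hst le_rfl (absorbing p) (Sum.inl j) (Sum.inl j)
        rw [hQ.apply_inr_inl s.coe_nonneg (by exact_mod_cast hst), mul_zero, zero_mul] at this
        exact (measureReal_eq_zero_iff).1 this
      have h3 : ∀ᵐ ω ∂P, ∀ j, ¬ (X s ω = absorbing p ∧ X t ω = Sum.inl j ∧ X t ω = Sum.inl j) :=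
        ae_all_iff.2 fun j => measure_eq_zero_iff_ae_notMem.1 (h2 j)
      filter_upwards [h3] with ω hω _ hs
      rcases hXt : X t ω with j | x
      · exact absurd ⟨hs, hXt, hXt⟩ (hω j)
      · rfl
    · exact Eventually.of_forall fun ω h => absurd h hst
  filter_upwards [h1] with ω hω s t hst hs
  rcases hst.eq_or_lt with rfl | hlt
  · exact hs
  obtain ⟨d, hd, hds⟩ := (hX.isStepPath ω).exists_Ico s
  obtain ⟨e, he, hes⟩ := (hX.isStepPath ω).exists_Ico t
  obtain ⟨s', hs', h1, h2⟩ := hDd.exists_between (lt_min hd hlt)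
  obtain ⟨t', ht', h3, h4⟩ := hDd.exists_between he
  have e1 : X s' ω = absorbing p := (hds s' ⟨h1.le, h2.trans_le (min_le_left _ _)⟩).trans hs
  have e2 := hω s' hs' t' ht' ((h2.le.trans (min_le_right _ _)).trans h3.le) e1
  exact (hes t' ⟨h3.le, h4⟩).symm.trans e2

end Absorption

/-! ### The expected number of jumps -/

section Jumps

variable {Ω : Type*} [MeasurableSpace Ω] {P : Measure Ω} {p K : ℕ}
  {g : Grid K} {T : Fin K → Matrix (Fin p) (Fin p) ℝ} {π : Fin p → ℝ} {X : ℝ≥0 → Ω → State p}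

/-- A Markov jump process together with the transition function behind its distribution. -/
structure HasLaw (P : Measure Ω) (g : Grid K) (π : Fin p → ℝ)
    (T : Fin K → Matrix (Fin p) (Fin p) ℝ) (X : ℝ≥0 → Ω → State p)
    (Q : ℝ → ℝ → Matrix (State p) (State p) ℝ) : Prop where
  process : IsMarkovJumpProcess P (initialLaw π) (g.intensityFun T) X
  transition : IsTransitionFunction (g.intensityFun T) Q
  law : ∀ (s t r : ℝ≥0), s ≤ t → t ≤ r → ∀ a b c,
    P.real {ω | X s ω = a ∧ X t ω = b ∧ X r ω = c} =
      (∑ x, initialLaw π x * Q 0 s x a) * Q s t a b * Q t r b c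

theorem IsMarkovJumpProcess.exists_hasLaw [IsFiniteMeasure P]
    (hX : IsMarkovJumpProcess P (initialLaw π) (g.intensityFun T) X) :
    ∃ Q, HasLaw P g π T X Q := by
  obtain ⟨Q, hQ, h⟩ := hX.exists_law
  exact ⟨Q, hX, hQ, h⟩

variable {Q : ℝ → ℝ → Matrix (State p) (State p) ℝ}

theorem HasLaw.law_inl (hX : HasLaw P g π T X Q) {s t r : ℝ≥0} (hst : s ≤ t) (htr : t ≤ r)
    (i : Fin p) (b c : State p) :
    P.real {ω | X s ω = Sum.inl i ∧ X t ω = b ∧ X r ω = c} =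
      forwardVec g π T s i * Q s t (Sum.inl i) b * Q t r b c := by
  rw [hX.law s t r hst htr, hX.transition.sum_initialLaw_mul_inl s.coe_nonneg]

theorem HasLaw.law_two (hX : HasLaw P g π T X Q) {s r : ℝ≥0} (hsr : s ≤ r) (a c : State p) :
    P.real {ω | X s ω = a ∧ X r ω = c} = (∑ x, initialLaw π x * Q 0 s x a) * Q s r a c := by
  have := hX.law s s r le_rfl hsr a a c
  rw [hX.transition.apply_self s.coe_nonneg, Matrix.one_apply_eq, mul_one] at this
  rw [← this]
  congr 1
  ext ω
  simp

theorem HasLaw.law_one (hX : HasLaw P g π T X Q) (s : ℝ≥0) (a : State p) :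
    P.real {ω | X s ω = a} = ∑ x, initialLaw π x * Q 0 s x a := by
  have := hX.law_two (le_refl s) a a
  rw [hX.transition.apply_self s.coe_nonneg, Matrix.one_apply_eq, mul_one] at this
  rw [← this]
  congr 1
  ext ω
  simp

/-- Off-diagonal transition probabilities are at most linear in the length of the interval. Summed
over a partition, this bounds the expected number of observed changes uniformly in the mesh. -/
theorem HasLaw.exists_change_bound [IsFiniteMeasure P] (hX : HasLaw P g π T X Q) (hT : ∀ k, IsSubIntensity (T k)) :
    ∃ C : ℝ, 0 ≤ C ∧ ∀ s t : ℝ≥0, s ≤ t →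
      P {ω | X s ω ≠ X t ω} ≤ ENNReal.ofReal (C * (t - s)) := by
  obtain ⟨L, hL0, -, hL, -, -, -⟩ := hX.transition.exists_bounds hT
  refine ⟨∑ q ∈ Finset.univ.filter (fun q : State p × State p => q.1 ≠ q.2), P.real Set.univ * L,
    by positivity, fun s t hst => ?_⟩
  have h1 : {ω | X s ω ≠ X t ω} ⊆
      ⋃ q ∈ Finset.univ.filter (fun q : State p × State p => q.1 ≠ q.2),
        {ω | X s ω = q.1 ∧ X t ω = q.2} := by
    intro ω hω
    simp only [Finset.mem_filter, Finset.mem_univ, true_and, Set.mem_iUnion, exists_prop]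
    exact ⟨(X s ω, X t ω), hω, rfl, rfl⟩
  rw [← ofReal_measureReal]
  refine ENNReal.ofReal_le_ofReal ?_
  refine (measureReal_mono h1 (measure_ne_top _ _)).trans ((measureReal_biUnion_finset_le _ _).trans ?_)
  rw [Finset.sum_mul]
  refine Finset.sum_le_sum fun q hq => ?_
  rw [hX.law_two hst, ← hX.law_one, mul_assoc]
  have h2 := hL s t s.coe_nonneg (by exact_mod_cast hst) q.1 q.2
  rw [Matrix.one_apply_ne (Finset.mem_filter.1 hq).2, sub_zero] at h2
  exact mul_le_mul (measureReal_mono (Set.subset_univ _)) ((le_abs_self _).trans h2)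
    (hX.transition.nonneg hT s.coe_nonneg (by exact_mod_cast hst) _ _) measureReal_nonneg

/-- Expected number of jumps from `i` to `j` during `(a, a + h]` on the event of absorption
before `r`. -/
theorem HasLaw.lintegral_ncard_jumpsIoc [IsFiniteMeasure P] (hX : HasLaw P g π T X Q)
    (hT : ∀ k, IsSubIntensity (T k)) {i : Fin p} {j : State p} (hij : j ≠ Sum.inl i)
    {a h r : ℝ≥0} (hr : a + h ≤ r) :
    ∫⁻ ω in {ω | X r ω = absorbing p},
        ((jumpsIoc (fun t => X t ω) (Sum.inl i) j a (a + h)).ncard : ℝ≥0∞) ∂P =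
      ENNReal.ofReal (∫ u in (a : ℝ)..(a + h : ℝ≥0), jumpRate g π T Q i j r u) := by
  have hm : ∀ t c, MeasurableSet {ω | X t ω = c} := fun t c =>
    hX.process.measurable t (measurableSet_singleton c)
  set R : Set Ω := {ω | X r ω = absorbing p} with hR
  let d : ℕ → ℕ → ℝ≥0 := dyadicPt a h
  let F : ℕ → Ω → ℝ≥0∞ := fun n ω => ∑ m ∈ Finset.range (2 ^ n),
    if X (d n m) ω = Sum.inl i ∧ X (d n (m + 1)) ω = j then (1 : ℝ≥0∞) else 0
  -- Changes of state of any kind, unlike those from `i` to `j`, only increase in number under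
  -- refinement. Their supremum therefore dominates every `F n` and, by monotone convergence, has
  -- expectation at most C·h.
  let J : ℕ → Ω → ℝ≥0∞ := fun n ω => ∑ m ∈ Finset.range (2 ^ n),
    if X (d n m) ω ≠ X (d n (m + 1)) ω then (1 : ℝ≥0∞) else 0
  have hFm' : ∀ n m, Measurable fun ω =>
      if X (d n m) ω = Sum.inl i ∧ X (d n (m + 1)) ω = j then (1 : ℝ≥0∞) else 0 := fun n m =>
    Measurable.ite ((hm _ _).inter (hm _ _)) measurable_const measurable_const
  have hne : ∀ n m, MeasurableSet {ω | X (d n m) ω ≠ X (d n (m + 1)) ω} := fun n m =>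
    (measurableSet_eq_fun (hX.process.measurable _) (hX.process.measurable _)).compl
  have hJm' : ∀ n m, Measurable fun ω =>
      if X (d n m) ω ≠ X (d n (m + 1)) ω then (1 : ℝ≥0∞) else 0 := fun n m =>
    Measurable.ite (hne n m) measurable_const measurable_const
  have hFm : ∀ n, Measurable (F n) := fun n => Finset.measurable_fun_sum _ fun m _ => hFm' n m
  have hJm : ∀ n, Measurable (J n) := fun n => Finset.measurable_fun_sum _ fun m _ => hJm' n m
  have hdmono : ∀ n m, d n m ≤ d n (m + 1) := fun n m => dyadicPt_mono a h n (Nat.le_succ m)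
  have hdr : ∀ n, ∀ m < 2 ^ n, d n (m + 1) ≤ r := fun n m hm' =>
    ((dyadicPt_mono a h n hm').trans (dyadicPt_top a h n).le).trans hr
  have hds : ∀ n m, ((d n (m + 1) : ℝ≥0) : ℝ) - d n m = h / 2 ^ n := fun n m => by
    simp only [d]
    rw [dyadicPt_succ]
    push_cast
    ring
  have hlim : Tendsto (fun n => ∫⁻ ω in R, F n ω ∂P) atTop
      (𝓝 (∫⁻ ω in R, ((jumpsIoc (fun t => X t ω) (Sum.inl i) j a (a + h)).ncard : ℝ≥0∞) ∂P)) := by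
    refine tendsto_lintegral_of_dominated_convergence (fun ω => ⨆ n, J n ω) hFm (fun n => ?_) ?_ ?_
    · refine Eventually.of_forall fun ω => le_trans ?_ (le_iSup (fun n => J n ω) n)
      refine Finset.sum_le_sum fun m _ => ?_
      by_cases hc : X (d n m) ω = Sum.inl i ∧ X (d n (m + 1)) ω = j
      · rw [if_pos hc, if_pos]
        rw [hc.1, hc.2]
        exact hij.symm
      · rw [if_neg hc]; exact zero_le
    · obtain ⟨C, hC0, hC⟩ := hX.exists_change_bound hT
      rw [lintegral_iSup hJm fun n n' hn ω => monotone_sum_dyadic (fun t => X t ω) a h hn]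
      refine ne_top_of_le_ne_top (b := ENNReal.ofReal (C * h)) ENNReal.ofReal_ne_top
        (iSup_le fun n => ?_)
      refine (setLIntegral_le_lintegral _ _).trans ?_
      simp only [J]
      rw [lintegral_finsetSum _ fun m _ => hJm' n m]
      calc ∑ m ∈ Finset.range (2 ^ n),
            ∫⁻ ω, (if X (d n m) ω ≠ X (d n (m + 1)) ω then (1 : ℝ≥0∞) else 0) ∂P
          ≤ ∑ m ∈ Finset.range (2 ^ n), ENNReal.ofReal (C * (h / 2 ^ n)) := by
            refine Finset.sum_le_sum fun m _ => ?_
            rw [← hds n m]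
            refine le_trans (le_of_eq ?_) (hC _ _ (hdmono n m))
            rw [← lintegral_indicator_one (hne n m)]
            refine lintegral_congr fun ω => ?_
            simp [Set.indicator_apply]
        _ = ENNReal.ofReal (C * h) := by
            rw [Finset.sum_const, Finset.card_range, nsmul_eq_mul,
              ← ENNReal.ofReal_natCast, ← ENNReal.ofReal_mul (by positivity)]
            congr 1
            push_cast
            field_simp
    · refine Eventually.of_forall fun ω => tendsto_const_nhds.congr' ?_
      filter_upwards [(hX.process.isStepPath ω).eventually_card_dyadic hij.symm a h] with n hn
      rw [← hn, Finset.card_filter]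
      push_cast
      rfl
  have hF : ∀ n, ∫⁻ ω in R, F n ω ∂P = ENNReal.ofReal (∑ m ∈ Finset.range (2 ^ n),
      forwardVec g π T (d n m) i * Q (d n m) (d n (m + 1)) (Sum.inl i) j *
        Q (d n (m + 1)) r j (absorbing p)) := by
    intro n
    simp only [F]
    rw [lintegral_finsetSum _ fun m _ => hFm' n m, ENNReal.ofReal_sum_of_nonneg]
    · refine Finset.sum_congr rfl fun m hm' => ?_
      rw [← hX.law_inl (hdmono n m) (hdr n m (Finset.mem_range.1 hm')), ofReal_measureReal]
      have : ∀ ω, (if X (d n m) ω = Sum.inl i ∧ X (d n (m + 1)) ω = j then (1 : ℝ≥0∞) else 0) =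
          ({ω | X (d n m) ω = Sum.inl i} ∩ {ω | X (d n (m + 1)) ω = j}).indicator 1 ω := by
        intro ω
        simp [Set.indicator_apply]
      simp_rw [this]
      rw [lintegral_indicator_one ((hm _ _).inter (hm _ _)),
        Measure.restrict_apply ((hm _ _).inter (hm _ _)), Set.inter_assoc]
      rfl
    · intro m hm'
      rw [← hX.law_inl (hdmono n m) (hdr n m (Finset.mem_range.1 hm'))]
      exact measureReal_nonneg
  refine tendsto_nhds_unique hlim ?_
  simp_rw [hF]
  refine (ENNReal.continuous_ofReal.tendsto _).comp ?_
  obtain ⟨C, hC0, hC⟩ := hX.transition.exists_abs_sub_integral_jumpRate_le hT π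
  -- There are 2^n intervals, each with error C(h/2^n)²; the total is C·h times the mesh.
  have hmesh : Tendsto (fun n : ℕ => C * h * ((h / 2 ^ n : ℝ≥0) : ℝ)) atTop (𝓝 0) := by
    have := (NNReal.tendsto_coe.2 (tendsto_dyadic_mesh h)).const_mul (C * h)
    simpa using this
  refine tendsto_iff_dist_tendsto_zero.2 (squeeze_zero (fun _ => dist_nonneg) (fun n => ?_) hmesh)
  have hsum : ∫ u in (a : ℝ)..(a + h : ℝ≥0), jumpRate g π T Q i j r u =
      ∑ m ∈ Finset.range (2 ^ n), ∫ u in (d n m : ℝ)..(d n (m + 1)), jumpRate g π T Q i j r u := by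
    have := intervalIntegral.sum_integral_adjacent_intervals (μ := volume)
      (f := jumpRate g π T Q i j r) (a := fun m => ((d n m : ℝ≥0) : ℝ)) (n := 2 ^ n) fun m hm' =>
      hX.transition.intervalIntegrable_jumpRate hT i j (d n m).coe_nonneg
        (by exact_mod_cast hdmono n m) (by exact_mod_cast hdr n m hm')
    rw [this]
    simp only [d]
    rw [dyadicPt_zero, dyadicPt_top]
  rw [hsum, Real.dist_eq, ← Finset.sum_sub_distrib]
  refine (Finset.abs_sum_le_sum_abs _ _).trans ?_
  calc _ ≤ ∑ m ∈ Finset.range (2 ^ n), C * ((h : ℝ) / 2 ^ n) ^ 2 := by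
        refine Finset.sum_le_sum fun m hm' => ?_
        rw [← hds n m]
        exact hC i j hij _ _ _ (d n m).coe_nonneg (by exact_mod_cast hdmono n m)
          (by exact_mod_cast hdr n m (Finset.mem_range.1 hm'))
    _ = _ := by
        rw [Finset.sum_const, Finset.card_range, nsmul_eq_mul]
        push_cast
        field_simp

end Jumps

end IPH

namespace IPH

/-! ### Contributions of one observation -/

section Window

variable {K : ℕ} (g : Grid K)

theorem Grid.coe_leftMin (k : Fin K) (x : ℝ) : g.leftMin k x = min (g.left k) x := by
  rw [Grid.leftMin, ← g.coe_left, ← EReal.coe_strictMono.monotone.map_min, EReal.toReal_coe]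

theorem Grid.coe_rightMin (k : Fin K) (x : ℝ) :
    ((g.rightMin k x : ℝ) : EReal) = min (g.pts k.succ) x := by
  refine EReal.coe_toReal ?_ ?_
  · exact ne_of_lt ((min_le_right _ _).trans_lt (EReal.coe_lt_top x))
  · refine ne_of_gt (lt_min ?_ (EReal.bot_lt_coe x))
    exact (EReal.bot_lt_coe (g.left k)).trans (by
      rw [g.coe_left]; exact g.strictMono (Fin.castSucc_lt_succ))

/-- Turns a cell, possibly unbounded, into a bounded real interval once truncated at `x`. For a cell
lying to the right of `x` both sides are empty. -/
theorem Grid.cell_inter_Iic (k : Fin K) (x : ℝ) :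
    g.cell k ∩ Set.Iic x = Set.Ioc (g.leftMin k x) (g.rightMin k x) := by
  ext u
  rw [Set.mem_inter_iff, g.mem_cell, Set.mem_Iic, Set.mem_Ioc, g.coe_leftMin,
    ← EReal.coe_le_coe_iff (y := g.rightMin k x), g.coe_rightMin, le_min_iff, min_lt_iff,
    EReal.coe_le_coe_iff]
  constructor
  · rintro ⟨⟨h1, h2⟩, h3⟩
    exact ⟨Or.inl h1, h2, h3⟩
  · rintro ⟨h1, h2, h3⟩
    exact ⟨⟨h1.resolve_right (not_lt.2 h3), h2⟩, h3⟩

theorem Grid.leftMin_nonneg (k : Fin K) {x : ℝ} (hx : 0 ≤ x) : 0 ≤ g.leftMin k x := by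
  rw [g.coe_leftMin]
  exact le_min (g.left_nonneg k) hx

theorem Grid.leftMin_le_rightMin (k : Fin K) (x : ℝ) : g.leftMin k x ≤ g.rightMin k x := by
  rw [← EReal.coe_le_coe_iff, g.coe_rightMin, g.coe_leftMin,
    EReal.coe_strictMono.monotone.map_min, g.coe_left]
  exact min_le_min_right _ (g.strictMono (Fin.castSucc_lt_succ)).le

theorem Grid.rightMin_le (k : Fin K) (x : ℝ) : g.rightMin k x ≤ x := by
  rw [← EReal.coe_le_coe_iff, g.coe_rightMin]
  exact min_le_right _ _

end Window

section Numerators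

variable {K p : ℕ} (g : Grid K) (π : Fin p → ℝ) (T : Fin K → Matrix (Fin p) (Fin p) ℝ)

/-- Contribution of an observation `x` to the expected initiations, times the density. -/
noncomputable def numInitiations (i : Fin p) (x : ℝ) : ℝ := π i * backwardVec g T 0 x i

/-- Contribution of an observation `x` to the expected exposures, times the density. -/
noncomputable def numExposure (i : Fin p) (k : Fin K) (x : ℝ) : ℝ :=
  ∫ u in (g.leftMin k x)..(g.rightMin k x), forwardVec g π T u i * backwardVec g T u x i

/-- Contribution of an observation `x` to the expected occurrences, times the density. -/
noncomputable def numOccurrences (i : Fin p) (k : Fin K) (x : ℝ) : State p → ℝ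
  | Sum.inl j => ∫ u in (g.leftMin k x)..(g.rightMin k x),
      forwardVec g π T u i * T k i j * backwardVec g T u x j
  | Sum.inr _ => (g.cell k).indicator (fun _ => (1 : ℝ)) x *
      (forwardVec g π T x i * exitRate (T (g.index x)) i)

variable {g π T}

/-- This and the following homogeneity lemmas serve the reduction to one path: an event about the
other paths replaces `π` by `c • π`, and the factor must cancel in the quotient. -/
theorem forwardVec_smul (c : ℝ) (u : ℝ) (i : Fin p) :
    forwardVec g (c • π) T u i = c * forwardVec g π T u i := by
  rw [forwardVec, Matrix.smul_vecMul]; rfl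

theorem density_smul (c : ℝ) (x : ℝ) : density g (c • π) T x = c * density g π T x := by
  simp only [density, dotProduct, forwardVec_smul, Finset.mul_sum, mul_assoc]

theorem numInitiations_smul (c : ℝ) (i : Fin p) (x : ℝ) :
    numInitiations g (c • π) T i x = c * numInitiations g π T i x := by
  simp only [numInitiations, Pi.smul_apply, smul_eq_mul, mul_assoc]

theorem numExposure_smul (c : ℝ) (i : Fin p) (k : Fin K) (x : ℝ) :
    numExposure g (c • π) T i k x = c * numExposure g π T i k x := by
  simp only [numExposure, forwardVec_smul, mul_assoc, intervalIntegral.integral_const_mul]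

theorem numOccurrences_smul (c : ℝ) (i : Fin p) (k : Fin K) (x : ℝ) (b : State p) :
    numOccurrences g (c • π) T i k x b = c * numOccurrences g π T i k x b := by
  cases b with
  | inl j => simp only [numOccurrences, forwardVec_smul, mul_assoc,
      intervalIntegral.integral_const_mul]
  | inr y => simp only [numOccurrences, forwardVec_smul]; ring

theorem density_eq_sum (x : ℝ) : density g π T x = ∑ i, π i * backwardVec g T 0 x i := by
  rw [density, forwardVec, ← Matrix.dotProduct_mulVec]
  rfl

theorem density_nonneg (hT : ∀ k, IsSubIntensity (T k)) (hπ : ∀ i, 0 ≤ π i) {x : ℝ} (hx : 0 ≤ x) : 0 ≤ density g π T x := by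
  rw [density_eq_sum]
  exact Finset.sum_nonneg fun i _ => mul_nonneg (hπ i) (backwardVec_nonneg hT le_rfl hx i)

theorem numInitiations_nonneg (hT : ∀ k, IsSubIntensity (T k)) (hπ : ∀ i, 0 ≤ π i)
    (i : Fin p) {x : ℝ} (hx : 0 ≤ x) : 0 ≤ numInitiations g π T i x :=
  mul_nonneg (hπ i) (backwardVec_nonneg hT le_rfl hx i)

theorem numExposure_nonneg (hT : ∀ k, IsSubIntensity (T k)) (hπ : ∀ i, 0 ≤ π i)
    (i : Fin p) (k : Fin K) {x : ℝ} (hx : 0 ≤ x) :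
    0 ≤ numExposure g π T i k x := by
  refine intervalIntegral.integral_nonneg (g.leftMin_le_rightMin k x) fun u hu => ?_
  have h0 := (g.leftMin_nonneg k hx).trans hu.1
  exact mul_nonneg (forwardVec_nonneg hT hπ h0 i)
    (backwardVec_nonneg hT h0 (hu.2.trans (g.rightMin_le k x)) i)

theorem numOccurrences_nonneg (hT : ∀ k, IsSubIntensity (T k)) (hπ : ∀ i, 0 ≤ π i)
    {i : Fin p} (k : Fin K) {x : ℝ} (hx : 0 ≤ x) {b : State p}
    (hb : b ≠ Sum.inl i) : 0 ≤ numOccurrences g π T i k x b := by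
  cases b with
  | inl j =>
    refine intervalIntegral.integral_nonneg (g.leftMin_le_rightMin k x) fun u hu => ?_
    have h0 := (g.leftMin_nonneg k hx).trans hu.1
    exact mul_nonneg (mul_nonneg (forwardVec_nonneg hT hπ h0 i)
      ((hT k).1 i j fun h => hb (by rw [h])))
      (backwardVec_nonneg hT h0 (hu.2.trans (g.rightMin_le k x)) j)
  | inr y =>
    exact mul_nonneg (Set.indicator_nonneg (fun _ _ => zero_le_one) x)
      (mul_nonneg (forwardVec_nonneg hT hπ hx i) (exitRate_nonneg (hT _) i))

end Numerators

/-! ### Exchanging the time of an event and the time of absorption -/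

section Swap

variable {K p : ℕ} {g : Grid K} {π : Fin p → ℝ} {T : Fin K → Matrix (Fin p) (Fin p) ℝ}
  {Q : ℝ → ℝ → Matrix (State p) (State p) ℝ}

theorem ofReal_intervalIntegral_eq_lintegral {f : ℝ → ℝ} {a b : ℝ} (hab : a ≤ b)
    (hf : IntervalIntegrable f volume a b) (h0 : ∀ u ∈ Set.Ioc a b, 0 ≤ f u) :
    ENNReal.ofReal (∫ u in a..b, f u) = ∫⁻ u in Set.Ioc a b, ENNReal.ofReal (f u) := by
  rw [intervalIntegral.integral_of_le hab]
  refine ofReal_integral_eq_lintegral_ofReal ?_ ?_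
  · exact (intervalIntegrable_iff_integrableOn_Ioc_of_le hab).1 hf
  · exact (ae_restrict_iff' measurableSet_Ioc).2 (Eventually.of_forall h0)

/-- The probability of absorption between `u` and `r` is the integral of `backwardVec g T u x j`
over x in (u, r]. Tonelli on {u in the cell, u < x ≤ r} then leaves, for each x, the part of the
cell up to x. The weight `ρ` is the forward probability for exposures, times a constant rate for
occurrences. -/
theorem IsTransitionFunction.lintegral_mul_absorbing
    (hQ : IsTransitionFunction (g.intensityFun T) Q) (hT : ∀ k, IsSubIntensity (T k))
    {ρ : ℝ → ℝ} (hρm : Measurable ρ) (hρ0 : ∀ u, 0 ≤ u → 0 ≤ ρ u)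
    (hρc : ∀ b, ContinuousOn ρ (Set.Icc 0 b)) (k : Fin K) (j : Fin p) (r : ℝ) :
    ∫⁻ u in g.cell k ∩ Set.Iic r, ENNReal.ofReal (ρ u * Q u r (Sum.inl j) (absorbing p)) =
      ∫⁻ x in Set.Ioc 0 r, ENNReal.ofReal
        (∫ u in (g.leftMin k x)..(g.rightMin k x), ρ u * backwardVec g T u x j) := by
  have hcr : MeasurableSet (g.cell k ∩ Set.Iic r) := (g.measurableSet_cell k).inter measurableSet_Iic
  let F : ℝ → ℝ → ℝ≥0∞ := fun u x => ENNReal.ofReal (ρ u * backwardVec g T u x j)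
  have hF : Measurable (Function.uncurry F) := by
    have h1 : Measurable fun z : ℝ × ℝ => ρ z.1 * backwardVec g T z.1 z.2 j :=
      (hρm.comp measurable_fst).mul (measurable_backwardVec j)
    exact h1.ennreal_ofReal
  let A : Set (ℝ × ℝ) := {z | z.1 ∈ g.cell k ∧ z.1 < z.2 ∧ z.2 ≤ r}
  have hA : MeasurableSet A :=
    (measurable_fst (g.measurableSet_cell k)).inter
      ((measurableSet_lt measurable_fst measurable_snd).inter
        (measurableSet_le measurable_snd measurable_const))
  have hL : ∫⁻ u in g.cell k ∩ Set.Iic r, ENNReal.ofReal (ρ u * Q u r (Sum.inl j) (absorbing p)) =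
      ∫⁻ u, ∫⁻ x, A.indicator (Function.uncurry F) (u, x) := by
    rw [← lintegral_indicator hcr]
    refine lintegral_congr fun u => ?_
    by_cases hu : u ∈ g.cell k ∩ Set.Iic r
    · have hu0 := g.pos_of_mem_cell hu.1
      have hur : u ≤ r := hu.2
      rw [Set.indicator_of_mem hu]
      obtain ⟨hI, hE⟩ := hQ.apply_inl_inr hu0.le hur j ()
      rw [hE, ENNReal.ofReal_mul (hρ0 u hu0.le), ofReal_intervalIntegral_eq_lintegral hur hI
        (fun x hx => backwardVec_nonneg hT hu0.le hx.1.le j),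
        ← lintegral_const_mul' _ _ ENNReal.ofReal_ne_top, ← lintegral_indicator measurableSet_Ioc]
      refine lintegral_congr fun x => ?_
      by_cases hx : x ∈ Set.Ioc u r
      · rw [Set.indicator_of_mem hx, Set.indicator_of_mem (show (u, x) ∈ A from ⟨hu.1, hx.1, hx.2⟩),
          ← ENNReal.ofReal_mul (hρ0 u hu0.le)]
        rfl
      · rw [Set.indicator_of_notMem hx, Set.indicator_of_notMem fun h => hx ⟨h.2.1, h.2.2⟩]
    · rw [Set.indicator_of_notMem hu]
      symm
      rw [lintegral_eq_zero_iff']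
      · refine Eventually.of_forall fun x => ?_
        exact Set.indicator_of_notMem (fun h => hu ⟨h.1, (h.2.1.trans_le h.2.2).le⟩) _
      · have h2 := (hF.indicator hA).comp (measurable_prodMk_left (x := u))
        exact h2.aemeasurable
  rw [hL, lintegral_lintegral_swap (f := fun u x => A.indicator (Function.uncurry F) (u, x))
    (hF.indicator hA).aemeasurable,
    ← lintegral_indicator measurableSet_Ioc]
  refine lintegral_congr fun x => ?_
  by_cases hx : x ∈ Set.Ioc 0 r
  · rw [Set.indicator_of_mem hx]
    have hx0 := hx.1.le
    have hsub : Set.uIcc (g.leftMin k x) (g.rightMin k x) ⊆ Set.Icc 0 x := by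
      rw [Set.uIcc_of_le (g.leftMin_le_rightMin k x)]
      exact Set.Icc_subset_Icc (g.leftMin_nonneg k hx0) (g.rightMin_le k x)
    rw [ofReal_intervalIntegral_eq_lintegral (g.leftMin_le_rightMin k x), ← g.cell_inter_Iic,
      ← lintegral_indicator ((g.measurableSet_cell k).inter measurableSet_Iic)]
    · refine lintegral_congr_ae ?_
      -- The region has u < x while the window allows u = x; the diagonal is a null set.
      have hne : ∀ᵐ u : ℝ, u ≠ x := by
        rw [ae_iff]; simp
      filter_upwards [hne] with u hux
      by_cases hu : u ∈ g.cell k ∩ Set.Iic x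
      · rw [Set.indicator_of_mem hu, Set.indicator_of_mem
          (show (u, x) ∈ A from ⟨hu.1, lt_of_le_of_ne hu.2 hux, hx.2⟩)]
        rfl
      · rw [Set.indicator_of_notMem hu, Set.indicator_of_notMem fun h => hu ⟨h.1, h.2.1.le⟩]
    · exact (((hρc x).mul (hQ.continuousOn_backwardVec hT x j)).mono hsub).intervalIntegrable
    · intro u hu
      have hu0 : 0 ≤ u := (g.leftMin_nonneg k hx0).trans hu.1.le
      exact mul_nonneg (hρ0 u hu0)
        (backwardVec_nonneg hT hu0 (hu.2.trans (g.rightMin_le k x)) j)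
  · rw [Set.indicator_of_notMem hx]
    rw [lintegral_eq_zero_iff']
    · refine Eventually.of_forall fun u => ?_
      exact Set.indicator_of_notMem
        (fun h => hx ⟨(g.pos_of_mem_cell h.1).trans h.2.1, h.2.2⟩) _
    · have h2 := (hF.indicator hA).comp (measurable_prodMk_right (y := x))
      exact h2.aemeasurable

end Swap

end IPH

namespace IPH

/-! ### Statistics of one path -/

/-- Time spent in `i` during a cell. -/
noncomputable def pathExposure {p K : ℕ} (g : Grid K) (x : ℝ≥0 → State p) (i : Fin p)
    (k : Fin K) : ℝ :=
  ∫ u in g.cell k, if x u.toNNReal = Sum.inl i then (1 : ℝ) else 0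

/-- A path absorbed from `r` on has an absorbing left limit after `r`, so it makes no jump from a
transient state there. Counting over a possibly unbounded cell is thus counting over a bounded
interval, where the dyadic argument applies. -/
theorem jumpTimes_eq_jumpsIoc {p K : ℕ} {g : Grid K} {x : ℝ≥0 → State p} {r : ℝ≥0}
    (hr : ∀ t, r ≤ t → x t = absorbing p) (i : Fin p) (j : State p) (k : Fin K) {a b : ℝ≥0}
    (ha : (a : ℝ) = g.leftMin k r) (hb : (b : ℝ) = g.rightMin k r) :
    jumpTimes g x (Sum.inl i) j k = jumpsIoc x (Sum.inl i) j a b := by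
  ext u
  simp only [jumpTimes, jumpsIoc, Set.mem_ofPred_eq]
  have hw : u ∈ Set.Ioc a b ↔ (u : ℝ) ∈ g.cell k ∩ Set.Iic (r : ℝ) := by
    rw [g.cell_inter_Iic, ← ha, ← hb, Set.mem_Ioc, Set.mem_Ioc, NNReal.coe_lt_coe,
      NNReal.coe_le_coe]
  rw [hw, Set.mem_inter_iff, and_assoc]
  refine and_congr_right fun hcell => ?_
  refine ⟨fun h => ⟨?_, h⟩, fun h => h.2⟩
  by_contra hlt
  rw [Set.mem_Iic, not_le, NNReal.coe_lt_coe] at hlt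
  have := IsStepPath.neBot_nhdsLT (zero_le.trans_lt hlt)
  obtain ⟨v, hv1, hv2⟩ := (h.1.and (Ioo_mem_nhdsLT hlt)).exists
  rw [hr v hv2.1.le] at hv1
  exact absurd hv1 (by simp)

section OnePath

variable {Ω : Type*} [MeasurableSpace Ω] {P : Measure Ω} {p K : ℕ}
  {g : Grid K} {T : Fin K → Matrix (Fin p) (Fin p) ℝ} {π : Fin p → ℝ} {X : ℝ≥0 → Ω → State p}
  {Q : ℝ → ℝ → Matrix (State p) (State p) ℝ}

theorem HasLaw.measurableSet_eq (hX : HasLaw P g π T X Q) (t : ℝ≥0) (c : State p) :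
    MeasurableSet {ω | X t ω = c} := hX.process.measurable t (measurableSet_singleton c)

theorem HasLaw.forwardVec_eq (hX : HasLaw P g π T X Q) (u : ℝ≥0) (i : Fin p) :
    forwardVec g π T u i = P.real {ω | X u ω = Sum.inl i} := by
  rw [hX.law_one, hX.transition.sum_initialLaw_mul_inl u.coe_nonneg]

theorem measurableSet_prod_toNNReal (hX : HasLaw P g π T X Q) (c : State p) :
    MeasurableSet {z : ℝ × Ω | X z.1.toNNReal z.2 = c} := by
  have h1 := measurableSet_eq_of_isStepPath hX.process.measurable hX.process.isStepPath c
  have h2 : Measurable fun z : ℝ × Ω => (z.1.toNNReal, z.2) :=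
    (measurable_real_toNNReal.comp measurable_fst).prodMk measurable_snd
  exact h2 h1

theorem HasLaw.measurable_pathExposure (hX : HasLaw P g π T X Q) (i : Fin p) (k : Fin K) :
    Measurable fun ω => pathExposure g (fun t => X t ω) i k := by
  have h1 : Measurable fun z : Ω × ℝ =>
      if X z.2.toNNReal z.1 = Sum.inl i then (1 : ℝ) else 0 := by
    refine Measurable.ite ?_ measurable_const measurable_const
    have h2 := measurable_swap (measurableSet_prod_toNNReal hX (Sum.inl i))
    exact h2
  exact (h1.stronglyMeasurable.integral_prod_right (ν := volume.restrict (g.cell k))).measurable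

variable [IsFiniteMeasure P]

theorem HasLaw.measure_absorbed (hX : HasLaw P g π T X Q) (hT : ∀ k, IsSubIntensity (T k))
    (hπ : ∀ i, 0 ≤ π i) (r : ℝ≥0) :
    P {ω | X r ω = absorbing p} = ∫⁻ x in Set.Ioc 0 (r : ℝ), ENNReal.ofReal (density g π T x) := by
  have hI : ∀ i, IntervalIntegrable (fun x => π i * backwardVec g T 0 x i) volume 0 r := fun i =>
    (hX.transition.apply_inl_inr le_rfl r.coe_nonneg i ()).1.const_mul _
  rw [← ofReal_measureReal, hX.law_one, hX.transition.sum_initialLaw_mul_inr r.coe_nonneg,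
    ← ofReal_intervalIntegral_eq_lintegral r.coe_nonneg]
  · congr 1
    simp only [density_eq_sum]
    rw [intervalIntegral.integral_finsetSum fun i _ => hI i]
    simp only [intervalIntegral.integral_const_mul]
  · have := IntervalIntegrable.sum (μ := volume) (a := 0) (b := (r : ℝ)) Finset.univ
      (f := fun i x => π i * backwardVec g T 0 x i) fun i _ => hI i
    refine this.congr fun x _ => ?_
    simp [density_eq_sum]
  · exact fun x hx => density_nonneg hT hπ hx.1.le

theorem HasLaw.lintegral_initiations (hX : HasLaw P g π T X Q) (hT : ∀ k, IsSubIntensity (T k))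
    (hπ : ∀ i, 0 ≤ π i) (i : Fin p) (r : ℝ≥0) :
    ∫⁻ ω in {ω | X r ω = absorbing p}, ENNReal.ofReal (if X 0 ω = Sum.inl i then 1 else 0) ∂P =
      ∫⁻ x in Set.Ioc 0 (r : ℝ), ENNReal.ofReal (numInitiations g π T i x) := by
  have h1 : ∀ ω, ENNReal.ofReal (if X 0 ω = Sum.inl i then 1 else 0) =
      {ω | X 0 ω = Sum.inl i}.indicator 1 ω := by
    intro ω
    by_cases h : X 0 ω = Sum.inl i <;> simp [h]
  simp_rw [h1]
  rw [lintegral_indicator_one (hX.measurableSet_eq _ _),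
    Measure.restrict_apply (hX.measurableSet_eq _ _), ← ofReal_measureReal]
  have h2 : P.real ({ω | X 0 ω = Sum.inl i} ∩ {ω | X r ω = absorbing p}) =
      π i * Q 0 r (Sum.inl i) (absorbing p) := by
    have := hX.law_two (s := 0) (r := r) zero_le (Sum.inl i) (absorbing p)
    rw [hX.transition.sum_initialLaw_mul_inl NNReal.zero_le_coe] at this
    rw [forwardVec, NNReal.coe_zero, subTrans_self, Matrix.vecMul_one] at this
    exact this
  obtain ⟨hI, hE⟩ := hX.transition.apply_inl_inr le_rfl r.coe_nonneg i ()
  rw [h2, hE, ← intervalIntegral.integral_const_mul]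
  refine ofReal_intervalIntegral_eq_lintegral r.coe_nonneg (hI.const_mul _) fun x hx => ?_
  exact numInitiations_nonneg hT hπ i hx.1.le

theorem HasLaw.measure_inter_absorbed (hX : HasLaw P g π T X Q) (i : Fin p) {u : ℝ} (hu : 0 ≤ u)
    (r : ℝ≥0) :
    P ({ω | X u.toNNReal ω = Sum.inl i} ∩ {ω | X r ω = absorbing p}) =
      (Set.Iic (r : ℝ)).indicator
        (fun u => ENNReal.ofReal (forwardVec g π T u i * Q u r (Sum.inl i) (absorbing p))) u := by
  have hu' : ((u.toNNReal : ℝ≥0) : ℝ) = u := Real.coe_toNNReal u hu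
  by_cases h : u ≤ r
  · rw [Set.indicator_of_mem (Set.mem_Iic.2 h), ← ofReal_measureReal]
    congr 1
    have hle : u.toNNReal ≤ r := by rw [← NNReal.coe_le_coe, hu']; exact h
    have := hX.law_two hle (Sum.inl i) (absorbing p)
    rw [hu', hX.transition.sum_initialLaw_mul_inl hu] at this
    exact this
  · rw [Set.indicator_of_notMem (by simpa using h)]
    have hle : r ≤ u.toNNReal := by
      rw [← NNReal.coe_le_coe, hu']; exact (not_le.1 h).le
    have := hX.law_two hle (absorbing p) (Sum.inl i)
    rw [hX.transition.apply_inr_inl r.coe_nonneg (by exact_mod_cast hle), mul_zero] at this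
    rw [Set.inter_comm]
    exact (measureReal_eq_zero_iff).1 this

theorem HasLaw.lintegral_pathExposure (hX : HasLaw P g π T X Q) (i : Fin p) (k : Fin K)
    (r : ℝ≥0) :
    ∫⁻ ω in {ω | X r ω = absorbing p},
        ENNReal.ofReal (pathExposure g (fun t => X t ω) i k) ∂P =
      ∫⁻ u in g.cell k ∩ Set.Iic (r : ℝ),
        ENNReal.ofReal (forwardVec g π T u i * Q u r (Sum.inl i) (absorbing p)) := by
  have hms := measurableSet_prod_toNNReal hX (Sum.inl i)
  have hsec : ∀ ω, MeasurableSet {u : ℝ | X u.toNNReal ω = Sum.inl i} := fun ω => by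
    have h1 := measurable_prodMk_right (y := ω) hms
    exact h1
  have h1 : ∀ᵐ ω ∂P.restrict {ω | X r ω = absorbing p},
      ENNReal.ofReal (pathExposure g (fun t => X t ω) i k) =
        ∫⁻ u in g.cell k, {z : ℝ × Ω | X z.1.toNNReal z.2 = Sum.inl i}.indicator 1 (u, ω) := by
    rw [ae_restrict_iff' (hX.measurableSet_eq _ _)]
    filter_upwards [hX.process.ae_absorbed] with ω hω hr
    have h2 : pathExposure g (fun t => X t ω) i k =
        ∫ u in g.cell k, {u : ℝ | X u.toNNReal ω = Sum.inl i}.indicator 1 u := by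
      rw [pathExposure]
      refine integral_congr_ae (Eventually.of_forall fun u => ?_)
      simp [Set.indicator_apply]
    have h3 : ∀ u, {z : ℝ × Ω | X z.1.toNNReal z.2 = Sum.inl i}.indicator (1 : ℝ × Ω → ℝ≥0∞) (u, ω) =
        {u : ℝ | X u.toNNReal ω = Sum.inl i}.indicator 1 u := by
      intro u; simp [Set.indicator_apply]
    simp_rw [h3]
    -- On absorbed paths the time in a transient state is confined to (0, r]. The Bochner integral
    -- over an unbounded cell is then the true occupation time and not the default value of a
    -- nonintegrable function.
    have hfin : (volume.restrict (g.cell k)) {u : ℝ | X u.toNNReal ω = Sum.inl i} ≠ ∞ := by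
      rw [Measure.restrict_apply (hsec ω)]
      refine ne_top_of_le_ne_top (b := volume (Set.Ioc 0 (r : ℝ))) (by simp)
        (measure_mono fun u hu => ⟨g.pos_of_mem_cell hu.2, ?_⟩)
      by_contra hlt
      rw [not_le] at hlt
      have hu0 := (g.pos_of_mem_cell hu.2).le
      have := hω r u.toNNReal (by
        rw [← NNReal.coe_le_coe, Real.coe_toNNReal u hu0]; exact hlt.le) hr
      have hu1 : X u.toNNReal ω = Sum.inl i := hu.1
      rw [hu1] at this
      exact absurd this (by simp)
    rw [h2, integral_indicator_one (hsec ω), lintegral_indicator_one (hsec ω),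
      ofReal_measureReal hfin]
  rw [lintegral_congr_ae h1, lintegral_lintegral_swap (f := fun ω u =>
    {z : ℝ × Ω | X z.1.toNNReal z.2 = Sum.inl i}.indicator 1 (u, ω))]
  · rw [Set.inter_comm, ← Measure.restrict_restrict measurableSet_Iic,
      ← lintegral_indicator measurableSet_Iic]
    refine setLIntegral_congr_fun (g.measurableSet_cell k) fun u hu => ?_
    rw [← hX.measure_inter_absorbed i (g.pos_of_mem_cell hu).le r,
      ← Measure.restrict_apply (hX.measurableSet_eq _ _),
      ← lintegral_indicator_one (hX.measurableSet_eq _ _)]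
    refine lintegral_congr fun ω => ?_
    simp [Set.indicator_apply]
  · have h4 : Measurable ({z : ℝ × Ω | X z.1.toNNReal z.2 = Sum.inl i}.indicator
      (1 : ℝ × Ω → ℝ≥0∞)) := measurable_one.indicator hms
    have h5 := (h4.comp measurable_swap).aemeasurable
      (μ := (P.restrict {ω | X r ω = absorbing p}).prod (volume.restrict (g.cell k)))
    exact h5

theorem HasLaw.lintegral_jumpTimes (hX : HasLaw P g π T X Q) (hT : ∀ k, IsSubIntensity (T k))
    (hπ : ∀ i, 0 ≤ π i) {i : Fin p} {j : State p} (hij : j ≠ Sum.inl i) (k : Fin K) (r : ℝ≥0) :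
    ∫⁻ ω in {ω | X r ω = absorbing p},
        ENNReal.ofReal ((jumpTimes g (fun t => X t ω) (Sum.inl i) j k).ncard : ℝ) ∂P =
      ∫⁻ u in g.cell k ∩ Set.Iic (r : ℝ), ENNReal.ofReal (jumpRate g π T Q i j r u) := by
  let a : ℝ≥0 := ⟨g.leftMin k r, g.leftMin_nonneg k r.coe_nonneg⟩
  let h : ℝ≥0 := ⟨g.rightMin k r - g.leftMin k r, sub_nonneg.2 (g.leftMin_le_rightMin k r)⟩
  have hab : ((a + h : ℝ≥0) : ℝ) = g.rightMin k r := by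
    rw [NNReal.coe_add]
    change g.leftMin k r + (g.rightMin k r - g.leftMin k r) = _
    ring
  have hr : a + h ≤ r := by
    rw [← NNReal.coe_le_coe, hab]; exact g.rightMin_le k r
  have h1 : ∀ᵐ ω ∂P.restrict {ω | X r ω = absorbing p},
      ENNReal.ofReal ((jumpTimes g (fun t => X t ω) (Sum.inl i) j k).ncard : ℝ) =
        ((jumpsIoc (fun t => X t ω) (Sum.inl i) j a (a + h)).ncard : ℝ≥0∞) := by
    rw [ae_restrict_iff' (hX.measurableSet_eq _ _)]
    filter_upwards [hX.process.ae_absorbed] with ω hω hr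
    rw [jumpTimes_eq_jumpsIoc (fun t ht => hω r t ht hr) i j k (a := a) rfl hab, ENNReal.ofReal_natCast]
  rw [lintegral_congr_ae h1, hX.lintegral_ncard_jumpsIoc hT hij hr, hab,
    ofReal_intervalIntegral_eq_lintegral, g.cell_inter_Iic]
  · rfl
  · exact g.leftMin_le_rightMin k r
  · exact hX.transition.intervalIntegrable_jumpRate hT i j (g.leftMin_nonneg k r.coe_nonneg)
      (g.leftMin_le_rightMin k r) (g.rightMin_le k r)
  · intro u hu
    have hu0 := (g.leftMin_nonneg k r.coe_nonneg).trans hu.1.le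
    exact mul_nonneg (mul_nonneg (forwardVec_nonneg hT hπ hu0 i)
      (intensity_nonneg (hT _) hij))
      (hX.transition.nonneg hT hu0 (hu.2.trans (g.rightMin_le k r)) _ _)

theorem HasLaw.lintegral_pathExposure_eq_num (hX : HasLaw P g π T X Q)
    (hT : ∀ k, IsSubIntensity (T k)) (hπ : ∀ i, 0 ≤ π i) (i : Fin p) (k : Fin K) (r : ℝ≥0) :
    ∫⁻ ω in {ω | X r ω = absorbing p},
        ENNReal.ofReal (pathExposure g (fun t => X t ω) i k) ∂P =
      ∫⁻ x in Set.Ioc 0 (r : ℝ), ENNReal.ofReal (numExposure g π T i k x) := by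
  rw [hX.lintegral_pathExposure]
  exact hX.transition.lintegral_mul_absorbing hT (measurable_forwardVec i)
    (fun u hu => forwardVec_nonneg hT hπ hu i)
    (fun b => hX.transition.continuousOn_forwardVec hT b i) k i r

theorem HasLaw.lintegral_jumpTimes_eq_num (hX : HasLaw P g π T X Q)
    (hT : ∀ k, IsSubIntensity (T k)) (hπ : ∀ i, 0 ≤ π i) {i : Fin p} {j : State p}
    (hij : j ≠ Sum.inl i) (k : Fin K) (r : ℝ≥0) :
    ∫⁻ ω in {ω | X r ω = absorbing p},
        ENNReal.ofReal ((jumpTimes g (fun t => X t ω) (Sum.inl i) j k).ncard : ℝ) ∂P =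
      ∫⁻ x in Set.Ioc 0 (r : ℝ), ENNReal.ofReal (numOccurrences g π T i k x j) := by
  rw [hX.lintegral_jumpTimes hT hπ hij]
  have hcr : MeasurableSet (g.cell k ∩ Set.Iic (r : ℝ)) :=
    (g.measurableSet_cell k).inter measurableSet_Iic
  cases j with
  | inl j =>
    rw [setLIntegral_congr_fun hcr (g := fun u => ENNReal.ofReal
      (forwardVec g π T u i * T k i j * Q u r (Sum.inl j) (absorbing p)))]
    · exact hX.transition.lintegral_mul_absorbing hT ((measurable_forwardVec i).mul_const _)
        (fun u hu => mul_nonneg (forwardVec_nonneg hT hπ hu i)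
          ((hT k).1 i j fun h => hij (by rw [h])))
        (fun b => (hX.transition.continuousOn_forwardVec hT b i).mul continuousOn_const) k j r
    · intro u hu
      simp only [jumpRate, Grid.intensityFun, g.index_eq_of_mem_cell hu.1, intensity_inl_inl]
  -- A jump into absorption has no later waiting time: the absorption probability after it is 1, and
  -- the jump time is itself x. No Tonelli step is needed.
  | inr y =>
    have hsub : g.cell k ∩ Set.Iic (r : ℝ) = g.cell k ∩ Set.Ioc 0 (r : ℝ) := by
      ext u
      exact ⟨fun h => ⟨h.1, g.pos_of_mem_cell h.1, h.2⟩, fun h => ⟨h.1, h.2.2⟩⟩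
    rw [setLIntegral_congr_fun hcr (g := fun u => ENNReal.ofReal
      (forwardVec g π T u i * exitRate (T (g.index u)) i)), hsub,
      ← Measure.restrict_restrict (g.measurableSet_cell k),
      ← lintegral_indicator (g.measurableSet_cell k)]
    · refine lintegral_congr fun u => ?_
      by_cases hu : u ∈ g.cell k <;> simp [numOccurrences, hu]
    · intro u hu
      have h1 : Q u r (Sum.inr y) (absorbing p) = 1 :=
        hX.transition.apply_inr_inr (g.pos_of_mem_cell hu.1).le hu.2 _ _
      simp only [jumpRate, h1, mul_one]
      rfl

/-- The event of absorption before `r`. -/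
theorem HasLaw.ae_absorptionTime_le_iff (hX : HasLaw P g π T X Q) :
    ∀ᵐ ω ∂P, ∀ r : ℝ≥0, absorptionTime X ω ≤ r ↔ X r ω = absorbing p := by
  filter_upwards [hX.process.ae_absorbed] with ω hω r
  exact absorptionTime_le_iff (hX.process.isStepPath ω) hω r

theorem HasLaw.ae_eventually_absorbed (hX : HasLaw P g π T X Q)
    (habs : ∀ᵐ ω ∂P, absorptionTime X ω < ∞) :
    ∀ᵐ ω ∂P, ∀ᶠ n : ℕ in atTop, ∀ t : ℝ≥0, n ≤ t → X t ω = absorbing p := by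
  filter_upwards [hX.ae_absorptionTime_le_iff, habs] with ω h1 h2
  obtain ⟨n, hn⟩ := ENNReal.exists_nat_gt h2.ne
  filter_upwards [eventually_ge_atTop n] with m hm t ht
  refine (h1 t).1 (hn.le.trans ?_)
  have : ((n : ℝ≥0) : ℝ≥0∞) ≤ t := by
    rw [ENNReal.coe_le_coe]
    exact le_trans (by exact_mod_cast hm) ht
  simpa using this

/-- Truncated at `n`, the counts are measurable as limits of dyadic counts. Almost surely they agree
with the full count as soon as `n` exceeds the absorption time. -/
theorem HasLaw.aemeasurable_jumpTimes (hX : HasLaw P g π T X Q)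
    (habs : ∀ᵐ ω ∂P, absorptionTime X ω < ∞) {i : Fin p} {j : State p}
    (hij : j ≠ Sum.inl i) (k : Fin K) :
    AEMeasurable (fun ω => ((jumpTimes g (fun t => X t ω) (Sum.inl i) j k).ncard : ℝ)) P := by
  let a : ℕ → ℝ≥0 := fun n => ⟨g.leftMin k n, g.leftMin_nonneg k n.cast_nonneg⟩
  let h : ℕ → ℝ≥0 := fun n =>
    ⟨g.rightMin k n - g.leftMin k n, sub_nonneg.2 (g.leftMin_le_rightMin k n)⟩
  have hab : ∀ n, ((a n + h n : ℝ≥0) : ℝ) = g.rightMin k n := fun n => by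
    rw [NNReal.coe_add]
    change g.leftMin k n + (g.rightMin k n - g.leftMin k n) = _
    ring
  refine aemeasurable_of_tendsto_metrizable_ae atTop (f := fun n ω =>
    ((jumpsIoc (fun t => X t ω) (Sum.inl i) j (a n) (a n + h n)).ncard : ℝ)) (fun n => ?_) ?_
  · have := (measurable_ncard_jumpsIoc hX.process.measurable hX.process.isStepPath hij.symm
      (a n) (h n)).ennreal_toReal
    simp only [ENNReal.toReal_natCast] at this
    exact this.aemeasurable
  · filter_upwards [hX.ae_eventually_absorbed habs] with ω hω
    refine tendsto_const_nhds.congr' ?_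
    filter_upwards [hω] with n hn
    rw [jumpTimes_eq_jumpsIoc (r := (n : ℝ≥0)) hn i j k (a := a n) (b := a n + h n) rfl]
    exact hab n

/-- A nonnegative statistic with bounded expectation before every deterministic time. -/
theorem HasLaw.lintegral_le_of_forall (hX : HasLaw P g π T X Q)
    (habs : ∀ᵐ ω ∂P, absorptionTime X ω < ∞) {Z : Ω → ℝ≥0∞} (hZ : AEMeasurable Z P) {C : ℝ≥0∞}
    (h : ∀ n : ℕ, ∫⁻ ω in {ω | X n ω = absorbing p}, Z ω ∂P ≤ C) : ∫⁻ ω, Z ω ∂P ≤ C := by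
  -- Almost every path is absorbed at all large integer times, so `Z` is the limit of its
  -- truncations and Fatou's lemma applies.
  have h1 : ∀ᵐ ω ∂P, Z ω = liminf (fun n : ℕ => {ω | X n ω = absorbing p}.indicator Z ω) atTop := by
    filter_upwards [hX.ae_eventually_absorbed habs] with ω hω
    symm
    refine Tendsto.liminf_eq (tendsto_const_nhds.congr' ?_)
    filter_upwards [hω] with n hn
    exact (Set.indicator_of_mem (show ω ∈ {ω | X n ω = absorbing p} from hn n le_rfl) _).symm
  rw [lintegral_congr_ae h1]
  refine (lintegral_liminf_le' fun n => hZ.indicator (hX.measurableSet_eq _ _)).trans ?_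
  refine liminf_le_of_frequently_le' (Frequently.of_forall fun n => ?_)
  rw [lintegral_indicator (hX.measurableSet_eq _ _)]
  exact h n

end OnePath

end IPH

namespace IPH

/-! ### Integrability of the survival probabilities -/

section Decay

theorem Grid.pos {K : ℕ} (g : Grid K) : 0 < K := (g.index 0).pos

theorem Grid.index_of_last_lt {K : ℕ} (g : Grid K) {l : Fin K} (hl : l.val + 1 = K) {u : ℝ}
    (hu : g.left l < u) : g.index u = l := by
  refine g.index_eq_of_mem_cell (g.mem_cell.2 ⟨hu, ?_⟩)
  have : l.succ = Fin.last K := Fin.ext (by simpa using hl)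
  rw [this, g.pts_last]
  exact le_top

variable {K p : ℕ} {g : Grid K} {T : Fin K → Matrix (Fin p) (Fin p) ℝ} {π : Fin p → ℝ}
  {Q : ℝ → ℝ → Matrix (State p) (State p) ℝ}

theorem IsTransitionFunction.forwardVec_vecMul (hQ : IsTransitionFunction (g.intensityFun T) Q)
    {s t : ℝ} (hs : 0 ≤ s) (hst : s ≤ t) :
    forwardVec g π T t = forwardVec g π T s ᵥ* subTrans g T s t := by
  rw [forwardVec, forwardVec, Matrix.vecMul_vecMul, hQ.subTrans_mul le_rfl hs hst]

theorem IsTransitionFunction.sum_subTrans_le (hQ : IsTransitionFunction (g.intensityFun T) Q)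
    (hT : ∀ k, IsSubIntensity (T k)) {s t : ℝ} (hs : 0 ≤ s) (hst : s ≤ t) (i : Fin p) :
    ∑ j, subTrans g T s t i j ≤ 1 := by
  rw [← hQ.sum_row hs hst (Sum.inl i), Fintype.sum_sum_type]
  simp only [hQ.apply_inl_inl hs hst]
  exact le_add_of_nonneg_right (Finset.sum_nonneg fun _ _ => hQ.nonneg hT hs hst _ _)

theorem IsTransitionFunction.sum_forwardVec_eq (hQ : IsTransitionFunction (g.intensityFun T) Q)
    {s t : ℝ} (hs : 0 ≤ s) (hst : s ≤ t) :
    ∑ j, forwardVec g π T t j = ∑ l, forwardVec g π T s l * ∑ j, subTrans g T s t l j := by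
  rw [hQ.forwardVec_vecMul hs hst]
  simp only [Matrix.vecMul, dotProduct, Finset.mul_sum]
  rw [Finset.sum_comm]

theorem IsTransitionFunction.sum_forwardVec_anti (hQ : IsTransitionFunction (g.intensityFun T) Q)
    (hT : ∀ k, IsSubIntensity (T k)) (hπ : ∀ i, 0 ≤ π i) {s t : ℝ} (hs : 0 ≤ s) (hst : s ≤ t) :
    ∑ j, forwardVec g π T t j ≤ ∑ j, forwardVec g π T s j := by
  rw [hQ.sum_forwardVec_eq hs hst]
  exact Finset.sum_le_sum fun l _ => mul_le_of_le_one_right (forwardVec_nonneg hT hπ hs l)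
    (hQ.sum_subTrans_le hT hs hst l)

/-- In the last cell the survival probability is halved over intervals of a fixed length. -/
theorem IsTransitionFunction.exists_halving (hQ : IsTransitionFunction (g.intensityFun T) Q)
    (hT : ∀ k, IsSubIntensity (T k)) (hπ : ∀ i, 0 ≤ π i)
    (h0 : Tendsto (fun n : ℕ => ∑ i, forwardVec g π T n i) atTop (𝓝 0)) :
    ∃ a w : ℝ, 0 ≤ a ∧ 0 < w ∧ ∀ u, a ≤ u →
      ∑ i, forwardVec g π T (u + w) i ≤ 2⁻¹ * ∑ i, forwardVec g π T u i := by
  let l : Fin K := ⟨K - 1, Nat.sub_lt g.pos one_pos⟩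
  have hl : l.val + 1 = K := by
    have := g.pos
    simp only [l]; omega
  -- The last cell is open on the left; from a point strictly inside it the process is
  -- time-homogeneous for ever.
  set a := g.left l + 1
  have ha : 0 ≤ a := add_nonneg (g.left_nonneg l) zero_le_one
  have hsub : ∀ u w, a ≤ u → 0 ≤ w → subTrans g T u (u + w) = NormedSpace.exp (w • T l) := by
    intro u w hu hw
    have h1 : g.index u = l := g.index_of_last_lt hl (by linarith)
    have h2 : g.index (u + w) = l := g.index_of_last_lt hl (by linarith)
    rw [subTrans_of_index_eq g T (h1.trans h2.symm), h2, add_sub_cancel_left]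
  let ρ : ℝ → Fin p → ℝ := fun w i => ∑ j, NormedSpace.exp (w • T l) i j
  have hρ0 : ∀ w, 0 ≤ w → ∀ i, 0 ≤ ρ w i := fun w hw i => by
    simp only [ρ]
    rw [← hsub a w le_rfl hw]
    exact Finset.sum_nonneg fun j _ => subTrans_nonneg hT ha (by linarith) i j
  have hG : ∀ u w, a ≤ u → 0 ≤ w →
      ∑ i, forwardVec g π T (u + w) i = ∑ i, forwardVec g π T u i * ρ w i := by
    intro u w hu hw
    rw [hQ.sum_forwardVec_eq (ha.trans hu) (by linarith), hsub u w hu hw]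
  have hev : ∀ i, (∃ u, a ≤ u ∧ 0 < forwardVec g π T u i) →
      ∀ᶠ n : ℕ in atTop, ρ n i ≤ 2⁻¹ := by
    rintro i ⟨u, hu, hpos⟩
    -- Mass in state `i` at time `u` times the survival probability from `i` is at most the total
    -- survival probability, which tends to zero. Hence survival from `i` drops to 1/2; states never
    -- occupied after `a` carry no mass and need no such bound.
    have hpos' : 0 < 2⁻¹ * forwardVec g π T u i := by positivity
    filter_upwards [h0.eventually_lt_const hpos'] with n hn
    have h1 : forwardVec g π T u i * ρ n i ≤ ∑ j, forwardVec g π T n j := by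
      refine le_trans ?_ (hQ.sum_forwardVec_anti hT hπ n.cast_nonneg
        (t := u + n) (by linarith))
      rw [hG u n hu n.cast_nonneg]
      exact Finset.single_le_sum (f := fun j => forwardVec g π T u j * ρ n j)
        (fun j _ => mul_nonneg (forwardVec_nonneg hT hπ (ha.trans hu) j)
          (hρ0 n n.cast_nonneg j)) (Finset.mem_univ i)
    by_contra hlt
    rw [not_le] at hlt
    nlinarith
  have hall : ∀ᶠ n : ℕ in atTop, ∀ i, (∃ u, a ≤ u ∧ 0 < forwardVec g π T u i) → ρ n i ≤ 2⁻¹ := by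
    refine eventually_all.2 fun i => ?_
    by_cases h : ∃ u, a ≤ u ∧ 0 < forwardVec g π T u i
    · filter_upwards [hev i h] with n hn _ using hn
    · exact Eventually.of_forall fun n h' => absurd h' h
  obtain ⟨n, hn, hn0⟩ := (hall.and (eventually_gt_atTop 0)).exists
  refine ⟨a, n, ha, by exact_mod_cast hn0, fun u hu => ?_⟩
  rw [hG u n hu n.cast_nonneg, Finset.mul_sum]
  refine Finset.sum_le_sum fun i _ => ?_
  rcases (forwardVec_nonneg hT hπ (ha.trans hu) i).eq_or_lt with h | h
  · rw [← h]; simp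
  · rw [mul_comm]
    exact mul_le_mul_of_nonneg_right (hn i ⟨u, hu, h⟩) h.le

/-- Each state probability is bounded by the survival probability, which decreases and is halved
along a + n·w, so the integral is dominated by a geometric series. -/
theorem IsTransitionFunction.lintegral_forwardVec_lt_top
    (hQ : IsTransitionFunction (g.intensityFun T) Q)
    (hT : ∀ k, IsSubIntensity (T k)) (hπ : ∀ i, 0 ≤ π i)
    (h0 : Tendsto (fun n : ℕ => ∑ i, forwardVec g π T n i) atTop (𝓝 0)) (i : Fin p) :
    ∫⁻ u in Set.Ioi 0, ENNReal.ofReal (forwardVec g π T u i) < ∞ := by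
  obtain ⟨a, w, ha, hw, hhalf⟩ := hQ.exists_halving hT hπ h0
  let G : ℝ → ℝ := fun u => ∑ i, forwardVec g π T u i
  have hGanti : ∀ s t, 0 ≤ s → s ≤ t → G t ≤ G s := fun s t hs hst =>
    hQ.sum_forwardVec_anti hT hπ hs hst
  have hle : ∀ u, 0 ≤ u → forwardVec g π T u i ≤ G u := fun u hu =>
    Finset.single_le_sum (f := fun i => forwardVec g π T u i)
      (fun i _ => forwardVec_nonneg hT hπ hu i) (Finset.mem_univ i)
  have hG0 : ∀ u, 0 ≤ u → 0 ≤ G u := fun u hu =>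
    Finset.sum_nonneg fun i _ => forwardVec_nonneg hT hπ hu i
  have hpow : ∀ n : ℕ, G (a + n * w) ≤ (2⁻¹ : ℝ) ^ n * G a := by
    intro n
    induction n with
    | zero => simp
    | succ n ih =>
      have h1 := hhalf (a + n * w) (le_add_of_nonneg_right (by positivity))
      have h2 : a + ((n + 1 : ℕ) : ℝ) * w = a + n * w + w := by push_cast; ring
      rw [h2, pow_succ']
      refine h1.trans ?_
      rw [mul_assoc]
      exact mul_le_mul_of_nonneg_left ih (by norm_num)
  have hcover : Set.Ioi (0 : ℝ) ⊆ Set.Ioc 0 a ∪ ⋃ n : ℕ, Set.Ioc (a + n * w) (a + (n + 1) * w) := by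
    intro u hu
    rcases le_or_gt u a with hua | hua
    · exact Or.inl ⟨hu, hua⟩
    · right
      have hpos : 0 < (u - a) / w := div_pos (by linarith) hw
      have hc : 0 < ⌈(u - a) / w⌉₊ := Nat.ceil_pos.2 hpos
      obtain ⟨n, hn⟩ := Nat.exists_eq_succ_of_ne_zero hc.ne'
      rw [Set.mem_iUnion]
      refine ⟨n, ?_, ?_⟩
      · have : n < ⌈(u - a) / w⌉₊ := by omega
        rw [Nat.lt_ceil, lt_div_iff₀ hw] at this
        linarith
      · have h1 := Nat.le_ceil ((u - a) / w)
        rw [hn, div_le_iff₀ hw] at h1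
        push_cast at h1
        linarith
  refine (lintegral_mono_set hcover).trans_lt ((lintegral_union_le _ _ _).trans_lt ?_)
  refine ENNReal.add_lt_top.2 ⟨?_, ?_⟩
  · refine (setLIntegral_mono (g := fun _ => ENNReal.ofReal (G 0)) measurable_const
      fun u hu => ENNReal.ofReal_le_ofReal ?_).trans_lt ?_
    · exact (hle u hu.1.le).trans (hGanti 0 u le_rfl hu.1.le)
    · rw [setLIntegral_const, Real.volume_Ioc]
      exact ENNReal.mul_lt_top ENNReal.ofReal_lt_top ENNReal.ofReal_lt_top
  · refine (lintegral_iUnion_le _ _).trans_lt ?_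
    have hterm : ∀ n : ℕ, ∫⁻ u in Set.Ioc (a + n * w) (a + (n + 1) * w),
        ENNReal.ofReal (forwardVec g π T u i) ≤
          ENNReal.ofReal ((2⁻¹ : ℝ) ^ n * (G a * w)) := by
      intro n
      have hn0 : 0 ≤ a + n * w := by positivity
      refine (setLIntegral_mono (g := fun _ => ENNReal.ofReal ((2⁻¹ : ℝ) ^ n * G a))
        measurable_const fun u hu => ENNReal.ofReal_le_ofReal ?_).trans ?_
      · exact (hle u (hn0.trans hu.1.le)).trans ((hGanti _ u hn0 hu.1.le).trans (hpow n))
      · rw [setLIntegral_const, Real.volume_Ioc, ← ENNReal.ofReal_mul]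
        · refine ENNReal.ofReal_le_ofReal (le_of_eq ?_)
          ring
        · exact mul_nonneg (by positivity) (hG0 a ha)
    refine (ENNReal.tsum_le_tsum hterm).trans_lt ?_
    have hs : Summable fun n : ℕ => (2⁻¹ : ℝ) ^ n * (G a * w) :=
      (summable_geometric_of_lt_one (by norm_num) (by norm_num)).mul_right _
    rw [← ENNReal.ofReal_tsum_of_nonneg
      (fun n => mul_nonneg (by positivity) (mul_nonneg (hG0 a ha) hw.le)) hs]
    exact ENNReal.ofReal_lt_top

end Decay

/-! ### Integrability of exposures and occurrences -/

section Integrable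

variable {Ω : Type*} [MeasurableSpace Ω] {P : Measure Ω} [IsFiniteMeasure P] {p K : ℕ}
  {g : Grid K} {T : Fin K → Matrix (Fin p) (Fin p) ℝ} {π : Fin p → ℝ} {X : ℝ≥0 → Ω → State p}
  {Q : ℝ → ℝ → Matrix (State p) (State p) ℝ}

theorem HasLaw.tendsto_sum_forwardVec (hX : HasLaw P g π T X Q)
    (habs : ∀ᵐ ω ∂P, absorptionTime X ω < ∞) :
    Tendsto (fun n : ℕ => ∑ i, forwardVec g π T n i) atTop (𝓝 0) := by
  rw [← Finset.sum_const_zero (s := (Finset.univ : Finset (Fin p)))]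
  refine tendsto_finsetSum _ fun i _ => ?_
  have h1 : Tendsto (fun n : ℕ => ∫⁻ ω, {ω | X n ω = Sum.inl i}.indicator 1 ω ∂P) atTop
      (𝓝 (∫⁻ _, 0 ∂P)) := by
    refine tendsto_lintegral_of_dominated_convergence (fun _ => 1)
      (fun n => measurable_one.indicator (hX.measurableSet_eq _ _))
      (fun n => Eventually.of_forall fun ω => Set.indicator_le_self' (by simp) ω) (by simp) ?_
    filter_upwards [hX.ae_eventually_absorbed habs] with ω hω
    refine tendsto_const_nhds.congr' ?_
    filter_upwards [hω] with n hn
    symm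
    refine Set.indicator_of_notMem (fun h => ?_) _
    have h' : X n ω = Sum.inl i := h
    rw [hn n le_rfl] at h'
    exact absurd h' (by simp)
  rw [lintegral_zero] at h1
  have h2 := (ENNReal.tendsto_toReal ENNReal.zero_ne_top).comp h1
  refine h2.congr fun n => ?_
  rw [Function.comp_apply, lintegral_indicator_one (hX.measurableSet_eq _ _), ← measureReal_def,
    ← hX.forwardVec_eq, NNReal.coe_natCast]

theorem HasLaw.integrable_pathExposure (hX : HasLaw P g π T X Q)
    (hT : ∀ k, IsSubIntensity (T k)) (hπ : ∀ i, 0 ≤ π i)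
    (habs : ∀ᵐ ω ∂P, absorptionTime X ω < ∞) (i : Fin p) (k : Fin K) :
    Integrable (fun ω => pathExposure g (fun t => X t ω) i k) P := by
  have hm := hX.measurable_pathExposure i k
  refine ⟨hm.aestronglyMeasurable, ?_⟩
  have hnn : ∀ ω, 0 ≤ pathExposure g (fun t => X t ω) i k := fun ω =>
    integral_nonneg fun u => by dsimp only; split_ifs <;> norm_num
  rw [hasFiniteIntegral_iff_ofReal (Eventually.of_forall hnn)]
  refine (hX.lintegral_le_of_forall habs hm.ennreal_ofReal.aemeasurable fun n => ?_).trans_lt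
    (hX.transition.lintegral_forwardVec_lt_top hT hπ (hX.tendsto_sum_forwardVec habs) i)
  rw [hX.lintegral_pathExposure]
  refine (setLIntegral_mono (measurable_forwardVec i).ennreal_ofReal fun u hu =>
    ENNReal.ofReal_le_ofReal ?_).trans (lintegral_mono_set fun u hu => g.pos_of_mem_cell hu.1)
  have hu0 := (g.pos_of_mem_cell hu.1).le
  exact mul_le_of_le_one_right (forwardVec_nonneg hT hπ hu0 i)
    (hX.transition.le_one hT hu0 hu.2 _ _)

/-- Bounded intensities make the jump rate at most a constant times the probability of being in `i`,
so finite expected exposure gives finite expected occurrences. -/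
theorem HasLaw.integrable_jumpTimes (hX : HasLaw P g π T X Q)
    (hT : ∀ k, IsSubIntensity (T k)) (hπ : ∀ i, 0 ≤ π i)
    (habs : ∀ᵐ ω ∂P, absorptionTime X ω < ∞) {i : Fin p} {j : State p}
    (hij : j ≠ Sum.inl i) (k : Fin K) :
    Integrable (fun ω => ((jumpTimes g (fun t => X t ω) (Sum.inl i) j k).ncard : ℝ)) P := by
  have hm := hX.aemeasurable_jumpTimes habs hij k
  refine ⟨hm.aestronglyMeasurable, ?_⟩
  obtain ⟨C, hC0, hC⟩ := exists_intensityFun_bound g T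
  rw [hasFiniteIntegral_iff_ofReal (Eventually.of_forall fun ω => Nat.cast_nonneg _)]
  refine (hX.lintegral_le_of_forall habs hm.ennreal_ofReal (C := ENNReal.ofReal C *
    ∫⁻ u in Set.Ioi 0, ENNReal.ofReal (forwardVec g π T u i)) fun n => ?_).trans_lt
    (ENNReal.mul_lt_top ENNReal.ofReal_lt_top
      (hX.transition.lintegral_forwardVec_lt_top hT hπ (hX.tendsto_sum_forwardVec habs) i))
  rw [hX.lintegral_jumpTimes hT hπ hij, ← lintegral_const_mul' _ _ ENNReal.ofReal_ne_top]
  refine (setLIntegral_mono ((measurable_forwardVec i).ennreal_ofReal.const_mul _) fun u hu => ?_).trans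
    (lintegral_mono_set fun u hu => g.pos_of_mem_cell hu.1)
  rw [← ENNReal.ofReal_mul hC0]
  refine ENNReal.ofReal_le_ofReal ?_
  have hu0 := (g.pos_of_mem_cell hu.1).le
  have hf := forwardVec_nonneg (g := g) hT hπ hu0 i
  have hI := intensity_nonneg (hT (g.index u)) hij
  have hI2 : g.intensityFun T u (Sum.inl i) j ≤ C := (le_abs_self _).trans (hC u _ _)
  refine (mul_le_of_le_one_right (mul_nonneg hf hI) (hX.transition.le_one hT hu0 hu.2 _ _)).trans ?_
  rw [mul_comm]
  exact mul_le_mul_of_nonneg_right hI2 hf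

end Integrable

end IPH

namespace IPH

/-! ### Conditioning one path on its absorption time -/

section Measurable

variable {K p : ℕ} {g : Grid K} {T : Fin K → Matrix (Fin p) (Fin p) ℝ} {π : Fin p → ℝ}

theorem measurable_backwardVec_right (s : ℝ) (i : Fin p) :
    Measurable fun x => backwardVec g T s x i := by
  have h := (measurable_backwardVec (g := g) (T := T) i).comp (measurable_prodMk_left (x := s))
  exact h

theorem measurable_density : Measurable (density g π T) := by
  have h : Measurable fun x => ∑ i, π i * backwardVec g T 0 x i :=
    Finset.measurable_fun_sum _ fun i _ => (measurable_backwardVec_right 0 i).const_mul _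
  exact (funext fun x => density_eq_sum (g := g) (π := π) (T := T) x) ▸ h

theorem measurable_numInitiations (i : Fin p) : Measurable (numInitiations g π T i) :=
  (measurable_backwardVec_right 0 i).const_mul _

/-- Written over the fixed cell with the indicator of u ≤ x, the window no longer depends on x, and
measurability of parameter integrals applies. -/
theorem measurable_window_integral {F : ℝ × ℝ → ℝ} (hF : Measurable F) (k : Fin K) :
    Measurable fun x => ∫ u in (g.leftMin k x)..(g.rightMin k x), F (u, x) := by
  have h1 : ∀ x, ∫ u in (g.leftMin k x)..(g.rightMin k x), F (u, x) =
      ∫ u in g.cell k, {z : ℝ × ℝ | z.1 ≤ z.2}.indicator F (u, x) := by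
    intro x
    rw [intervalIntegral.integral_of_le (g.leftMin_le_rightMin k x), ← g.cell_inter_Iic,
      Set.inter_comm, ← Measure.restrict_restrict measurableSet_Iic,
      ← integral_indicator measurableSet_Iic]
    refine integral_congr_ae (Eventually.of_forall fun u => ?_)
    simp [Set.indicator_apply]
  simp_rw [h1]
  have h2 : Measurable ({z : ℝ × ℝ | z.1 ≤ z.2}.indicator F) :=
    hF.indicator (measurableSet_le measurable_fst measurable_snd)
  have h3 := (h2.comp measurable_swap).stronglyMeasurable.integral_prod_right'
    (ν := volume.restrict (g.cell k))
  exact h3.measurable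

theorem measurable_numExposure (i : Fin p) (k : Fin K) : Measurable (numExposure g π T i k) := by
  have h : Measurable fun z : ℝ × ℝ => forwardVec g π T z.1 i * backwardVec g T z.1 z.2 i :=
    ((measurable_forwardVec i).comp measurable_fst).mul (measurable_backwardVec i)
  exact measurable_window_integral h k

theorem measurable_numOccurrences (i : Fin p) (k : Fin K) (b : State p) :
    Measurable fun x => numOccurrences g π T i k x b := by
  cases b with
  | inl j =>
    have h : Measurable fun z : ℝ × ℝ =>
        forwardVec g π T z.1 i * T k i j * backwardVec g T z.1 z.2 j :=
      (((measurable_forwardVec i).comp measurable_fst).mul_const _).mul (measurable_backwardVec j)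
    exact measurable_window_integral h k
  | inr y =>
    exact (measurable_const.indicator (g.measurableSet_cell k)).mul
      ((measurable_forwardVec i).mul (measurable_exitRate_index i))

end Measurable

/-! ### The law of the absorption time and conditioning on it -/

section OneObservation

variable {Ω : Type*} [MeasurableSpace Ω] {P : Measure Ω} [IsFiniteMeasure P] {p K : ℕ}
  {g : Grid K} {T : Fin K → Matrix (Fin p) (Fin p) ℝ} {π : Fin p → ℝ} {X : ℝ≥0 → Ω → State p}
  {Q : ℝ → ℝ → Matrix (State p) (State p) ℝ}

theorem HasLaw.measurable_toReal_absorptionTime {P : Measure Ω} (hX : HasLaw P g π T X Q) :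
    Measurable fun ω => (absorptionTime X ω).toReal :=
  (measurable_absorptionTime hX.process.measurable hX.process.isStepPath).ennreal_toReal

theorem HasLaw.ae_toReal_absorptionTime_le_iff (hX : HasLaw P g π T X Q)
    (habs : ∀ᵐ ω ∂P, absorptionTime X ω < ∞) :
    ∀ᵐ ω ∂P, ∀ r : ℝ≥0, (absorptionTime X ω).toReal ≤ r ↔ X r ω = absorbing p := by
  filter_upwards [hX.ae_absorptionTime_le_iff, habs] with ω h1 h2 r
  rw [← h1 r, ← ENNReal.coe_toReal r, ENNReal.toReal_le_toReal h2.ne ENNReal.coe_ne_top]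

/-- The hypothesis is equality of the two distribution functions at r ≥ 0, since absorption by `r`
is almost surely {τ ≤ r}; below zero both measures vanish. Integrability of `Z` supplies the
finiteness under which half-lines determine a measure. -/
theorem HasLaw.map_withDensity_eq (hX : HasLaw P g π T X Q)
    (habs : ∀ᵐ ω ∂P, absorptionTime X ω < ∞) {Z : Ω → ℝ≥0∞}
    (hZi : ∫⁻ ω, Z ω ∂P ≠ ∞) {F : ℝ → ℝ≥0∞}
    (h : ∀ r : ℝ≥0, ∫⁻ ω in {ω | X r ω = absorbing p}, Z ω ∂P = ∫⁻ x in Set.Ioc 0 (r : ℝ), F x) :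
    (P.withDensity Z).map (fun ω => (absorptionTime X ω).toReal) =
      (volume.restrict (Set.Ioi 0)).withDensity F := by
  have hm := hX.measurable_toReal_absorptionTime
  have : IsFiniteMeasure (P.withDensity Z) := isFiniteMeasure_withDensity hZi
  refine Measure.ext_of_Iic _ _ fun a => ?_
  rw [Measure.map_apply hm measurableSet_Iic, withDensity_apply _ (hm measurableSet_Iic),
    withDensity_apply _ measurableSet_Iic, Measure.restrict_restrict measurableSet_Iic]
  rcases lt_or_ge a 0 with ha | ha
  · have h1 : (fun ω => (absorptionTime X ω).toReal) ⁻¹' Set.Iic a = ∅ := by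
      ext ω
      simp only [Set.mem_preimage, Set.mem_Iic, Set.mem_empty_iff_false, iff_false, not_le]
      exact ha.trans_le ENNReal.toReal_nonneg
    have h2 : Set.Iic a ∩ Set.Ioi (0 : ℝ) = ∅ := by
      ext x
      simp only [Set.mem_inter_iff, Set.mem_Iic, Set.mem_Ioi, Set.mem_empty_iff_false, iff_false]
      rintro ⟨h3, h4⟩
      linarith
    rw [h1, h2]
    simp
  · lift a to ℝ≥0 using ha
    have h1 : ((fun ω => (absorptionTime X ω).toReal) ⁻¹' Set.Iic (a : ℝ) : Set Ω) =ᵐ[P]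
        {ω | X a ω = absorbing p} := by
      filter_upwards [hX.ae_toReal_absorptionTime_le_iff habs] with ω hω
      exact propext (hω a)
    rw [Measure.restrict_congr_set h1, h a, Set.inter_comm, Set.Ioi_inter_Iic]

theorem HasLaw.map_absorptionTime (hX : HasLaw P g π T X Q) (hT : ∀ k, IsSubIntensity (T k))
    (hπ : ∀ i, 0 ≤ π i) (habs : ∀ᵐ ω ∂P, absorptionTime X ω < ∞) :
    P.map (fun ω => (absorptionTime X ω).toReal) =
      (volume.restrict (Set.Ioi 0)).withDensity fun x => ENNReal.ofReal (density g π T x) := by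
  have h := hX.map_withDensity_eq habs (Z := 1) (by simp)
    (F := fun x => ENNReal.ofReal (density g π T x)) fun r => by
      rw [← hX.measure_absorbed hT hπ r]
      simp
  rwa [withDensity_one] at h

theorem HasLaw.ae_density_pos (hX : HasLaw P g π T X Q) (hT : ∀ k, IsSubIntensity (T k))
    (hπ : ∀ i, 0 ≤ π i) (habs : ∀ᵐ ω ∂P, absorptionTime X ω < ∞) :
    ∀ᵐ ω ∂P, 0 < (absorptionTime X ω).toReal ∧
      0 < density g π T (absorptionTime X ω).toReal := by
  have hm := hX.measurable_toReal_absorptionTime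
  refine ae_of_ae_map (p := fun x => 0 < x ∧ 0 < density g π T x) hm.aemeasurable ?_
  rw [hX.map_absorptionTime hT hπ habs]
  rw [ae_withDensity_iff measurable_density.ennreal_ofReal, ae_restrict_iff' measurableSet_Ioi]
  refine Eventually.of_forall fun x hx hd => ⟨hx, ?_⟩
  by_contra hle
  exact hd (ENNReal.ofReal_eq_zero.2 (not_lt.1 hle))

/-- The τ-image of Z·P has density F and that of P has density f, so F/f is the required
Radon–Nikodym quotient. Passing to the almost sure set `D` where f > 0 removes the points at which
division by zero would return zero. -/
theorem HasLaw.setLIntegral_eq_div (hX : HasLaw P g π T X Q) (hT : ∀ k, IsSubIntensity (T k))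
    (hπ : ∀ i, 0 ≤ π i) (habs : ∀ᵐ ω ∂P, absorptionTime X ω < ∞) {Z : Ω → ℝ≥0∞}
    (hZi : ∫⁻ ω, Z ω ∂P ≠ ∞) {F : ℝ → ℝ} (hF : Measurable F)
    (h : ∀ r : ℝ≥0, ∫⁻ ω in {ω | X r ω = absorbing p}, Z ω ∂P =
      ∫⁻ x in Set.Ioc 0 (r : ℝ), ENNReal.ofReal (F x)) {A : Set ℝ} (hA : MeasurableSet A) :
    ∫⁻ ω in (fun ω => (absorptionTime X ω).toReal) ⁻¹' A, Z ω ∂P =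
      ∫⁻ ω in (fun ω => (absorptionTime X ω).toReal) ⁻¹' A,
        ENNReal.ofReal (F (absorptionTime X ω).toReal /
          density g π T (absorptionTime X ω).toReal) ∂P := by
  have hm := hX.measurable_toReal_absorptionTime
  set τ : Ω → ℝ := fun ω => (absorptionTime X ω).toReal with hτ
  have h1 := hX.map_withDensity_eq habs hZi h
  have h2 := hX.map_absorptionTime hT hπ habs
  rw [← hτ] at h1 h2
  let D : Set ℝ := {x | 0 < x ∧ 0 < density g π T x}
  have hD : MeasurableSet D :=
    measurableSet_Ioi.inter (measurableSet_lt measurable_const measurable_density)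
  have hDae : ∀ᵐ ω ∂P, τ ω ∈ D := hX.ae_density_pos hT hπ habs
  have hAD : (τ ⁻¹' A : Set Ω) =ᵐ[P] τ ⁻¹' (A ∩ D) := by
    filter_upwards [hDae] with ω hω
    exact propext ⟨fun ha => ⟨ha, hω⟩, fun ha => ha.1⟩
  have hADm := hA.inter hD
  rw [Measure.restrict_congr_set hAD]
  have e1 : ∫⁻ ω in τ ⁻¹' (A ∩ D), Z ω ∂P =
      ∫⁻ x in A ∩ D, ENNReal.ofReal (F x) ∂(volume.restrict (Set.Ioi 0)) := by
    rw [← withDensity_apply _ (hm hADm), ← Measure.map_apply hm hADm, h1,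
      withDensity_apply _ hADm]
  have hψ : Measurable fun x => ENNReal.ofReal (F x / density g π T x) :=
    (hF.div measurable_density).ennreal_ofReal
  have e2 : ∫⁻ ω in τ ⁻¹' (A ∩ D), ENNReal.ofReal (F (τ ω) / density g π T (τ ω)) ∂P =
      ∫⁻ x in A ∩ D, ENNReal.ofReal (F x) ∂(volume.restrict (Set.Ioi 0)) := by
    rw [← setLIntegral_map hADm hψ hm, h2,
      setLIntegral_withDensity_eq_setLIntegral_mul _ measurable_density.ennreal_ofReal hψ hADm]
    refine setLIntegral_congr_fun hADm fun x hx => ?_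
    have hd : 0 < density g π T x := hx.2.2
    rw [Pi.mul_apply, ← ENNReal.ofReal_mul hd.le, mul_div_cancel₀ _ hd.ne']
  rw [e1, e2]

end OneObservation

/-! ### Independent paths -/

section Independent

variable {Ω : Type*} [MeasurableSpace Ω] {P : Measure Ω} {N p K : ℕ}
  {g : Grid K} {T : Fin K → Matrix (Fin p) (Fin p) ℝ} {π : Fin p → ℝ}
  {X : Fin N → ℝ≥0 → Ω → State p}

/-- Restricting to an event that depends on the other paths only scales the distribution. -/
theorem isMarkovJumpProcess_restrict [IsProbabilityMeasure P]
    (hX : ∀ n, IsMarkovJumpProcess P (initialLaw π) (g.intensityFun T) (X n))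
    (hindep : iIndepFun (fun n ω t => X n t ω) P) (n : Fin N) (r : Fin N → ℝ≥0) :
    ∃ c : ℝ, 0 ≤ c ∧ IsMarkovJumpProcess
      (P.restrict (⋂ m ∈ Finset.univ.erase n, {ω | X m (r m) ω = absorbing p}))
      (initialLaw (c • π)) (g.intensityFun T) (X n) ∧
      (c = 0 → P.restrict (⋂ m ∈ Finset.univ.erase n, {ω | X m (r m) ω = absorbing p}) = 0) := by
  set B := ⋂ m ∈ Finset.univ.erase n, {ω | X m (r m) ω = absorbing p} with hB
  refine ⟨P.real B, measureReal_nonneg, ⟨(hX n).measurable, (hX n).right_continuous,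
    (hX n).left_limit, ?_⟩, ?_⟩
  · obtain ⟨Q, hQ, hlaw⟩ := (hX n).law
    refine ⟨Q, hQ, fun m t ht0 ht x => ?_⟩
    have hSm : MeasurableSet {ω | ∀ l, X n (t l) ω = x l} := by
      have : {ω | ∀ l, X n (t l) ω = x l} = ⋂ l, X n (t l) ⁻¹' {x l} := by
        ext ω; simp
      rw [this]
      exact MeasurableSet.iInter fun l => (hX n).measurable _ (measurableSet_singleton _)
    -- Coordinate `n` carries a finite-dimensional event, the others absorption. Independence, used
    -- once with and once without coordinate `n`, factors off P(B).
    let A : Fin N → Set (ℝ≥0 → State p) := fun m' =>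
      if m' = n then {f | ∀ l, f (t l) = x l} else {f | f (r m') = absorbing p}
    have hA : ∀ m', MeasurableSet (A m') := by
      intro m'
      simp only [A]
      split_ifs
      · have : {f : ℝ≥0 → State p | ∀ l, f (t l) = x l} = ⋂ l, (fun f => f (t l)) ⁻¹' {x l} := by
          ext f; simp
        rw [this]
        exact MeasurableSet.iInter fun l => measurable_pi_apply _ (measurableSet_singleton _)
      · have h1 := measurable_pi_apply (X := fun _ : ℝ≥0 => State p) (r m')
          (measurableSet_singleton (absorbing p))
        exact h1
    have h1 := hindep.measure_inter_preimage_eq_mul Finset.univ fun m' _ => hA m'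
    have h2 := hindep.measure_inter_preimage_eq_mul (Finset.univ.erase n) fun m' _ => hA m'
    have hAn : (fun ω t => X n t ω) ⁻¹' A n = {ω | ∀ l, X n (t l) ω = x l} := by
      simp only [A, if_pos]; rfl
    have hBA : (⋂ m' ∈ Finset.univ.erase n, (fun ω t => X m' t ω) ⁻¹' A m') = B := by
      rw [hB]
      refine Set.iInter₂_congr fun m' hm' => ?_
      simp only [A, if_neg (Finset.ne_of_mem_erase hm')]
      rfl
    have hU : (⋂ m' ∈ Finset.univ, (fun ω t => X m' t ω) ⁻¹' A m') =
        {ω | ∀ l, X n (t l) ω = x l} ∩ B := by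
      have h3 := Finset.set_biInter_insert n (Finset.univ.erase n)
        fun m' => (fun ω t => X m' t ω) ⁻¹' A m'
      rw [Finset.insert_erase (Finset.mem_univ n)] at h3
      rw [← hAn, ← hBA, h3]
    rw [hU, ← Finset.mul_prod_erase _ _ (Finset.mem_univ n), ← h2, hAn, hBA] at h1
    have h3 : (P.restrict B).real {ω | ∀ l, X n (t l) ω = x l} =
        P.real {ω | ∀ l, X n (t l) ω = x l} * P.real B := by
      rw [measureReal_def, Measure.restrict_apply hSm, h1, ENNReal.toReal_mul]
      rfl
    have h4 : initialLaw (P.real B • π) (x 0) = P.real B * initialLaw π (x 0) := by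
      cases x 0 <;> simp [initialLaw]
    rw [h3, hlaw m t ht0 ht x, h4]
    ring
  · intro hc
    rw [Measure.restrict_eq_zero]
    exact (measureReal_eq_zero_iff).1 hc

theorem measurable_obs (hX : ∀ n, IsMarkovJumpProcess P (initialLaw π) (g.intensityFun T) (X n)) :
    Measurable (obs X) :=
  measurable_pi_lambda _ fun n =>
    (measurable_absorptionTime (hX n).measurable (hX n).isStepPath).ennreal_toReal

theorem measurable_absorptionTimes
    (hX : ∀ n, IsMarkovJumpProcess P (initialLaw π) (g.intensityFun T) (X n)) :
    Measurable (absorptionTimes X) :=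
  measurable_pi_lambda _ fun n =>
    measurable_absorptionTime (hX n).measurable (hX n).isStepPath

/-- Two finite measures on a finite-dimensional space agree if they agree on all orthants. -/
theorem measure_pi_ext_of_Iic {μ ν : Measure (Fin N → ℝ)} [IsFiniteMeasure μ]
    (h : ∀ a : Fin N → ℝ, μ (Set.univ.pi fun n => Set.Iic (a n)) =
      ν (Set.univ.pi fun n => Set.Iic (a n))) : μ = ν := by
  have hspan : IsCountablySpanning (Set.range (Set.Iic : ℝ → Set ℝ)) :=
    ⟨fun n : ℕ => Set.Iic (n : ℝ), fun n => ⟨n, rfl⟩, by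
      rw [Set.iUnion_eq_univ_iff]
      intro x
      obtain ⟨n, hn⟩ := exists_nat_ge x
      exact ⟨n, hn⟩⟩
  have hgen := generateFrom_eq_pi (ι := Fin N) (α := fun _ => ℝ)
    (C := fun _ => Set.range (Set.Iic : ℝ → Set ℝ))
    (fun _ => (borel_eq_generateFrom_Iic ℝ).symm.trans (BorelSpace.measurable_eq (α := ℝ)).symm)
    fun _ => hspan
  refine Measure.ext_of_generateFrom_of_iUnion _
    (fun q : ℕ => Set.univ.pi fun _ : Fin N => Set.Iic (q : ℝ)) hgen.symm
    (IsPiSystem.pi fun _ => isPiSystem_Iic) ?_ ?_ (fun _ => measure_ne_top _ _) ?_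
  · rw [Set.iUnion_eq_univ_iff]
    intro x
    obtain ⟨q, hq⟩ := exists_nat_ge (∑ n, |x n|)
    refine ⟨q, fun n _ => (le_abs_self _).trans (le_trans ?_ hq)⟩
    exact Finset.single_le_sum (f := fun n => |x n|) (fun _ _ => abs_nonneg _) (Finset.mem_univ n)
  · intro q
    exact ⟨fun _ => Set.Iic (q : ℝ), fun n _ => ⟨q, rfl⟩, rfl⟩
  · rintro s ⟨f, hf, rfl⟩
    choose a ha using fun n => hf n (Set.mem_univ n)
    have : f = fun n => Set.Iic (a n) := funext fun n => (ha n).symm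
    rw [this]
    exact h a

/-- The conditional expectation of a statistic of the `n`-th path. -/
theorem condExp_path_statistic [IsProbabilityMeasure P] (hT : ∀ k, IsSubIntensity (T k)) (hπ : ∀ i, 0 ≤ π i)
    (hX : ∀ n, IsMarkovJumpProcess P (initialLaw π) (g.intensityFun T) (X n))
    (hindep : iIndepFun (fun n ω t => X n t ω) P)
    (habs : ∀ n, ∀ᵐ ω ∂P, absorptionTime (X n) ω < ∞) (n : Fin N) {Z : Ω → ℝ}
    (hZ : Integrable Z P) (hZ0 : ∀ ω, 0 ≤ Z ω) {F : (Fin p → ℝ) → ℝ → ℝ}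
    (hFm : Measurable (F π)) (hF0 : ∀ x, 0 ≤ x → 0 ≤ F π x)
    (hFs : ∀ (c : ℝ) x, F (c • π) x = c * F π x)
    (h : ∀ (P' : Measure Ω) [IsFiniteMeasure P'] (π' : Fin p → ℝ)
      (Q : ℝ → ℝ → Matrix (State p) (State p) ℝ), (∀ i, 0 ≤ π' i) → HasLaw P' g π' T (X n) Q →
      ∀ r : ℝ≥0, ∫⁻ ω in {ω | X n r ω = absorbing p}, ENNReal.ofReal (Z ω) ∂P' =
        ∫⁻ x in Set.Ioc 0 (r : ℝ), ENNReal.ofReal (F π' x)) :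
    P[Z | obsSigma X] =ᵐ[P] fun ω => F π (obs X ω n) / density g π T (obs X ω n) := by
  have hobs := measurable_obs hX
  have hle : obsSigma X ≤ (inferInstance : MeasurableSpace Ω) :=
    (measurable_absorptionTimes hX).comap_le
  let ψ : ℝ → ℝ := fun x => F π x / density g π T x
  have hψm : Measurable ψ := hFm.div measurable_density
  have hobs0 : ∀ ω m, 0 ≤ obs X ω m := fun ω m => ENNReal.toReal_nonneg
  have hψ0 : ∀ ω, 0 ≤ ψ (obs X ω n) := fun ω =>
    div_nonneg (hF0 _ (hobs0 ω n)) (density_nonneg hT hπ (hobs0 ω n))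
  have hobsn : Measurable fun ω => ψ (obs X ω n) :=
    hψm.comp ((measurable_pi_apply n).comp hobs)
  have hZfin : ∫⁻ ω, ENNReal.ofReal (Z ω) ∂P ≠ ∞ :=
    ((hasFiniteIntegral_iff_ofReal (Eventually.of_forall hZ0)).1 hZ.2).ne
  -- agreement on boxes
  have hbox : ∀ a : Fin N → ℝ,
      ∫⁻ ω in obs X ⁻¹' (Set.univ.pi fun m => Set.Iic (a m)), ENNReal.ofReal (Z ω) ∂P =
      ∫⁻ ω in obs X ⁻¹' (Set.univ.pi fun m => Set.Iic (a m)),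
        ENNReal.ofReal (ψ (obs X ω n)) ∂P := by
    intro a
    by_cases ha : ∀ m, 0 ≤ a m
    · let r : Fin N → ℝ≥0 := fun m => ⟨a m, ha m⟩
      -- The box says that τ of path `n` is at most `a n` and that the others are absorbed by `r`.
      -- Under P restricted to the latter event, of mass `c`, the one-path result applies with `c •
      -- π`; this is why the hypothesis `h` is required for all finite measures and all nonnegative
      -- vectors. If c = 0 both sides vanish.
      obtain ⟨c, hc0, hproc, hc⟩ := isMarkovJumpProcess_restrict hX hindep n r
      set B := ⋂ m ∈ Finset.univ.erase n, {ω | X m (r m) ω = absorbing p} with hB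
      obtain ⟨Q, hlaw⟩ := hproc.exists_hasLaw
      have hcπ : ∀ i, 0 ≤ (c • π) i := fun i => mul_nonneg hc0 (hπ i)
      have habs' : ∀ᵐ ω ∂P.restrict B, absorptionTime (X n) ω < ∞ :=
        ae_restrict_of_ae (habs n)
      have hset : (obs X ⁻¹' (Set.univ.pi fun m => Set.Iic (a m)) : Set Ω) =ᵐ[P]
          ((fun ω => (absorptionTime (X n) ω).toReal) ⁻¹' Set.Iic (a n) ∩ B : Set Ω) := by
        have hall : ∀ᵐ ω ∂P, ∀ m, ∀ r : ℝ≥0, (absorptionTime (X m) ω).toReal ≤ r ↔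
            X m r ω = absorbing p := by
          refine ae_all_iff.2 fun m => ?_
          obtain ⟨Q', hQ'⟩ := (hX m).exists_hasLaw
          exact hQ'.ae_toReal_absorptionTime_le_iff (habs m)
        filter_upwards [hall] with ω hω
        refine propext ?_
        change (∀ m, m ∈ Set.univ → (absorptionTime (X m) ω).toReal ≤ a m) ↔
          (absorptionTime (X n) ω).toReal ≤ a n ∧ ω ∈ B
        have hBm : ω ∈ B ↔ ∀ m ∈ Finset.univ.erase n, X m (r m) ω = absorbing p := by
          rw [hB, Set.mem_iInter₂]; rfl
        rw [hBm]
        constructor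
        · intro h1
          exact ⟨h1 n (Set.mem_univ n), fun m _ => (hω m (r m)).1 (h1 m (Set.mem_univ m))⟩
        · rintro ⟨h1, h2⟩ m -
          by_cases hmn : m = n
          · rw [hmn]; exact h1
          · exact (hω m (r m)).2 (h2 m (Finset.mem_erase.2 ⟨hmn, Finset.mem_univ m⟩))
      have hmA : MeasurableSet ((fun ω => (absorptionTime (X n) ω).toReal) ⁻¹' Set.Iic (a n)) :=
        hlaw.measurable_toReal_absorptionTime measurableSet_Iic
      have hZB : ∫⁻ ω, ENNReal.ofReal (Z ω) ∂P.restrict B ≠ ∞ :=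
        ne_top_of_le_ne_top hZfin (setLIntegral_le_lintegral _ _)
      rw [Measure.restrict_congr_set hset, ← Measure.restrict_restrict hmA]
      rcases hc0.eq_or_lt with hc' | hc'
      · rw [hc hc'.symm]
        simp
      · have hFc : F (c • π) = fun x => c * F π x := funext fun x => hFs c x
        have := hlaw.setLIntegral_eq_div hT hcπ habs' hZB (F := F (c • π))
          (by rw [hFc]; exact hFm.const_mul c) (h (P.restrict B) (c • π) Q hcπ hlaw)
          (measurableSet_Iic (a := a n))
        rw [this]
        refine lintegral_congr fun ω => ?_
        rw [hFs, density_smul, mul_div_mul_left _ _ hc'.ne']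
        rfl
    · push Not at ha
      obtain ⟨m, hm⟩ := ha
      have : obs X ⁻¹' (Set.univ.pi fun m => Set.Iic (a m)) = ∅ := by
        ext ω
        simp only [Set.mem_preimage, Set.mem_empty_iff_false, iff_false]
        intro hω
        exact absurd (hω m (Set.mem_univ m)) (not_le.2 (hm.trans_le (hobs0 ω m)))
      rw [this]
      simp
  have : IsFiniteMeasure (P.withDensity fun ω => ENNReal.ofReal (Z ω)) :=
    isFiniteMeasure_withDensity hZfin
  have hmeas : (P.withDensity fun ω => ENNReal.ofReal (Z ω)).map (obs X) =
      (P.withDensity fun ω => ENNReal.ofReal (ψ (obs X ω n))).map (obs X) := by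
    refine measure_pi_ext_of_Iic fun a => ?_
    have hs : MeasurableSet (Set.univ.pi fun m => Set.Iic (a m)) :=
      MeasurableSet.univ_pi fun m => measurableSet_Iic
    rw [Measure.map_apply hobs hs, Measure.map_apply hobs hs, withDensity_apply _ (hobs hs),
      withDensity_apply _ (hobs hs)]
    exact hbox a
  -- agreement on all events that depend on the observations
  have hset : ∀ s, MeasurableSet[obsSigma X] s →
      ∫⁻ ω in s, ENNReal.ofReal (Z ω) ∂P = ∫⁻ ω in s, ENNReal.ofReal (ψ (obs X ω n)) ∂P := by
    rintro s ⟨A, hA, rfl⟩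
    -- The σ-algebra is generated by extended-valued times. Almost surely these are finite, so its
    -- events agree up to null sets with events about the real vector.
    let A' : Set (Fin N → ℝ) := {x | (fun m => ENNReal.ofReal (x m)) ∈ A}
    have hA' : MeasurableSet A' := by
      have h1 : Measurable fun x : Fin N → ℝ => fun m => ENNReal.ofReal (x m) :=
        measurable_pi_lambda _ fun m => (measurable_pi_apply m).ennreal_ofReal
      exact h1 hA
    have he : (absorptionTimes X ⁻¹' A : Set Ω) =ᵐ[P] obs X ⁻¹' A' := by
      filter_upwards [ae_all_iff.2 habs] with ω hω
      refine propext ?_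
      have : (fun m => ENNReal.ofReal (obs X ω m)) = absorptionTimes X ω :=
        funext fun m => ENNReal.ofReal_toReal (hω m).ne
      change absorptionTimes X ω ∈ A ↔ (fun m => ENNReal.ofReal (obs X ω m)) ∈ A
      rw [this]
    rw [Measure.restrict_congr_set he, ← withDensity_apply _ (hobs hA'),
      ← withDensity_apply _ (hobs hA'), ← Measure.map_apply hobs hA', hmeas,
      Measure.map_apply hobs hA']
  have hψi : Integrable (fun ω => ψ (obs X ω n)) P := by
    refine ⟨hobsn.aestronglyMeasurable, ?_⟩
    rw [hasFiniteIntegral_iff_ofReal (Eventually.of_forall hψ0)]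
    have := hset Set.univ MeasurableSet.univ
    rw [Measure.restrict_univ] at this
    rw [← this]
    exact hZfin.lt_top
  symm
  refine ae_eq_condExp_of_forall_setIntegral_eq hle hZ (fun s _ _ => hψi.integrableOn) ?_ ?_
  · intro s hs _
    rw [integral_eq_lintegral_of_nonneg_ae (Eventually.of_forall hψ0)
      hobsn.aestronglyMeasurable, integral_eq_lintegral_of_nonneg_ae (Eventually.of_forall hZ0)
      hZ.1.restrict, hset s hs]
  · have h1 : Measurable[obsSigma X] fun ω => ψ (obs X ω n) := by
      have h2 : Measurable fun y : Fin N → ℝ≥0∞ => ψ (y n).toReal :=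
        hψm.comp (measurable_pi_apply n).ennreal_toReal
      exact h2.comp (comap_measurable (absorptionTimes X))
    exact h1.stronglyMeasurable.aestronglyMeasurable

end Independent

end IPH

namespace IPH

/-! ### Conditional expectations of the sufficient statistics -/

section Statistics

variable {Ω : Type*} [MeasurableSpace Ω] {P : Measure Ω} [IsProbabilityMeasure P] {N p K : ℕ}
  {g : Grid K} {T : Fin K → Matrix (Fin p) (Fin p) ℝ} {π : Fin p → ℝ}
  {X : Fin N → ℝ≥0 → Ω → State p}

theorem condExp_sum_ae_eq {Ω : Type*} {m m0 : MeasurableSpace Ω} {P : Measure Ω} {N : ℕ}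
    {Z ψ : Fin N → Ω → ℝ} (hZ : ∀ n, Integrable (Z n) P)
    (h : ∀ n, P[Z n | m] =ᵐ[P] ψ n) :
    P[fun ω => ∑ n, Z n ω | m] =ᵐ[P] fun ω => ∑ n, ψ n ω := by
  have h1 : (fun ω => ∑ n, Z n ω) = ∑ n, Z n := by ext ω; simp
  rw [h1]
  refine (condExp_finsetSum (fun n _ => hZ n) m).trans ?_
  filter_upwards [ae_all_iff.2 h] with ω hω
  rw [Finset.sum_apply]
  exact Finset.sum_congr rfl fun n _ => hω n

theorem ae_obs_pos (hT : ∀ k, IsSubIntensity (T k)) (hπ : ∀ i, 0 ≤ π i)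
    (hX : ∀ n, IsMarkovJumpProcess P (initialLaw π) (g.intensityFun T) (X n))
    (habs : ∀ n, ∀ᵐ ω ∂P, absorptionTime (X n) ω < ∞) :
    ∀ᵐ ω ∂P, ∀ n, 0 < obs X ω n ∧ 0 < density g π T (obs X ω n) := by
  refine ae_all_iff.2 fun n => ?_
  obtain ⟨Q, hQ⟩ := (hX n).exists_hasLaw
  exact hQ.ae_density_pos hT hπ (habs n)

theorem condExp_initiations (hT : ∀ k, IsSubIntensity (T k)) (hπ : ∀ i, 0 ≤ π i)
    (hX : ∀ n, IsMarkovJumpProcess P (initialLaw π) (g.intensityFun T) (X n))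
    (hindep : iIndepFun (fun n ω t => X n t ω) P)
    (habs : ∀ n, ∀ᵐ ω ∂P, absorptionTime (X n) ω < ∞) (i : Fin p) :
    Integrable (initiations X i) P ∧
      P[initiations X i | obsSigma X] =ᵐ[P] fun ω => expInitiations g π T (obs X ω) i := by
  have hZ : ∀ n, Integrable (fun ω => if X n 0 ω = Sum.inl i then (1 : ℝ) else 0) P := by
    intro n
    refine (integrable_const (1 : ℝ)).mono' ?_ (Eventually.of_forall fun ω => ?_)
    · exact (Measurable.ite ((hX n).measurable 0 (measurableSet_singleton _)) measurable_const
        measurable_const).aestronglyMeasurable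
    · split_ifs <;> simp
  refine ⟨integrable_finsetSum _ fun n _ => hZ n, condExp_sum_ae_eq hZ fun n => ?_⟩
  exact condExp_path_statistic hT hπ hX hindep habs n (hZ n)
    (fun ω => by split_ifs <;> norm_num) (F := fun π x => numInitiations g π T i x)
    (measurable_numInitiations i) (fun x hx => numInitiations_nonneg hT hπ i hx)
    (fun c x => numInitiations_smul c i x)
    fun P' _ π' Q hπ' hQ r => hQ.lintegral_initiations hT hπ' i r

theorem condExp_exposure (hT : ∀ k, IsSubIntensity (T k)) (hπ : ∀ i, 0 ≤ π i)
    (hX : ∀ n, IsMarkovJumpProcess P (initialLaw π) (g.intensityFun T) (X n))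
    (hindep : iIndepFun (fun n ω t => X n t ω) P)
    (habs : ∀ n, ∀ᵐ ω ∂P, absorptionTime (X n) ω < ∞) (i : Fin p) (k : Fin K) :
    Integrable (exposure g X i k) P ∧
      P[exposure g X i k | obsSigma X] =ᵐ[P] fun ω => expExposure g π T (obs X ω) i k := by
  have hZ : ∀ n, Integrable (fun ω => pathExposure g (fun t => X n t ω) i k) P := by
    intro n
    obtain ⟨Q, hQ⟩ := (hX n).exists_hasLaw
    exact hQ.integrable_pathExposure hT hπ (habs n) i k
  refine ⟨integrable_finsetSum _ fun n _ => hZ n, condExp_sum_ae_eq hZ fun n => ?_⟩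
  exact condExp_path_statistic hT hπ hX hindep habs n (hZ n)
    (fun ω => integral_nonneg fun u => by dsimp only; split_ifs <;> norm_num)
    (F := fun π x => numExposure g π T i k x)
    (measurable_numExposure i k) (fun x hx => numExposure_nonneg hT hπ i k hx)
    (fun c x => numExposure_smul c i k x)
    fun P' _ π' Q hπ' hQ r => hQ.lintegral_pathExposure_eq_num hT hπ' i k r

theorem expOccurrences_eq_sum (x : Fin N → ℝ) (i : Fin p) (j : State p) (k : Fin K) :
    expOccurrences g π T x i j k =
      ∑ n, numOccurrences g π T i k (x n) j / density g π T (x n) := by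
  cases j <;> rfl

theorem condExp_occurrences (hT : ∀ k, IsSubIntensity (T k)) (hπ : ∀ i, 0 ≤ π i)
    (hX : ∀ n, IsMarkovJumpProcess P (initialLaw π) (g.intensityFun T) (X n))
    (hindep : iIndepFun (fun n ω t => X n t ω) P)
    (habs : ∀ n, ∀ᵐ ω ∂P, absorptionTime (X n) ω < ∞) {i : Fin p} {j : State p}
    (hij : j ≠ Sum.inl i) (k : Fin K) :
    Integrable (occurrences g X i j k) P ∧
      P[occurrences g X i j k | obsSigma X] =ᵐ[P]
        fun ω => expOccurrences g π T (obs X ω) i j k := by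
  have hZ : ∀ n, Integrable
      (fun ω => ((jumpTimes g (fun t => X n t ω) (Sum.inl i) j k).ncard : ℝ)) P := by
    intro n
    obtain ⟨Q, hQ⟩ := (hX n).exists_hasLaw
    exact hQ.integrable_jumpTimes hT hπ (habs n) hij k
  simp only [expOccurrences_eq_sum]
  refine ⟨integrable_finsetSum _ fun n _ => hZ n, condExp_sum_ae_eq hZ fun n => ?_⟩
  exact condExp_path_statistic hT hπ hX hindep habs n (hZ n)
    (fun ω => Nat.cast_nonneg _) (F := fun π x => numOccurrences g π T i k x j)
    (measurable_numOccurrences i k j) (fun x hx => numOccurrences_nonneg hT hπ k hx hij)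
    (fun c x => numOccurrences_smul c i k x j)
    fun P' _ π' Q hπ' hQ r => hQ.lintegral_jumpTimes_eq_num hT hπ' hij k r

end Statistics

/-! ### The complete-data log-likelihood -/

section LogLikelihood

variable {p K : ℕ}

/-- The complete-data log-likelihood, linear in the statistics. -/
noncomputable def completeLogLikelihood (ϖ : Fin p → ℝ) (T : Fin K → Matrix (Fin p) (Fin p) ℝ)
    (B : Fin p → ℝ) (E : Fin p → Fin K → ℝ) (O : Fin p → State p → Fin K → ℝ) : ℝ :=
  ∑ i, B i * Real.log (ϖ i) +
    ∑ k, ∑ i : Fin p, ∑ j ∈ Finset.univ.erase (Sum.inl i : State p),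
      (O i j k * Real.log (intensity (T k) (Sum.inl i) j) -
        E i k * intensity (T k) (Sum.inl i) j)

theorem log_rpow_of_ne_zero {a b : ℝ} (ha : 0 ≤ a) (h : a ^ b ≠ 0) :
    Real.log (a ^ b) = b * Real.log a := by
  rcases ha.eq_or_lt with rfl | ha
  · have hb : b = 0 := by
      by_contra hb
      exact h (Real.zero_rpow hb)
    simp [hb]
  · exact Real.log_rpow ha b

theorem rpow_ne_zero_iff_imp {a b : ℝ} (ha : 0 ≤ a) : a ^ b ≠ 0 ↔ (a = 0 → b = 0) := by
  rw [Ne, Real.rpow_eq_zero_iff_of_nonneg ha]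
  tauto

variable {ϖ : Fin p → ℝ} {T : Fin K → Matrix (Fin p) (Fin p) ℝ} {B : Fin p → ℝ}
  {E : Fin p → Fin K → ℝ} {O : Fin p → State p → Fin K → ℝ}

theorem completeLikelihood_ne_zero_iff (hϖ : ∀ i, 0 ≤ ϖ i) (hT : ∀ k, IsSubIntensity (T k)) :
    completeLikelihood ϖ T B E O ≠ 0 ↔ (∀ i, ϖ i = 0 → B i = 0) ∧
      ∀ k i j, j ≠ Sum.inl i → intensity (T k) (Sum.inl i) j = 0 → O i j k = 0 := by
  rw [completeLikelihood, mul_ne_zero_iff, initialLikelihood]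
  simp only [Finset.prod_ne_zero_iff, mul_ne_zero_iff, Finset.mem_univ, true_implies,
    Finset.mem_erase, and_true]
  refine and_congr (forall_congr' fun i => rpow_ne_zero_iff_imp (hϖ i)) ?_
  refine forall_congr' fun k => forall_congr' fun i => forall_congr' fun j =>
    imp_congr_right fun hj => ?_
  rw [rpow_ne_zero_iff_imp (intensity_nonneg (hT k) hj)]
  exact ⟨fun h => h.1, fun h => ⟨h, (Real.exp_pos _).ne'⟩⟩

/-- A nonzero likelihood forces the exponent to vanish wherever the base does, so 0^0 = 1 and the
term 0·log 0 = 0 match, and the linear formula holds on the boundary too. -/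
theorem log_completeLikelihood (hϖ : ∀ i, 0 ≤ ϖ i) (hT : ∀ k, IsSubIntensity (T k))
    (h : completeLikelihood ϖ T B E O ≠ 0) :
    Real.log (completeLikelihood ϖ T B E O) = completeLogLikelihood ϖ T B E O := by
  have h' := (completeLikelihood_ne_zero_iff hϖ hT).1 h
  have h1 : ∀ i, ϖ i ^ B i ≠ 0 := fun i => (rpow_ne_zero_iff_imp (hϖ i)).2 (h'.1 i)
  have h2 : ∀ k (i : Fin p), ∀ j ∈ Finset.univ.erase (Sum.inl i : State p),
      intensity (T k) (Sum.inl i) j ^ O i j k ≠ 0 := fun k i j hj =>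
    (rpow_ne_zero_iff_imp (intensity_nonneg (hT k) (Finset.ne_of_mem_erase hj))).2
      (h'.2 k i j (Finset.ne_of_mem_erase hj))
  have h3 : ∀ k (i : Fin p), ∀ j ∈ Finset.univ.erase (Sum.inl i : State p),
      intensity (T k) (Sum.inl i) j ^ O i j k *
        Real.exp (-(E i k * intensity (T k) (Sum.inl i) j)) ≠ 0 := fun k i j hj =>
    mul_ne_zero (h2 k i j hj) (Real.exp_pos _).ne'
  have h4 : ∀ k (i : Fin p), ∏ j ∈ Finset.univ.erase (Sum.inl i : State p),
      intensity (T k) (Sum.inl i) j ^ O i j k *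
        Real.exp (-(E i k * intensity (T k) (Sum.inl i) j)) ≠ 0 := fun k i =>
    Finset.prod_ne_zero_iff.2 (h3 k i)
  rw [completeLikelihood, initialLikelihood, completeLogLikelihood,
    Real.log_mul (Finset.prod_ne_zero_iff.2 fun i _ => h1 i)
      (Finset.prod_ne_zero_iff.2 fun k _ => Finset.prod_ne_zero_iff.2 fun i _ => h4 k i),
    Real.log_prod fun i _ => h1 i,
    Real.log_prod fun k _ => Finset.prod_ne_zero_iff.2 fun i _ => h4 k i]
  congr 1
  · exact Finset.sum_congr rfl fun i _ => log_rpow_of_ne_zero (hϖ i) (h1 i)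
  · refine Finset.sum_congr rfl fun k _ => ?_
    rw [Real.log_prod fun i _ => h4 k i]
    refine Finset.sum_congr rfl fun i _ => ?_
    rw [Real.log_prod (h3 k i)]
    refine Finset.sum_congr rfl fun j hj => ?_
    rw [Real.log_mul (h2 k i j hj) (Real.exp_pos _).ne', Real.log_exp,
      log_rpow_of_ne_zero (intensity_nonneg (hT k) (Finset.ne_of_mem_erase hj)) (h2 k i j hj)]
    ring

/-- The expected complete-data log-likelihood, given any σ-algebra. -/
theorem condExp_log_completeLikelihood {Ω : Type*} {m m0 : MeasurableSpace Ω} {P : Measure Ω}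
    (hϖ : ∀ i, 0 ≤ ϖ i) (hT : ∀ k, IsSubIntensity (T k))
    {B B' : Fin p → Ω → ℝ} {E E' : Fin p → Fin K → Ω → ℝ} {O O' : Fin p → State p → Fin K → Ω → ℝ}
    (hB : ∀ i, Integrable (B i) P ∧ P[B i | m] =ᵐ[P] B' i)
    (hE : ∀ i k, Integrable (E i k) P ∧ P[E i k | m] =ᵐ[P] E' i k)
    (hO : ∀ i j k, j ≠ Sum.inl i → Integrable (O i j k) P ∧ P[O i j k | m] =ᵐ[P] O' i j k)
    (hpos : ∀ᵐ ω ∂P, 0 < completeLikelihood ϖ T (fun i => B i ω) (fun i k => E i k ω)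
      (fun i j k => O i j k ω)) :
    Integrable (fun ω => Real.log (completeLikelihood ϖ T (fun i => B i ω) (fun i k => E i k ω)
      (fun i j k => O i j k ω))) P ∧
    P[fun ω => Real.log (completeLikelihood ϖ T (fun i => B i ω) (fun i k => E i k ω)
      (fun i j k => O i j k ω)) | m] =ᵐ[P] fun ω => Real.log (completeLikelihood ϖ T
        (fun i => B' i ω) (fun i k => E' i k ω) (fun i j k => O' i j k ω)) := by
  have hne : ∀ᵐ ω ∂P, (∀ i, ϖ i = 0 → B i ω = 0) ∧
      ∀ k i j, j ≠ Sum.inl i → intensity (T k) (Sum.inl i) j = 0 → O i j k ω = 0 := by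
    filter_upwards [hpos] with ω hω
    exact (completeLikelihood_ne_zero_iff hϖ hT).1 hω.ne'
  -- Carries the support condition from the statistics to their conditional expectations, so the
  -- likelihood at the latter is also nonzero and its logarithm is linear.
  have hzero : ∀ {Z Z' : Ω → ℝ}, P[Z | m] =ᵐ[P] Z' → Z =ᵐ[P] 0 → ∀ᵐ ω ∂P, Z' ω = 0 := by
    intro Z Z' h1 h2
    have h3 : P[Z | m] =ᵐ[P] 0 := by
      refine (condExp_congr_ae h2).trans ?_
      rw [condExp_zero]
    filter_upwards [h1, h3] with ω h4 h5
    rw [← h4, h5]; rfl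
  have hne' : ∀ᵐ ω ∂P, (∀ i, ϖ i = 0 → B' i ω = 0) ∧
      ∀ k i j, j ≠ Sum.inl i → intensity (T k) (Sum.inl i) j = 0 → O' i j k ω = 0 := by
    refine Eventually.and ?_ ?_
    · refine ae_all_iff.2 fun i => ?_
      by_cases hi : ϖ i = 0
      · filter_upwards [hzero (hB i).2 (by filter_upwards [hne] with ω hω using hω.1 i hi)]
          with ω hω _ using hω
      · exact Eventually.of_forall fun ω h => absurd h hi
    · refine ae_all_iff.2 fun k => ae_all_iff.2 fun i => ae_all_iff.2 fun j => ?_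
      by_cases hj : j ≠ Sum.inl i ∧ intensity (T k) (Sum.inl i) j = 0
      · filter_upwards [hzero (hO i j k hj.1).2
          (by filter_upwards [hne] with ω hω using hω.2 k i j hj.1 hj.2)] with ω hω _ _ using hω
      · exact Eventually.of_forall fun ω h1 h2 => absurd ⟨h1, h2⟩ hj
  have hlog : (fun ω => Real.log (completeLikelihood ϖ T (fun i => B i ω) (fun i k => E i k ω)
      (fun i j k => O i j k ω))) =ᵐ[P] fun ω => completeLogLikelihood ϖ T (fun i => B i ω)
        (fun i k => E i k ω) (fun i j k => O i j k ω) := by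
    filter_upwards [hpos] with ω hω
    exact log_completeLikelihood hϖ hT hω.ne'
  have hlog' : (fun ω => Real.log (completeLikelihood ϖ T (fun i => B' i ω)
      (fun i k => E' i k ω) (fun i j k => O' i j k ω))) =ᵐ[P] fun ω =>
        completeLogLikelihood ϖ T (fun i => B' i ω)
        (fun i k => E' i k ω) (fun i j k => O' i j k ω) := by
    filter_upwards [hne'] with ω hω
    exact log_completeLikelihood hϖ hT ((completeLikelihood_ne_zero_iff hϖ hT).2 hω)
  -- integrability and conditional expectation are preserved by linear combinations
  let Good : (Ω → ℝ) → (Ω → ℝ) → Prop := fun Z Z' => Integrable Z P ∧ P[Z | m] =ᵐ[P] Z'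
  have hsum : ∀ {ι : Type} (s : Finset ι) (Z Z' : ι → Ω → ℝ), (∀ a ∈ s, Good (Z a) (Z' a)) →
      Good (fun ω => ∑ a ∈ s, Z a ω) (fun ω => ∑ a ∈ s, Z' a ω) := by
    intro ι s Z Z' h
    refine ⟨integrable_finsetSum _ fun a ha => (h a ha).1, ?_⟩
    have h1 : (fun ω => ∑ a ∈ s, Z a ω) = ∑ a ∈ s, Z a := by ext ω; simp
    rw [h1]
    refine (condExp_finsetSum (fun a ha => (h a ha).1) m).trans ?_
    filter_upwards [(Finset.eventually_all s).2 fun a ha => (h a ha).2] with ω hω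
    rw [Finset.sum_apply]
    exact Finset.sum_congr rfl fun a ha => hω a ha
  have hmul : ∀ {Z Z' : Ω → ℝ} (c : ℝ), Good Z Z' →
      Good (fun ω => Z ω * c) (fun ω => Z' ω * c) := by
    intro Z Z' c h
    refine ⟨h.1.mul_const c, ?_⟩
    have h1 : (fun ω => Z ω * c) = c • Z := by ext ω; simp [mul_comm]
    rw [h1]
    refine (condExp_smul c Z m).trans ?_
    filter_upwards [h.2] with ω hω
    rw [Pi.smul_apply, hω, smul_eq_mul, mul_comm]
  have hadd : ∀ {Z Z' W W' : Ω → ℝ}, Good Z Z' → Good W W' →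
      Good (fun ω => Z ω + W ω) (fun ω => Z' ω + W' ω) := by
    intro Z Z' W W' h1 h2
    refine ⟨h1.1.add h2.1, (condExp_add h1.1 h2.1 m).trans ?_⟩
    filter_upwards [h1.2, h2.2] with ω h3 h4
    rw [Pi.add_apply, h3, h4]
  have hsub : ∀ {Z Z' W W' : Ω → ℝ}, Good Z Z' → Good W W' →
      Good (fun ω => Z ω - W ω) (fun ω => Z' ω - W' ω) := by
    intro Z Z' W W' h1 h2
    refine ⟨h1.1.sub h2.1, (condExp_sub h1.1 h2.1 m).trans ?_⟩
    filter_upwards [h1.2, h2.2] with ω h3 h4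
    rw [Pi.sub_apply, h3, h4]
  have hgood : Good (fun ω => completeLogLikelihood ϖ T (fun i => B i ω)
        (fun i k => E i k ω) (fun i j k => O i j k ω)) (fun ω => completeLogLikelihood ϖ T
        (fun i => B' i ω) (fun i k => E' i k ω) (fun i j k => O' i j k ω)) := by
    refine hadd (hsum _ _ _ fun i _ => hmul _ (hB i)) (hsum _ _ _ fun k _ => hsum _ _ _ fun i _ =>
      hsum _ _ _ fun j hj => hsub (hmul _ (hO i j k (Finset.ne_of_mem_erase hj)))
        (hmul _ (hE i k)))
  exact ⟨hgood.1.congr hlog.symm, (condExp_congr_ae hlog).trans (hgood.2.trans hlog'.symm)⟩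

end LogLikelihood

end IPH

namespace IPH

/-! ### Support of the expected statistics -/

section Support

variable {N p K : ℕ} {g : Grid K} {T : Fin K → Matrix (Fin p) (Fin p) ℝ} {π : Fin p → ℝ}
  {Q : ℝ → ℝ → Matrix (State p) (State p) ℝ}

theorem intensity_ne_zero_of_numOccurrences_ne_zero {i : Fin p} {k : Fin K} {x : ℝ} {j : State p}
    (h : numOccurrences g π T i k x j ≠ 0) : intensity (T k) (Sum.inl i) j ≠ 0 := by
  intro h0
  apply h
  cases j with
  | inl j =>
    rw [intensity_inl_inl] at h0
    simp [numOccurrences, h0]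
  | inr u =>
    rw [intensity_inl_inr] at h0
    by_cases hx : x ∈ g.cell k
    · simp [numOccurrences, g.index_eq_of_mem_cell hx, h0]
    · simp [numOccurrences, hx]

/-- A positive transition rate makes the transition probabilities over short intervals positive. -/
theorem IsTransitionFunction.eventually_subTrans_pos
    (hQ : IsTransitionFunction (g.intensityFun T) Q) (hT : ∀ k, IsSubIntensity (T k))
    {i j : Fin p} {k : Fin K} {u : ℝ} (hu : u ∈ g.cell k) (hij : i ≠ j) (h : 0 < T k i j) :
    ∀ᶠ c in 𝓝[<] u, 0 < subTrans g T c u i j := by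
  obtain ⟨L, hL, -, -, -, -, hQL⟩ := hQ.exists_bounds hT
  -- Within the cell the transition probability is (u−c)·T k i j up to an error L(u−c)²; this
  -- condition makes the first-order term win.
  have h1 : ∀ᶠ c in 𝓝[<] u, L * (u - c) < T k i j := by
    have h2 : Tendsto (fun c : ℝ => L * (u - c)) (𝓝[<] u) (𝓝 (L * (u - u))) :=
      (Continuous.tendsto (by fun_prop) u).mono_left nhdsWithin_le_nhds
    refine h2.eventually_lt_const ?_
    simpa using h
  have h3 : ∀ᶠ c in 𝓝[<] u, g.left k < c :=
    nhdsWithin_le_nhds (lt_mem_nhds (g.mem_cell.1 hu).1)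
  filter_upwards [h1, h3, self_mem_nhdsWithin] with c hc1 hc2 (hc3 : c < u)
  have hc0 : 0 ≤ c := (g.left_nonneg k).trans hc2.le
  have h4 := hQL c u hc0 hc3.le (Sum.inl i) (Sum.inl j)
  have h5 : ∫ v in c..u, g.intensityFun T v (Sum.inl i) (Sum.inl j) = (u - c) * T k i j := by
    rw [intervalIntegral.integral_congr_ae (g := fun _ => T k i j)]
    · simp
    · refine Eventually.of_forall fun v hv => ?_
      rw [Set.uIoc_of_le hc3.le] at hv
      have hv' : v ∈ g.cell k := g.mem_cell.2 ⟨hc2.trans hv.1,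
        le_trans (by exact_mod_cast hv.2) hu.2⟩
      rw [Grid.intensityFun, g.index_eq_of_mem_cell hv', intensity_inl_inl]
  rw [h5, hQ.apply_inl_inl hc0 hc3.le,
    Matrix.one_apply_ne (fun h => hij (Sum.inl_injective h)), sub_zero] at h4
  have h6 := (abs_le.1 h4).1
  have h7 : 0 < (u - c) * (T k i j - L * (u - c)) :=
    mul_pos (sub_pos.2 hc3) (sub_pos.2 hc1)
  nlinarith

/-- By Chapman–Kolmogorov the right-hand side is a sum of nonnegative terms, of which one is kept.
-/
theorem IsTransitionFunction.mul_backwardVec_le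
    (hQ : IsTransitionFunction (g.intensityFun T) Q) (hT : ∀ k, IsSubIntensity (T k))
    {c u x : ℝ} (hc : 0 ≤ c) (hcu : c ≤ u) (hux : u ≤ x) (i j : Fin p) :
    subTrans g T c u i j * backwardVec g T u x j ≤ backwardVec g T c x i := by
  have h : backwardVec g T c x = subTrans g T c u *ᵥ backwardVec g T u x := by
    rw [backwardVec, backwardVec, Matrix.mulVec_mulVec, hQ.subTrans_mul hc hcu hux]
  rw [h]
  exact Finset.single_le_sum (f := fun j => subTrans g T c u i j * backwardVec g T u x j)
    (fun l _ => mul_nonneg (subTrans_nonneg hT hc hcu i l)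
      (backwardVec_nonneg hT (hc.trans hcu) hux l)) (Finset.mem_univ j)

theorem IsTransitionFunction.numExposure_pos
    (hQ : IsTransitionFunction (g.intensityFun T) Q) (hT : ∀ k, IsSubIntensity (T k))
    (hπ : ∀ i, 0 ≤ π i) {i : Fin p} {k : Fin K} {x c : ℝ} (hx : 0 ≤ x)
    (hlt : g.leftMin k x < g.rightMin k x) (hc : c ∈ Set.Icc (g.leftMin k x) (g.rightMin k x))
    (hF : 0 < forwardVec g π T c i) (hB : 0 < backwardVec g T c x i) :
    0 < numExposure g π T i k x := by
  have ha := g.leftMin_nonneg k hx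
  have hsub : Set.Icc (g.leftMin k x) (g.rightMin k x) ⊆ Set.Icc 0 x :=
    Set.Icc_subset_Icc ha (g.rightMin_le k x)
  refine intervalIntegral.integral_pos hlt
    (((hQ.continuousOn_forwardVec hT x i).mono hsub).mul
      ((hQ.continuousOn_backwardVec hT x i).mono hsub)) ?_ ⟨c, hc, mul_pos hF hB⟩
  intro u hu
  have hu' := hsub ⟨hu.1.le, hu.2⟩
  exact mul_nonneg (forwardVec_nonneg hT hπ hu'.1 i) (backwardVec_nonneg hT hu'.1 hu'.2 i)

/-- If a jump from `i` to `j` at `u` is possible, then shortly before `u` the path can already be in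
`i` (continuity of the forward vector) and can still move to `j` and be absorbed at `x` (positive
rate). The exposure integrand is thus positive at an earlier point of the window. For absorption the
point `x` itself serves, where the backward vector is the exit rate. -/
theorem IsTransitionFunction.numExposure_pos_of_numOccurrences_ne_zero
    (hQ : IsTransitionFunction (g.intensityFun T) Q) (hT : ∀ k, IsSubIntensity (T k))
    (hπ : ∀ i, 0 ≤ π i) {i : Fin p} {k : Fin K} {x : ℝ} (hx : 0 < x) {j : State p}
    (hij : j ≠ Sum.inl i) (h : numOccurrences g π T i k x j ≠ 0) :
    0 < numExposure g π T i k x := by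
  cases j with
  | inl j =>
    have hle := g.leftMin_le_rightMin k x
    obtain ⟨u, hu, hne⟩ : ∃ u ∈ Set.Ioc (g.leftMin k x) (g.rightMin k x),
        forwardVec g π T u i * T k i j * backwardVec g T u x j ≠ 0 := by
      by_contra! hall
      apply h
      rw [numOccurrences, intervalIntegral.integral_of_le hle,
        setIntegral_congr_fun measurableSet_Ioc hall]
      simp
    have huc : u ∈ g.cell k ∧ u ≤ x := by
      rw [← g.cell_inter_Iic] at hu; exact hu
    have hu0 := g.pos_of_mem_cell huc.1
    have hij' : i ≠ j := fun e => hij (e ▸ rfl)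
    have hF : 0 < forwardVec g π T u i :=
      (forwardVec_nonneg hT hπ hu0.le i).lt_of_ne' (left_ne_zero_of_mul (left_ne_zero_of_mul hne))
    have hTp : 0 < T k i j :=
      ((hT k).1 i j hij').lt_of_ne' (right_ne_zero_of_mul (left_ne_zero_of_mul hne))
    have hB : 0 < backwardVec g T u x j :=
      (backwardVec_nonneg hT hu0.le huc.2 j).lt_of_ne' (right_ne_zero_of_mul hne)
    have hcont : Tendsto (fun c => forwardVec g π T c i) (𝓝[<] u) (𝓝 (forwardVec g π T u i)) := by
      have h1 := hQ.continuousOn_forwardVec (π := π) hT u i u ⟨hu0.le, le_rfl⟩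
      refine h1.mono_left (nhdsWithin_le_of_mem ?_)
      filter_upwards [nhdsWithin_le_nhds (lt_mem_nhds hu0), self_mem_nhdsWithin]
        with c hc1 (hc2 : c < u) using ⟨hc1.le, hc2.le⟩
    have hleft : ∀ᶠ c in 𝓝[<] u, g.leftMin k x < c := nhdsWithin_le_nhds (lt_mem_nhds hu.1)
    have hlt : ∀ᶠ c in 𝓝[<] u, c < u := self_mem_nhdsWithin
    obtain ⟨c, hc1, hc2, hc3, hc4⟩ := ((hQ.eventually_subTrans_pos hT huc.1 hij' hTp).and
      ((hcont.eventually (lt_mem_nhds hF)).and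
        (hleft.and hlt))).exists
    have hc0 : 0 ≤ c := (g.leftMin_nonneg k hx.le).trans hc3.le
    exact hQ.numExposure_pos hT hπ hx.le (hu.1.trans_le hu.2) ⟨hc3.le, hc4.le.trans hu.2⟩ hc2
      ((mul_pos hc1 hB).trans_le (hQ.mul_backwardVec_le hT hc0 hc4.le huc.2 i j))
  | inr y =>
    rw [numOccurrences] at h
    have hxc : x ∈ g.cell k := by
      by_contra hxc
      exact left_ne_zero_of_mul h (Set.indicator_of_notMem hxc _)
    have hmem : x ∈ Set.Ioc (g.leftMin k x) (g.rightMin k x) := by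
      rw [← g.cell_inter_Iic]; exact ⟨hxc, le_refl x⟩
    have hne := right_ne_zero_of_mul h
    refine hQ.numExposure_pos hT hπ hx.le (hmem.1.trans_le hmem.2) ⟨hmem.1.le, hmem.2⟩
      ((forwardVec_nonneg hT hπ hx.le i).lt_of_ne' (left_ne_zero_of_mul hne)) ?_
    rw [backwardVec, subTrans_self, Matrix.one_mulVec]
    exact (exitRate_nonneg (hT _) i).lt_of_ne' (right_ne_zero_of_mul hne)

variable {x : Fin N → ℝ}

theorem expInitiations_nonneg (hT : ∀ k, IsSubIntensity (T k)) (hπ : ∀ i, 0 ≤ π i)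
    (hx : ∀ n, 0 ≤ x n) (i : Fin p) : 0 ≤ expInitiations g π T x i :=
  Finset.sum_nonneg fun n _ => div_nonneg (numInitiations_nonneg hT hπ i (hx n))
    (density_nonneg hT hπ (hx n))

theorem sum_expInitiations (hx : ∀ n, density g π T (x n) ≠ 0) :
    ∑ i, expInitiations g π T x i = N := by
  simp only [expInitiations]
  rw [Finset.sum_comm]
  simp only [← Finset.sum_div, ← density_eq_sum, div_self (hx _)]
  simp

theorem expExposure_nonneg (hT : ∀ k, IsSubIntensity (T k)) (hπ : ∀ i, 0 ≤ π i)
    (hx : ∀ n, 0 ≤ x n) (i : Fin p) (k : Fin K) : 0 ≤ expExposure g π T x i k :=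
  Finset.sum_nonneg fun n _ => div_nonneg (numExposure_nonneg hT hπ i k (hx n))
    (density_nonneg hT hπ (hx n))

theorem expOccurrences_nonneg (hT : ∀ k, IsSubIntensity (T k)) (hπ : ∀ i, 0 ≤ π i)
    (hx : ∀ n, 0 ≤ x n) {i : Fin p} {j : State p} (hij : j ≠ Sum.inl i) (k : Fin K) :
    0 ≤ expOccurrences g π T x i j k := by
  rw [expOccurrences_eq_sum]
  exact Finset.sum_nonneg fun n _ => div_nonneg (numOccurrences_nonneg hT hπ k (hx n) hij)
    (density_nonneg hT hπ (hx n))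

theorem exists_numOccurrences_ne_zero {i : Fin p} {j : State p} {k : Fin K}
    (h : expOccurrences g π T x i j k ≠ 0) : ∃ n, numOccurrences g π T i k (x n) j ≠ 0 := by
  rw [expOccurrences_eq_sum] at h
  obtain ⟨n, -, hn⟩ := Finset.exists_ne_zero_of_sum_ne_zero h
  exact ⟨n, fun h0 => hn (by rw [h0, zero_div])⟩

theorem intensity_ne_zero_of_expOccurrences_ne_zero {i : Fin p} {j : State p} {k : Fin K}
    (h : expOccurrences g π T x i j k ≠ 0) : intensity (T k) (Sum.inl i) j ≠ 0 := by
  obtain ⟨n, hn⟩ := exists_numOccurrences_ne_zero h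
  exact intensity_ne_zero_of_numOccurrences_ne_zero hn

theorem IsTransitionFunction.expExposure_pos_of_expOccurrences_ne_zero
    (hQ : IsTransitionFunction (g.intensityFun T) Q) (hT : ∀ k, IsSubIntensity (T k))
    (hπ : ∀ i, 0 ≤ π i) (hx : ∀ n, 0 < x n ∧ 0 < density g π T (x n)) {i : Fin p} {j : State p}
    (hij : j ≠ Sum.inl i) {k : Fin K} (h : expOccurrences g π T x i j k ≠ 0) :
    0 < expExposure g π T x i k := by
  obtain ⟨n, hn⟩ := exists_numOccurrences_ne_zero h
  refine (div_pos (hQ.numExposure_pos_of_numOccurrences_ne_zero hT hπ (hx n).1 hij hn)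
    (hx n).2).trans_le ?_
  exact Finset.single_le_sum (f := fun n => numExposure g π T i k (x n) / density g π T (x n))
    (fun m _ => div_nonneg (numExposure_nonneg hT hπ i k (hx m).1.le) (hx m).2.le)
    (Finset.mem_univ n)

end Support

/-! ### Maximization of the complete-data likelihood -/

section Maximization

variable {p K : ℕ}

/-- The factor of the complete-data likelihood that depends on the intensities. -/
noncomputable def rateLikelihood (T : Fin K → Matrix (Fin p) (Fin p) ℝ)
    (E : Fin p → Fin K → ℝ) (O : Fin p → State p → Fin K → ℝ) : ℝ :=
  ∏ k, ∏ i : Fin p, ∏ j ∈ Finset.univ.erase (Sum.inl i : State p),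
    intensity (T k) (Sum.inl i) j ^ O i j k *
      Real.exp (-(E i k * intensity (T k) (Sum.inl i) j))

theorem rateLikelihood_nonneg {T : Fin K → Matrix (Fin p) (Fin p) ℝ}
    (hT : ∀ k, IsSubIntensity (T k)) (E : Fin p → Fin K → ℝ) (O : Fin p → State p → Fin K → ℝ) :
    0 ≤ rateLikelihood T E O :=
  Finset.prod_nonneg fun k _ => Finset.prod_nonneg fun _ _ => Finset.prod_nonneg fun _ hj =>
    mul_nonneg (Real.rpow_nonneg (intensity_nonneg (hT k) (Finset.ne_of_mem_erase hj)) _)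
      (Real.exp_pos _).le

theorem rateLikelihood_pos {T : Fin K → Matrix (Fin p) (Fin p) ℝ}
    (hT : ∀ k, IsSubIntensity (T k)) {E : Fin p → Fin K → ℝ} {O : Fin p → State p → Fin K → ℝ}
    (h : ∀ i j k, j ≠ Sum.inl i → O i j k ≠ 0 → intensity (T k) (Sum.inl i) j ≠ 0) :
    0 < rateLikelihood T E O := by
  refine Finset.prod_pos fun k _ => Finset.prod_pos fun i _ => Finset.prod_pos fun j hj => ?_
  have hj' := Finset.ne_of_mem_erase hj
  refine mul_pos ((Real.rpow_nonneg (intensity_nonneg (hT k) hj') _).lt_of_ne' ?_)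
    (Real.exp_pos _)
  refine (rpow_ne_zero_iff_imp (intensity_nonneg (hT k) hj')).2 fun h0 => ?_
  by_contra hO
  exact h i j k hj' hO h0

/-- The factor is the product of E^O/Γ(O+1), free of the parameters. It is positive because E = 0
occurs only with O = 0, where 0^0 = 1. -/
theorem exists_poissonLikelihood_eq {E : Fin p → Fin K → ℝ} {O : Fin p → State p → Fin K → ℝ}
    (hE : ∀ i k, 0 ≤ E i k) (hO : ∀ i j k, j ≠ Sum.inl i → 0 ≤ O i j k)
    (hEO : ∀ i j k, j ≠ Sum.inl i → O i j k ≠ 0 → 0 < E i k) :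
    ∃ c : ℝ, 0 < c ∧ ∀ T : Fin K → Matrix (Fin p) (Fin p) ℝ, (∀ k, IsSubIntensity (T k)) →
      poissonLikelihood T E O = c * rateLikelihood T E O := by
  refine ⟨∏ k, ∏ i : Fin p, ∏ j ∈ Finset.univ.erase (Sum.inl i : State p),
    E i k ^ O i j k / Real.Gamma (O i j k + 1), ?_, fun T hT => ?_⟩
  · refine Finset.prod_pos fun k _ => Finset.prod_pos fun i _ => Finset.prod_pos fun j hj => ?_
    have hj' := Finset.ne_of_mem_erase hj
    refine div_pos ((Real.rpow_nonneg (hE i k) _).lt_of_ne' ?_)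
      (Real.Gamma_pos_of_pos (by linarith [hO i j k hj']))
    refine (rpow_ne_zero_iff_imp (hE i k)).2 fun h0 => ?_
    by_contra h
    exact (hEO i j k hj' h).ne' h0
  · simp only [poissonLikelihood, rateLikelihood, ← Finset.prod_mul_distrib]
    refine Finset.prod_congr rfl fun k _ => Finset.prod_congr rfl fun i _ =>
      Finset.prod_congr rfl fun j hj => ?_
    rw [Real.mul_rpow (hE i k) (intensity_nonneg (hT k) (Finset.ne_of_mem_erase hj))]
    ring

theorem initialLikelihood_nonneg {ϖ : Fin p → ℝ} (hϖ : ∀ i, 0 ≤ ϖ i) (B : Fin p → ℝ) :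
    0 ≤ initialLikelihood ϖ B :=
  Finset.prod_nonneg fun i _ => Real.rpow_nonneg (hϖ i) _

theorem initialLikelihood_ne_zero_iff {ϖ B : Fin p → ℝ} (hϖ : ∀ i, 0 ≤ ϖ i) :
    initialLikelihood ϖ B ≠ 0 ↔ ∀ i, ϖ i = 0 → B i = 0 := by
  simp [initialLikelihood, Finset.prod_ne_zero_iff, -ne_eq, rpow_ne_zero_iff_imp, hϖ]

theorem log_initialLikelihood {ϖ B : Fin p → ℝ} (hϖ : ∀ i, 0 ≤ ϖ i)
    (h : initialLikelihood ϖ B ≠ 0) :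
    Real.log (initialLikelihood ϖ B) = ∑ i, B i * Real.log (ϖ i) := by
  have h1 : ∀ i, ϖ i ^ B i ≠ 0 := fun i =>
    (rpow_ne_zero_iff_imp (hϖ i)).2 ((initialLikelihood_ne_zero_iff hϖ).1 h i)
  rw [initialLikelihood, Real.log_prod fun i _ => h1 i]
  exact Finset.sum_congr rfl fun i _ => log_rpow_of_ne_zero (hϖ i) (h1 i)

/-- The strict inequality log z < z − 1 at z = w/b ≠ 1; for b = 0 it reduces to 0 < w. -/
theorem mul_log_div_lt {b w : ℝ} (hb : 0 ≤ b) (hw : 0 ≤ w) (h : w = 0 → b = 0) (hne : w ≠ b) :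
    b * Real.log w < b * Real.log b + (w - b) := by
  rcases hb.eq_or_lt with rfl | hb
  · simpa using hw.lt_of_ne' hne
  · have hw' : 0 < w := hw.lt_of_ne' fun h0 => hb.ne' (h h0)
    have h1 := Real.log_lt_sub_one_of_pos (div_pos hw' hb)
      fun h1 => hne ((div_eq_one_iff_eq hb.ne').1 h1)
    rw [Real.log_div hw'.ne' hb.ne'] at h1
    have h2 := mul_lt_mul_of_pos_left h1 hb
    have h3 : b * (w / b - 1) = w - b := by field_simp
    linarith

/-- Gibbs' inequality: the proportions are the unique maximizer of the multinomial likelihood. -/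
theorem initialLikelihood_lt {q ϖ : Fin p → ℝ} {c : ℝ} (hc : 0 < c)
    (hq : q ∈ stdSimplex ℝ (Fin p)) (hϖ : ϖ ∈ stdSimplex ℝ (Fin p)) (hne : ϖ ≠ q) :
    initialLikelihood ϖ (fun i => c * q i) < initialLikelihood q (fun i => c * q i) := by
  have hq0 : initialLikelihood q (fun i => c * q i) ≠ 0 :=
    (initialLikelihood_ne_zero_iff hq.1).2 fun i h => by simp [h]
  have hqpos := (initialLikelihood_nonneg hq.1 _).lt_of_ne' hq0
  by_cases h0 : initialLikelihood ϖ (fun i => c * q i) = 0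
  · rwa [h0]
  have h0' := (initialLikelihood_ne_zero_iff hϖ.1).1 h0
  have hsupp : ∀ i, ϖ i = 0 → q i = 0 := fun i hi => by
    simpa [hc.ne'] using h0' i hi
  rw [← Real.log_lt_log_iff ((initialLikelihood_nonneg hϖ.1 _).lt_of_ne' h0) hqpos,
    log_initialLikelihood hϖ.1 h0, log_initialLikelihood hq.1 hq0]
  simp only [mul_assoc, ← Finset.mul_sum]
  refine mul_lt_mul_of_pos_left ?_ hc
  -- The linear corrections ϖ i − q i sum to zero, both vectors having total mass one.
  have h1 : ∑ i, q i * Real.log (ϖ i) < ∑ i, (q i * Real.log (q i) + (ϖ i - q i)) := by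
    obtain ⟨i, hi⟩ := Function.ne_iff.1 hne
    refine Finset.sum_lt_sum (fun l _ => ?_)
      ⟨i, Finset.mem_univ i, mul_log_div_lt (hq.1 i) (hϖ.1 i) (hsupp i) hi⟩
    by_cases hl : ϖ l = q l
    · simp [hl]
    · exact (mul_log_div_lt (hq.1 l) (hϖ.1 l) (hsupp l) hl).le
  rwa [Finset.sum_add_distrib, Finset.sum_sub_distrib, hϖ.2, hq.2, sub_self, add_zero] at h1

/-- The maximizers of the complete-data likelihood: proportions for the initial distribution,
Poisson regression for the intensities. -/
theorem isMax_completeLikelihood_iff {Θ : Type*} {T : Θ → Fin K → Matrix (Fin p) (Fin p) ℝ}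
    (hT : ∀ θ k, IsSubIntensity (T θ k)) {B : Fin p → ℝ} {E : Fin p → Fin K → ℝ}
    {O : Fin p → State p → Fin K → ℝ} {c : ℝ} (hc : 0 < c) (hB : ∀ i, 0 ≤ B i)
    (hBc : ∑ i, B i = c) (hE : ∀ i k, 0 ≤ E i k) (hO : ∀ i j k, j ≠ Sum.inl i → 0 ≤ O i j k)
    (hEO : ∀ i j k, j ≠ Sum.inl i → O i j k ≠ 0 → 0 < E i k) {θ₀ : Θ}
    (hOT : ∀ i j k, j ≠ Sum.inl i → O i j k ≠ 0 → intensity (T θ₀ k) (Sum.inl i) j ≠ 0)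
    {ϖ : Fin p → ℝ} (hϖ : ϖ ∈ stdSimplex ℝ (Fin p)) (θ : Θ) :
    (∀ ϖ' ∈ stdSimplex ℝ (Fin p), ∀ θ' : Θ,
      completeLikelihood ϖ' (T θ') B E O ≤ completeLikelihood ϖ (T θ) B E O) ↔
    (∀ i, ϖ i = B i / c) ∧
      ∀ θ' : Θ, poissonLikelihood (T θ') E O ≤ poissonLikelihood (T θ) E O := by
  obtain ⟨d, hd, hP⟩ := exists_poissonLikelihood_eq hE hO hEO
  have hC : ∀ ϖ T, completeLikelihood ϖ T B E O = initialLikelihood ϖ B * rateLikelihood T E O :=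
    fun _ _ => rfl
  have hR0 : ∀ θ, 0 ≤ rateLikelihood (T θ) E O := fun θ => rateLikelihood_nonneg (hT θ) E O
  have hRpos : 0 < rateLikelihood (T θ₀) E O := rateLikelihood_pos (hT θ₀) hOT
  set q : Fin p → ℝ := fun i => B i / c with hq
  have hqs : q ∈ stdSimplex ℝ (Fin p) := by
    refine ⟨fun i => div_nonneg (hB i) hc.le, ?_⟩
    rw [hq, ← Finset.sum_div, hBc, div_self hc.ne']
  have hBq : B = fun i => c * q i := by
    ext i; rw [hq]; field_simp
  have hIlt : ∀ ϖ ∈ stdSimplex ℝ (Fin p), ϖ ≠ q → initialLikelihood ϖ B < initialLikelihood q B := by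
    intro ϖ hϖ hne
    rw [hBq]
    exact initialLikelihood_lt hc hqs hϖ hne
  have hIpos : 0 < initialLikelihood q B := by
    refine (initialLikelihood_nonneg hqs.1 B).lt_of_ne' ?_
    refine (initialLikelihood_ne_zero_iff hqs.1).2 fun i hi => ?_
    rw [hBq]; simp [hi]
  simp only [hC, hP _ (hT _)]
  constructor
  · intro h
    -- Comparison with the proportions and the current parameter makes the maximum positive. Without
    -- this a vanishing rate factor would leave `ϖ` undetermined.
    have hval : 0 < initialLikelihood ϖ B * rateLikelihood (T θ) E O :=
      (mul_pos hIpos hRpos).trans_le (h q hqs θ₀)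
    have hR : 0 < rateLikelihood (T θ) E O :=
      (hR0 θ).lt_of_ne' (right_ne_zero_of_mul hval.ne')
    have hI : 0 < initialLikelihood ϖ B :=
      (initialLikelihood_nonneg hϖ.1 B).lt_of_ne' (left_ne_zero_of_mul hval.ne')
    refine ⟨fun i => ?_, fun θ' => ?_⟩
    · by_contra hi
      have h1 := hIlt ϖ hϖ fun e => hi (congrFun e i)
      exact (mul_lt_mul_of_pos_right h1 hR).not_ge (h q hqs θ)
    · exact mul_le_mul_of_nonneg_left (le_of_mul_le_mul_left (h ϖ hϖ θ') hI) hd.le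
  · rintro ⟨h1, h2⟩ ϖ' hϖ' θ'
    have hϖq : ϖ = q := funext h1
    rw [hϖq]
    refine mul_le_mul ?_ (le_of_mul_le_mul_left (h2 θ') hd) (hR0 θ') hIpos.le
    by_cases he : ϖ' = q
    · rw [he]
    · exact (hIlt ϖ' hϖ' he).le

end Maximization

end IPH

theorem mainTheorem3
    {Ω Θ : Type*} [MeasurableSpace Ω] (P : Measure Ω) [IsProbabilityMeasure P]
    {p K N : ℕ} (hN : 0 < N) (g : IPH.Grid K)
    (T : Θ → Fin K → Matrix (Fin p) (Fin p) ℝ)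
    (hT : ∀ θ k, IPH.IsSubIntensity (T θ k))
    -- the current parameter, under which `P` governs the process
    (π : Fin p → ℝ) (hπ : π ∈ stdSimplex ℝ (Fin p)) (θ₀ : Θ)
    -- `N` i.i.d. Markov jump processes, almost surely absorbed in finite time
    (X : Fin N → ℝ≥0 → Ω → IPH.State p)
    (hX : ∀ n, IPH.IsMarkovJumpProcess P (IPH.initialLaw π) (g.intensityFun (T θ₀)) (X n))
    (hindep : iIndepFun (fun n ω t => X n t ω) P)
    (habs : ∀ n, ∀ᵐ ω ∂P, IPH.absorptionTime (X n) ω < ∞) :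
    -- the observations are positive and the density is positive there
    (∀ᵐ ω ∂P, ∀ n, 0 < IPH.obs X ω n ∧ 0 < IPH.density g π (T θ₀) (IPH.obs X ω n)) ∧
    -- initiations
    (∀ i, Integrable (IPH.initiations X i) P ∧
      P[IPH.initiations X i | IPH.obsSigma X] =ᵐ[P]
        fun ω => IPH.expInitiations g π (T θ₀) (IPH.obs X ω) i) ∧
    -- local exposures
    (∀ i k, Integrable (IPH.exposure g X i k) P ∧
      P[IPH.exposure g X i k | IPH.obsSigma X] =ᵐ[P]
        fun ω => IPH.expExposure g π (T θ₀) (IPH.obs X ω) i k) ∧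
    -- occurrences of transitions between transient states
    (∀ i j k, j ≠ i → Integrable (IPH.occurrences g X i (Sum.inl j) k) P ∧
      P[IPH.occurrences g X i (Sum.inl j) k | IPH.obsSigma X] =ᵐ[P]
        fun ω => IPH.expOccurrences g π (T θ₀) (IPH.obs X ω) i (Sum.inl j) k) ∧
    -- occurrences of absorption
    (∀ i k, Integrable (IPH.occurrences g X i (IPH.absorbing p) k) P ∧
      P[IPH.occurrences g X i (IPH.absorbing p) k | IPH.obsSigma X] =ᵐ[P]
        fun ω => IPH.expOccurrences g π (T θ₀) (IPH.obs X ω) i (IPH.absorbing p) k) ∧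
    -- E-step: the conditional expected log-likelihood is the complete-data log-likelihood with the
    -- statistics replaced by the above conditional expectations
    (∀ ϖ ∈ stdSimplex ℝ (Fin p), ∀ θ : Θ,
      (∀ᵐ ω ∂P, 0 < IPH.completeLikelihood ϖ (T θ) (fun i => IPH.initiations X i ω)
        (fun i k => IPH.exposure g X i k ω) (fun i j k => IPH.occurrences g X i j k ω)) →
      Integrable (fun ω => Real.log (IPH.completeLikelihood ϖ (T θ)
        (fun i => IPH.initiations X i ω) (fun i k => IPH.exposure g X i k ω)
        (fun i j k => IPH.occurrences g X i j k ω))) P ∧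
      P[fun ω => Real.log (IPH.completeLikelihood ϖ (T θ)
        (fun i => IPH.initiations X i ω) (fun i k => IPH.exposure g X i k ω)
        (fun i j k => IPH.occurrences g X i j k ω)) | IPH.obsSigma X] =ᵐ[P]
        fun ω => Real.log (IPH.completeLikelihood ϖ (T θ)
          (IPH.expInitiations g π (T θ₀) (IPH.obs X ω))
          (IPH.expExposure g π (T θ₀) (IPH.obs X ω))
          (IPH.expOccurrences g π (T θ₀) (IPH.obs X ω)))) ∧
    -- M-step: maximizing it amounts to taking the proportions of the expected initiations and
    -- solving the Poisson regression of expected occurrences with expected exposures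
    (∀ x : Fin N → ℝ, (∀ n, 0 < x n ∧ 0 < IPH.density g π (T θ₀) (x n)) →
      ∀ ϖ ∈ stdSimplex ℝ (Fin p), ∀ θ : Θ,
        ((∀ ϖ' ∈ stdSimplex ℝ (Fin p), ∀ θ' : Θ,
          IPH.completeLikelihood ϖ' (T θ') (IPH.expInitiations g π (T θ₀) x)
              (IPH.expExposure g π (T θ₀) x) (IPH.expOccurrences g π (T θ₀) x) ≤
            IPH.completeLikelihood ϖ (T θ) (IPH.expInitiations g π (T θ₀) x)
              (IPH.expExposure g π (T θ₀) x) (IPH.expOccurrences g π (T θ₀) x)) ↔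
          (∀ i, ϖ i = IPH.expInitiations g π (T θ₀) x i / N) ∧
          ∀ θ' : Θ,
            IPH.poissonLikelihood (T θ') (IPH.expExposure g π (T θ₀) x)
                (IPH.expOccurrences g π (T θ₀) x) ≤
              IPH.poissonLikelihood (T θ) (IPH.expExposure g π (T θ₀) x)
                (IPH.expOccurrences g π (T θ₀) x))) := by
  have hX0 := hX ⟨0, hN⟩
  -- The M-step concerns deterministic data but uses a transition function to compare exposures with
  -- occurrences; since N ≥ 1, the law of one of the processes provides it.
  obtain ⟨Q, hQ, -⟩ := hX0.law
  have hN' : (0 : ℝ) < N := by exact_mod_cast hN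
  refine ⟨IPH.ae_obs_pos (hT θ₀) hπ.1 hX habs,
    IPH.condExp_initiations (hT θ₀) hπ.1 hX hindep habs,
    IPH.condExp_exposure (hT θ₀) hπ.1 hX hindep habs,
    fun i j k hij => IPH.condExp_occurrences (hT θ₀) hπ.1 hX hindep habs
      (fun h => hij (Sum.inl_injective h)) k,
    fun i k => IPH.condExp_occurrences (hT θ₀) hπ.1 hX hindep habs Sum.inr_ne_inl k,
    fun ϖ hϖ θ hpos => ?_, fun x hx ϖ hϖ θ => ?_⟩
  · exact IPH.condExp_log_completeLikelihood hϖ.1 (hT θ)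
      (B := IPH.initiations X) (E := IPH.exposure g X) (O := IPH.occurrences g X)
      (B' := fun i ω => IPH.expInitiations g π (T θ₀) (IPH.obs X ω) i)
      (E' := fun i k ω => IPH.expExposure g π (T θ₀) (IPH.obs X ω) i k)
      (O' := fun i j k ω => IPH.expOccurrences g π (T θ₀) (IPH.obs X ω) i j k)
      (IPH.condExp_initiations (hT θ₀) hπ.1 hX hindep habs)
      (IPH.condExp_exposure (hT θ₀) hπ.1 hX hindep habs)
      (fun i j k hij => IPH.condExp_occurrences (hT θ₀) hπ.1 hX hindep habs hij k) hpos
  · have hx0 : ∀ n, 0 ≤ x n := fun n => (hx n).1.le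
    exact IPH.isMax_completeLikelihood_iff hT hN'
      (IPH.expInitiations_nonneg (hT θ₀) hπ.1 hx0)
      (IPH.sum_expInitiations fun n => (hx n).2.ne')
      (IPH.expExposure_nonneg (hT θ₀) hπ.1 hx0)
      (fun i j k hij => IPH.expOccurrences_nonneg (hT θ₀) hπ.1 hx0 hij k)
      (fun i j k hij => hQ.expExposure_pos_of_expOccurrences_ne_zero (hT θ₀) hπ.1 hx hij)
      (θ₀ := θ₀) (fun i j k _ => IPH.intensity_ne_zero_of_expOccurrences_ne_zero) hϖ θ
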